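/- Let $(M^m,g)$, $(N^n,h)$, $(Q^l,k)$ be smooth Riemannian manifolds (without boundary), let $f:M\to(0,\infty)$ be smooth, and let $\Delta^M,\Delta^N$ be the Laplace--Beltrami operators. A $C^2$ function $v$ on an open subset of $M$ is called $f$-harmonic if $f\,\Delta^M v+g(\mathrm{grad}\,f,\mathrm{grad}\,v)=0$. A continuous map $\phi:M\to N$ is called an $f$-harmonic morphism if for every open $V\subseteq N$ with $\phi^{-1}(V)\neq\emptyset$ and every harmonic function $u$ on $V$ (that is, $u\in C^2(V)$, $\Delta^N u=0$), the function $u\circ\phi$ is $f$-harmonic on $\phi^{-1}(V)$. For a $C^2$ map $\phi$ between Riemannian manifolds, $\tau(\phi)=\mathrm{Tr}_g\nabla d\phi$ is its tension field and, for a map defined on $M$, $\tau_f(\phi)=f\,\tau(\phi)+d\phi(\mathrm{grad}\,f)$ is its $f$-tension field; a $C^2$ map is called harmonic if $\tau=0$ and $f$-harmonic if $\tau_f=0$. Let $\phi:(M,g)\to(N,h)$ be an $f$-harmonic morphism. Then $\phi$ is of class $C^2$ and horizontally weakly conformal with a dilation $\lambda:M\to[0,\infty)$: where $d\phi_x=0$,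 $\lambda(x)=0$, and where $d\phi_x\neq0$, $\lambda(x)>0$ and $d\phi_x$ maps $H_x=(\ker d\phi_x)^{\perp}$ onto $T_{\phi(x)}N$ with $h(d\phi_x X,d\phi_x Y)=\lambda(x)^2 g(X,Y)$ for all $X,Y\in H_x$. For every harmonic map $\psi:(N,h)\to(Q,k)$, the composition $\psi\circ\phi:(M,g)\to(Q,k)$ is an $f$-harmonic map. More precisely, for every $C^2$ map $\psi:N\to Q$, $$\tau_f(\psi\circ\phi)=d\psi(\tau_f(\phi))+f\lambda^2\,\tau(\psi)\circ\phi .$$ -/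

import Mathlib

open scoped Manifold ContDiff

noncomputable section

namespace FHarmonic

/-- A smooth Riemannian metric on an `n`-dimensional smooth manifold `M` (without boundary). -/
abbrev Metric (n : ℕ) (M : Type*) [TopologicalSpace M]
    [ChartedSpace (EuclideanSpace ℝ (Fin n)) M] [IsManifold (𝓡 n) ∞ M] :=
  Bundle.ContMDiffRiemannianMetric (𝓡 n) ∞ (EuclideanSpace ℝ (Fin n))
    (fun x : M => TangentSpace (𝓡 n) x)

/-- The `i`-th vector of the standard basis of `ℝⁿ`. -/
abbrev stdVec {n : ℕ} (i : Fin n) : EuclideanSpace ℝ (Fin n) := EuclideanSpace.single i 1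

/-- The `i`-th partial derivative of a map on `ℝⁿ`. -/
def partialD {n : ℕ} {F : Type*} [NormedAddCommGroup F] [NormedSpace ℝ F] (i : Fin n)
    (u : EuclideanSpace ℝ (Fin n) → F) (z : EuclideanSpace ℝ (Fin n)) : F :=
  fderiv ℝ u z (stdVec i)

section OneManifold

variable {n : ℕ} {M : Type*} [TopologicalSpace M]
  [ChartedSpace (EuclideanSpace ℝ (Fin n)) M] [IsManifold (𝓡 n) ∞ M]

/-- The coordinate vector field `∂ᵢ` of the preferred chart around `p`, at the point with
coordinates `z`. -/
def coordVec (p : M) (z : EuclideanSpace ℝ (Fin n)) (i : Fin n) :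
    TangentSpace (𝓡 n) ((extChartAt (𝓡 n) p).symm z) :=
  mfderiv (𝓡 n) (𝓡 n) (extChartAt (𝓡 n) p).symm z (stdVec i)

/-- The matrix `(gᵢⱼ)` of the metric in the preferred chart around `p`, at coordinates `z`. -/
def gram (g : Metric n M) (p : M) (z : EuclideanSpace ℝ (Fin n)) : Matrix (Fin n) (Fin n) ℝ :=
  Matrix.of fun i j =>
    g.inner ((extChartAt (𝓡 n) p).symm z) (coordVec p z i) (coordVec p z j)

/-- The Christoffel symbol `Γᵏᵢⱼ` of the Levi-Civita connection of `g` in the preferred chart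
around `p`, at coordinates `z`:
`Γᵏᵢⱼ = ½ ∑ₛ gᵏˢ (∂ᵢ gⱼₛ + ∂ⱼ gᵢₛ - ∂ₛ gᵢⱼ)`. -/
def christoffel (g : Metric n M) (p : M) (z : EuclideanSpace ℝ (Fin n)) (k i j : Fin n) : ℝ :=
  (1 / 2 : ℝ) * ∑ s, (gram g p z)⁻¹ k s *
    (partialD i (fun w => gram g p w j s) z + partialD j (fun w => gram g p w i s) z
      - partialD s (fun w => gram g p w i j) z)

/-- The Laplace–Beltrami operator `Δ u = gⁱʲ (∂ᵢ ∂ⱼ u - Γᵏᵢⱼ ∂ₖ u)`, computed at `x` in the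
preferred chart around `x`. -/
def laplacian (g : Metric n M) (u : M → ℝ) (x : M) : ℝ :=
  let z := extChartAt (𝓡 n) x x
  let U : EuclideanSpace ℝ (Fin n) → ℝ := fun w => u ((extChartAt (𝓡 n) x).symm w)
  ∑ i, ∑ j, (gram g x z)⁻¹ i j *
    (partialD i (partialD j U) z - ∑ k, christoffel g x z k i j * partialD k U z)

/-- The Riemannian gradient `grad u = gⁱʲ ∂ⱼ u ∂ᵢ`, computed at `x` in the preferred chart
around `x`, whose coordinate vectors at `x` are the standard basis of
`TangentSpace (𝓡 n) x = ℝⁿ`. -/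
def grad (g : Metric n M) (u : M → ℝ) (x : M) : TangentSpace (𝓡 n) x :=
  let z := extChartAt (𝓡 n) x x
  let U : EuclideanSpace ℝ (Fin n) → ℝ := fun w => u ((extChartAt (𝓡 n) x).symm w)
  (WithLp.toLp 2 fun i => ∑ j, (gram g x z)⁻¹ i j * partialD j U z : EuclideanSpace ℝ (Fin n))

/-- The `f`-Laplacian `Δ_f u = f Δ u + g(grad f, grad u)`. -/
def fLaplacian (g : Metric n M) (f u : M → ℝ) (x : M) : ℝ :=
  f x * laplacian g u x + g.inner x (grad g f x) (grad g u x)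

/-- `u` is a harmonic function on the open set `V`: it is `C²` there with `Δ u = 0`. -/
def IsHarmonicOn (g : Metric n M) (u : M → ℝ) (V : Set M) : Prop :=
  ContMDiffOn (𝓡 n) 𝓘(ℝ, ℝ) 2 u V ∧ ∀ x ∈ V, laplacian g u x = 0

/-- `u` is an `f`-harmonic function on the open set `V`: it is `C²` there with `Δ_f u = 0`. -/
def IsFHarmonicOn (g : Metric n M) (f u : M → ℝ) (V : Set M) : Prop :=
  ContMDiffOn (𝓡 n) 𝓘(ℝ, ℝ) 2 u V ∧ ∀ x ∈ V, fLaplacian g f u x = 0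

end OneManifold

section TwoManifolds

variable {m n : ℕ} {M N : Type*}
  [TopologicalSpace M] [ChartedSpace (EuclideanSpace ℝ (Fin m)) M] [IsManifold (𝓡 m) ∞ M]
  [TopologicalSpace N] [ChartedSpace (EuclideanSpace ℝ (Fin n)) N] [IsManifold (𝓡 n) ∞ N]

/-- The tension field `τ(φ) = Tr_g ∇dφ`, as a vector of `T_{φ(x)} N`. In the preferred charts
around `x` and `φ x` its components are
`τ(φ)ᶜ = gⁱʲ (∂ᵢ ∂ⱼ φᶜ - Γᵏᵢⱼ ∂ₖ φᶜ + Γ̄ᶜₐᵦ ∂ᵢ φᵃ ∂ⱼ φᵇ)`, and the coordinate vectors of the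
preferred chart around `φ x` at `φ x` are the standard basis of
`TangentSpace (𝓡 n) (φ x) = ℝⁿ`. -/
def tension (g : Metric m M) (h : Metric n N) (φ : M → N) (x : M) :
    TangentSpace (𝓡 n) (φ x) :=
  let z := extChartAt (𝓡 m) x x
  let y := extChartAt (𝓡 n) (φ x) (φ x)
  let Φ : Fin n → EuclideanSpace ℝ (Fin m) → ℝ := fun c w =>
    extChartAt (𝓡 n) (φ x) (φ ((extChartAt (𝓡 m) x).symm w)) c
  (WithLp.toLp 2 fun c => ∑ i, ∑ j, (gram g x z)⁻¹ i j *
    (partialD i (partialD j (Φ c)) z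
      - ∑ k, christoffel g x z k i j * partialD k (Φ c) z
      + ∑ a, ∑ b, christoffel h (φ x) y c a b * partialD i (Φ a) z * partialD j (Φ b) z) :
    EuclideanSpace ℝ (Fin n))

/-- The `f`-tension field `τ_f(φ) = f τ(φ) + dφ(grad f)`. -/
def fTension (g : Metric m M) (h : Metric n N) (f : M → ℝ) (φ : M → N) (x : M) :
    TangentSpace (𝓡 n) (φ x) :=
  f x • tension g h φ x + mfderiv (𝓡 m) (𝓡 n) φ x (grad g f x)

/-- A harmonic map: a `C²` map with vanishing tension field. -/
def IsHarmonicMap (g : Metric m M) (h : Metric n N) (φ : M → N) : Prop :=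
  ContMDiff (𝓡 m) (𝓡 n) 2 φ ∧ ∀ x, tension g h φ x = 0

/-- An `f`-harmonic map: a `C²` map with vanishing `f`-tension field. -/
def IsFHarmonicMap (g : Metric m M) (h : Metric n N) (f : M → ℝ) (φ : M → N) : Prop :=
  ContMDiff (𝓡 m) (𝓡 n) 2 φ ∧ ∀ x, fTension g h f φ x = 0

/-- An `f`-harmonic morphism: a continuous map which pulls back local harmonic functions to
local `f`-harmonic functions. A function on an open subset `V` of `N` is represented by a
function on `N` of which only the restriction to `V` matters. -/
def IsFHarmonicMorphism (g : Metric m M) (h : Metric n N) (f : M → ℝ) (φ : M → N) : Prop :=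
  Continuous φ ∧ ∀ (V : Set N) (u : N → ℝ), IsOpen V → (φ ⁻¹' V).Nonempty →
    IsHarmonicOn h u V → IsFHarmonicOn g f (u ∘ φ) (φ ⁻¹' V)

/-- The horizontal space `H_x`: the `g`-orthogonal complement of `ker dφ_x` in `T_x M`. -/
def horizontal (g : Metric m M) (φ : M → N) (x : M) : Set (TangentSpace (𝓡 m) x) :=
  {X | ∀ V : TangentSpace (𝓡 m) x, mfderiv (𝓡 m) (𝓡 n) φ x V = 0 → g.inner x X V = 0}

/-- `φ` is a horizontally weakly conformal map with dilation `lam`: at each point where `dφ ≠ 0`,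
`dφ` maps the horizontal space conformally onto the tangent space of `N` with factor `lam > 0`;
at the points where `dφ = 0`, `lam = 0`. -/
def IsHWCWithDilation (g : Metric m M) (h : Metric n N) (φ : M → N) (lam : M → ℝ) : Prop :=
  MDifferentiable (𝓡 m) (𝓡 n) φ ∧
  ∀ x, (mfderiv (𝓡 m) (𝓡 n) φ x = 0 → lam x = 0) ∧
    (mfderiv (𝓡 m) (𝓡 n) φ x ≠ 0 →
      0 < lam x ∧
      Set.SurjOn (mfderiv (𝓡 m) (𝓡 n) φ x) (horizontal (n := n) g φ x) Set.univ ∧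
      ∀ X ∈ horizontal (n := n) g φ x, ∀ Y ∈ horizontal (n := n) g φ x,
        h.inner (φ x) (mfderiv (𝓡 m) (𝓡 n) φ x X) (mfderiv (𝓡 m) (𝓡 n) φ x Y)
          = lam x ^ 2 * g.inner x X Y)

end TwoManifolds

end FHarmonic

end

open scoped Manifold ContDiff

noncomputable section

namespace FHarmonic

open MeasureTheory Filter Topology
open scoped FourierTransform

/-! ### Fourier series of compactly supported smooth functions -/

section FourierSeries

variable {n : ℕ}

/-! Near `φ x`, harmonic functions on `N` realise, up to an arbitrarily small error, every
differential `ξ` together with every symmetric trace-free Hessian `C` at `φ x`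
(`exists_harmonic_near_jet`). For a `C²` map the chain rule reads Δ_f(U ∘ φ) = f ⟨A, Hess U⟩ +
dU(τ_f(φ)), where A is the pushforward under dφ of the cometric of `M` (`fLaplacian_comp`). The left
side vanishes for harmonic U, and since the relation is continuous in the jet it passes to the
limit: f ⟨A, C⟩ + ξ(τ_f(φ)) = 0 for all such `ξ` and `C` (`jet_condition`). Taking `C = 0` gives
τ_f(φ) = 0. Taking `ξ = 0` shows that A annihilates all trace-free forms, so A = λ² h⁻¹, which is
horizontal weak conformality. In the chain rule for the components of `ψ ∘ φ` this turns the trace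
against A into f λ² τ(ψ), whence the composition law.

That `φ` is `C²` comes from the same jets: `n` harmonic functions whose differentials are close to
the dual basis form a `C²` chart, their composites with `φ` are `C²` by the definition of a
morphism, and the inverse function theorem recovers `φ`.

The analytic input is `exists_solution_near_jet`. With `p` a polynomial having the wanted jet, one
seeks u = p + r² Re W((z - z₀)/r). After this scaling the equation for W is a constant-coefficient
elliptic operator perturbed by terms of size O(r), and cutting off makes all data absolutely
convergent Fourier series. On series with frequencies in ℤⁿ + (1/2, …, 1/2) the constant-coefficient
symbol never vanishes, and first or second derivatives after its inverse are bounded multipliers. So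
the equation on ℓ¹ is the identity plus an operator of norm at most 1/2. The right side is O(r)
because `p` satisfies the equation at `z₀`, so the correction to the jet is O(r) too. Absolute
summability of the second derivatives makes W of class `C²`. -/

/-- The point of `ℝⁿ` with integer coordinates `k`. -/
def latticePt (k : Fin n → ℤ) : EuclideanSpace ℝ (Fin n) := WithLp.toLp 2 fun i => (k i : ℝ)

/-- The character `y ↦ exp (2πi ⟨κ, y⟩)` of `ℝⁿ`. -/
def char (κ y : EuclideanSpace ℝ (Fin n)) : ℂ :=
  Complex.exp ((2 * Real.pi * inner ℝ κ y : ℝ) * Complex.I)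

lemma norm_char (κ y : EuclideanSpace ℝ (Fin n)) : ‖char κ y‖ = 1 :=
  Complex.norm_exp_ofReal_mul_I _

lemma char_add (κ κ' y : EuclideanSpace ℝ (Fin n)) : char (κ + κ') y = char κ y * char κ' y := by
  rw [char, char, char, ← Complex.exp_add, inner_add_left]
  congr 1
  push_cast
  ring

lemma mFourier_coe (k : Fin n → ℤ) (y : EuclideanSpace ℝ (Fin n)) :
    UnitAddTorus.mFourier k (fun i => (y i : UnitAddCircle)) = char (latticePt k) y := by
  simp only [UnitAddTorus.mFourier, ContinuousMap.coe_mk, fourier_coe_apply, char]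
  rw [← Complex.exp_sum]
  congr 1
  simp only [latticePt, PiLp.inner_apply, RCLike.inner_apply, conj_trivial]
  push_cast
  rw [Finset.mul_sum, Finset.sum_mul]
  refine Finset.sum_congr rfl fun i _ => ?_
  simp
  ring

lemma summable_prod_one_add_sq_inv (n : ℕ) :
    Summable fun k : Fin n → ℤ => ∏ i, (1 + (k i : ℝ) ^ 2)⁻¹ := by
  have h1 : Summable fun k : ℤ => (1 + (k : ℝ) ^ 2)⁻¹ := by
    refine Summable.of_norm_bounded_eventually (Real.summable_one_div_int_pow.2 one_lt_two) ?_
    have : ∀ᶠ k : ℤ in cofinite, k ≠ 0 :=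
      (Set.finite_singleton (0 : ℤ)).eventually_cofinite_notMem
    filter_upwards [this] with k hk
    rw [Real.norm_of_nonneg (by positivity), one_div]
    have : (0 : ℝ) < (k : ℝ) ^ 2 := by positivity
    gcongr
    linarith
  induction n with
  | zero => exact Summable.of_finite
  | succ n ih =>
    rw [← (Fin.consEquiv fun _ : Fin (n + 1) => ℤ).summable_iff]
    refine (h1.mul_of_nonneg ih (fun _ => by positivity) fun _ => by
      simp only [Pi.zero_apply]; positivity).congr fun x => ?_
    simp [Fin.prod_univ_succ, Fin.consEquiv, mul_comm]

/-- Every factor 1 + kᵢ² is at most 1 + ‖k‖², so the product of the one-dimensional weights is at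
most 2ⁿ (1 + ‖k‖²ⁿ). Decay of order `2 * n` is therefore enough for summability over the lattice. -/
lemma summable_inv_one_add_norm_pow (n : ℕ) :
    Summable fun k : Fin n → ℤ => (1 + ‖latticePt k‖ ^ (2 * n))⁻¹ := by
  refine Summable.of_nonneg_of_le (fun k => by positivity) (fun k => ?_)
    ((summable_prod_one_add_sq_inv n).mul_left (2 ^ n))
  rw [Finset.prod_inv_distrib, inv_eq_one_div, ← div_eq_mul_inv, div_le_div_iff₀ (by positivity)
    (Finset.prod_pos fun i _ => by positivity), one_mul]
  set s := ‖latticePt k‖ ^ 2 with hs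
  have hle : ∀ i, (k i : ℝ) ^ 2 ≤ s := fun i => by
    rw [hs, EuclideanSpace.norm_sq_eq]
    refine le_trans ?_ (Finset.single_le_sum (fun j _ => by positivity) (Finset.mem_univ i))
    simp [latticePt]
  have h1 : ∏ i, (1 + (k i : ℝ) ^ 2) ≤ (1 + s) ^ n := by
    refine (Finset.prod_le_prod (fun i _ => by positivity)
      (g := fun _ => 1 + s) fun i _ => by linarith [hle i]).trans ?_
    simp
  have h0 : 0 ≤ s := by positivity
  rw [pow_mul, ← hs]
  refine h1.trans ?_
  have h2 : (1 + s) ^ n ≤ (2 * max 1 s) ^ n := by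
    gcongr
    linarith [le_max_left 1 s, le_max_right 1 s]
  refine h2.trans ?_
  rw [mul_pow]
  gcongr
  rcases max_cases 1 s with ⟨h, _⟩ | ⟨h, _⟩ <;> rw [h]
  · simp [pow_nonneg h0]
  · linarith

/-- The fundamental cell `[-1/4, 1/4]ⁿ`. -/
def cell (n : ℕ) : Set (EuclideanSpace ℝ (Fin n)) := {y | ∀ i, |y i| ≤ 1 / 4}

/-- The representative of a point of the torus in `(-1/2, 1/2]ⁿ`. -/
def torusRep (t : UnitAddTorus (Fin n)) : EuclideanSpace ℝ (Fin n) :=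
  WithLp.toLp 2 fun i => ((AddCircle.equivIoc 1 (-1 / 2 : ℝ) (t i)).1 : ℝ)

lemma torusRep_coe {y : EuclideanSpace ℝ (Fin n)} (hy : ∀ i, y i ∈ Set.Ioc (-1 / 2 : ℝ) (1 / 2)) :
    torusRep (fun i => (y i : UnitAddCircle)) = y := by
  ext i
  simp only [torusRep]
  rw [AddCircle.equivIoc_coe_eq (hx := ?_)]
  convert! hy i using 2
  norm_num

lemma norm_eq_abs_equivIoc (t : UnitAddCircle) :
    ‖t‖ = |((AddCircle.equivIoc 1 (-1 / 2 : ℝ) t).1 : ℝ)| := by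
  conv_lhs => rw [← AddCircle.coe_equivIoc (p := (1 : ℝ)) (a := -1 / 2) (y := t)]
  rw [AddCircle.norm_coe_eq_abs_iff _ one_ne_zero]
  have := (AddCircle.equivIoc 1 (-1 / 2 : ℝ) t).2
  rw [abs_le, abs_one]
  constructor <;> linarith [this.1, this.2]

/-- The representative jumps only where a coordinate is 1/2 modulo 1. There `c` vanishes nearby,
because its support keeps all coordinates within 1/4. -/
lemma continuous_comp_torusRep {c : EuclideanSpace ℝ (Fin n) → ℂ} (hc : Continuous c)
    (hsupp : Function.support c ⊆ cell n) : Continuous fun t => c (torusRep t) := by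
  rw [continuous_iff_continuousAt]
  intro t
  by_cases ht : ∃ i, 1 / 4 < ‖t i‖
  · obtain ⟨i, hi⟩ := ht
    have : (fun t => c (torusRep t)) =ᶠ[𝓝 t] fun _ => 0 := by
      have ho : IsOpen {s : UnitAddTorus (Fin n) | 1 / 4 < ‖s i‖} :=
        isOpen_lt continuous_const (by fun_prop)
      filter_upwards [ho.mem_nhds hi] with s hs
      by_contra h
      have := hsupp h i
      simp only [torusRep] at this
      rw [← norm_eq_abs_equivIoc] at this
      exact absurd hs (not_lt.2 this)
    exact this.continuousAt
  · push Not at ht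
    refine hc.continuousAt.comp ?_
    refine (PiLp.continuous_toLp 2 _).continuousAt.comp ?_
    refine continuousAt_pi.2 fun i => ?_
    refine continuous_subtype_val.continuousAt.comp ?_
    refine (AddCircle.continuousAt_equivIoc 1 (-1 / 2 : ℝ) ?_).comp (continuous_apply i).continuousAt
    intro h
    have := ht i
    rw [h, (AddCircle.norm_coe_eq_abs_iff _ one_ne_zero).2] at this
    · norm_num [abs_of_nonneg] at this
    · norm_num [abs_of_nonneg]

/-- Both sides integrate `c` against the same character: the support of `c` lies inside one period
box, so the integral over the box equals the one over ℝⁿ. -/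
lemma mFourierCoeff_comp_torusRep {c : EuclideanSpace ℝ (Fin n) → ℂ}
    (hsupp : Function.support c ⊆ cell n) (k : Fin n → ℤ) :
    UnitAddTorus.mFourierCoeff (fun t => c (torusRep t)) k = 𝓕 c (latticePt k) := by
  rw [UnitAddTorus.mFourierCoeff_eq_integral _ _ fun _ => (-1 / 2 : ℝ), Real.fourier_eq,
    ← (PiLp.volume_preserving_toLp (Fin n)).integral_comp
      (MeasurableEquiv.toLp 2 (Fin n → ℝ)).measurableEmbedding]
  have hI : MeasurableSet {x : Fin n → ℝ | ∀ i, x i ∈ Set.Ioc (-1 / 2 : ℝ) (-1 / 2 + 1)} :=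
    MeasurableSet.univ_pi' fun i => measurableSet_Ioc
  rw [← integral_indicator hI]
  congr 1
  ext x
  have key : UnitAddTorus.mFourier (-k) (fun i => (x i : UnitAddCircle)) =
      ((Real.fourierChar (-inner ℝ (WithLp.toLp 2 x) (latticePt k)) : Circle) : ℂ) := by
    rw [mFourier_coe (-k) (WithLp.toLp 2 x), char, Real.fourierChar_apply]
    congr 2
    have : latticePt (-k) = -latticePt k := by
      ext i; simp [latticePt]
    rw [this, inner_neg_left, real_inner_comm]
  by_cases hx : x ∈ {x : Fin n → ℝ | ∀ i, x i ∈ Set.Ioc (-1 / 2 : ℝ) (-1 / 2 + 1)}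
  · rw [Set.indicator_of_mem hx, key]
    have h2 := torusRep_coe (n := n) (y := WithLp.toLp 2 x) (fun i => by
      have := hx i
      norm_num at this ⊢
      exact this)
    simp only at h2
    rw [h2]
    rfl
  · rw [Set.indicator_of_notMem hx]
    have : c (WithLp.toLp 2 x) = 0 := by
      by_contra h
      refine hx fun i => ?_
      have := abs_le.1 (hsupp h i)
      simp only at this
      constructor <;> linarith [this.1, this.2]
    simp [this]

/-- Fourier inversion on the torus for the periodised `c`, read back at points that are their own
representatives. -/
lemma hasSum_fourier_latticePt {c : EuclideanSpace ℝ (Fin n) → ℂ} (hc : Continuous c)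
    (hsupp : Function.support c ⊆ cell n) (hs : Summable fun k : Fin n → ℤ => 𝓕 c (latticePt k))
    {y : EuclideanSpace ℝ (Fin n)} (hy : y ∈ cell n) :
    HasSum (fun k : Fin n → ℤ => 𝓕 c (latticePt k) * char (latticePt k) y) (c y) := by
  have h := UnitAddTorus.hasSum_mFourier_series_apply_of_summable
    (f := ⟨_, continuous_comp_torusRep hc hsupp⟩)
    (by simpa only [ContinuousMap.coe_mk, funext (mFourierCoeff_comp_torusRep hsupp)] using hs)
    (fun i => (y i : UnitAddCircle))
  simp only [ContinuousMap.coe_mk, mFourierCoeff_comp_torusRep hsupp, mFourier_coe,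
    smul_eq_mul] at h
  rwa [torusRep_coe fun i => ?_] at h
  have := abs_le.1 (hy i)
  constructor <;> linarith [this.1, this.2]

lemma isCompact_cell (n : ℕ) : IsCompact (cell n) := by
  refine Metric.isCompact_of_isClosed_isBounded ?_ ?_
  · simp only [cell, Set.ofPred_forall]
    exact isClosed_iInter fun i => isClosed_le (by fun_prop) continuous_const
  · refine (Metric.isBounded_closedBall (x := 0) (r := √(∑ _i : Fin n, (1 / 4 : ℝ) ^ 2))).subset
      fun y hy => ?_
    rw [mem_closedBall_zero_iff, EuclideanSpace.norm_eq]
    gcongr with i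
    exact hy i

lemma exists_bound_iteratedFDeriv {G : EuclideanSpace ℝ (Fin n) → ℂ} (hG : ContDiff ℝ ∞ G)
    (hGc : HasCompactSupport G) (K : ℕ) :
    ∃ B, 1 ≤ B ∧ ∀ j ≤ K, ∀ x, ‖iteratedFDeriv ℝ j G x‖ ≤ B := by
  have h : ∀ j : ℕ, ∃ B, ∀ x, ‖iteratedFDeriv ℝ j G x‖ ≤ B := fun j =>
    (hGc.iteratedFDeriv j).exists_bound_of_continuous
      (hG.continuous_iteratedFDeriv (by exact_mod_cast le_top))
  choose B hB using h
  refine ⟨1 + ∑ j ∈ Finset.range (K + 1), |B j|,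
    le_add_of_nonneg_right (Finset.sum_nonneg fun _ _ => abs_nonneg _), fun j hj x => ?_⟩
  have := Finset.single_le_sum (f := fun j => |B j|) (fun _ _ => abs_nonneg _)
    (Finset.mem_range.2 (Nat.lt_succ_of_le hj))
  linarith [hB j x, le_abs_self (B j)]

/-- For `j = 0` the mean value inequality gives ‖G z₀‖ + B r ‖y‖, which is why derivatives up to
order `K + 1` must be bounded. For `j ≥ 1` the chain rule gives a factor rʲ ≤ r. In either case the
bound is linear in ‖G z₀‖ + r, hence small when `G` vanishes at the centre. -/
lemma norm_iteratedFDeriv_comp_scale_le {G : EuclideanSpace ℝ (Fin n) → ℂ} (hG : ContDiff ℝ ∞ G)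
    {K : ℕ} {B : ℝ} (hB1 : 1 ≤ B) (hB : ∀ j ≤ K + 1, ∀ x, ‖iteratedFDeriv ℝ j G x‖ ≤ B)
    (z₀ : EuclideanSpace ℝ (Fin n)) {r : ℝ} (hr : 0 < r) (hr1 : r ≤ 1) {j : ℕ} (hj : j ≤ K)
    (y : EuclideanSpace ℝ (Fin n)) :
    ‖iteratedFDeriv ℝ j (fun y => G (z₀ + r • y)) y‖ ≤ (‖G z₀‖ + r) * (B * (1 + ‖y‖)) := by
  rcases Nat.eq_zero_or_pos j with rfl | hj0
  · rw [norm_iteratedFDeriv_zero]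
    have h1 : ‖G (z₀ + r • y) - G z₀‖ ≤ B * ‖z₀ + r • y - z₀‖ :=
      Convex.norm_image_sub_le_of_norm_fderiv_le (𝕜 := ℝ) (s := Set.univ)
        (fun x _ => (hG.differentiable (by simp)) x)
        (fun x _ => by
          have := hB 1 (by omega) x
          rwa [norm_iteratedFDeriv_one] at this) convex_univ trivial trivial
    rw [add_sub_cancel_left, norm_smul, Real.norm_of_nonneg hr.le] at h1
    have h2 : ‖G (z₀ + r • y)‖ ≤ ‖G z₀‖ + B * (r * ‖y‖) := by
      have := norm_add_le (G (z₀ + r • y) - G z₀) (G z₀)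
      rw [sub_add_cancel] at this
      linarith
    have h3 : ‖G z₀‖ ≤ ‖G z₀‖ * (B * (1 + ‖y‖)) :=
      le_mul_of_one_le_right (norm_nonneg _)
        (one_le_mul_of_one_le_of_one_le hB1 (by linarith [norm_nonneg y]))
    nlinarith [mul_nonneg hr.le (zero_le_one.trans hB1)]
  · have h1 : iteratedFDeriv ℝ j (fun y => G (z₀ + r • y)) y =
        (iteratedFDeriv ℝ j (fun x => G (z₀ + x)) (r • y)).compContinuousLinearMap
          fun _ => r • ContinuousLinearMap.id ℝ _ :=
      (r • ContinuousLinearMap.id ℝ (EuclideanSpace ℝ (Fin n))).iteratedFDeriv_comp_right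
        (f := fun x => G (z₀ + x)) (hG.comp (contDiff_const.add contDiff_id)) y
        (i := j) (by exact_mod_cast le_top)
    rw [h1, iteratedFDeriv_comp_add_left]
    refine (ContinuousMultilinearMap.norm_compContinuousLinearMap_le _ _).trans ?_
    have h2 : ‖r • ContinuousLinearMap.id ℝ (EuclideanSpace ℝ (Fin n))‖ ≤ r := by
      rw [norm_smul, Real.norm_of_nonneg hr.le]
      exact mul_le_of_le_one_right hr.le ContinuousLinearMap.norm_id_le
    have h3 : ‖r • ContinuousLinearMap.id ℝ (EuclideanSpace ℝ (Fin n))‖ ^ j ≤ r :=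
      (pow_le_pow_left₀ (norm_nonneg _) h2 j).trans
        (pow_le_of_le_one hr.le hr1 hj0.ne')
    rw [Finset.prod_const, Finset.card_univ, Fintype.card_fin]
    calc _ ≤ B * r := by
          gcongr
          exact hB j (by omega) _
      _ ≤ (‖G z₀‖ + r) * (B * (1 + ‖y‖)) := by
          have hB0 : 0 ≤ B := zero_le_one.trans hB1
          rw [mul_comm]
          gcongr
          · linarith [norm_nonneg (G z₀)]
          · exact le_mul_of_one_le_right hB0 (by linarith [norm_nonneg y])

/-- Scaled, cut off smooth functions have absolutely convergent Fourier series, with a bound that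
is linear in the scale if the function vanishes at the centre. -/
lemma exists_fourierSeries_scale {χ G : EuclideanSpace ℝ (Fin n) → ℂ} (hχ : ContDiff ℝ ∞ χ)
    (hχs : Function.support χ ⊆ cell n) (hG : ContDiff ℝ ∞ G) (hGc : HasCompactSupport G)
    (z₀ : EuclideanSpace ℝ (Fin n)) :
    ∃ C, 0 ≤ C ∧ ∀ r : ℝ, 0 < r → r ≤ 1 → ∃ c : (Fin n → ℤ) → ℂ, Summable (fun k => ‖c k‖) ∧
      ∑' k, ‖c k‖ ≤ C * (‖G z₀‖ + r) ∧
      ∀ y ∈ cell n, HasSum (fun k => c k * char (latticePt k) y) (χ y * G (z₀ + r • y)) := by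
  -- Summable Fourier coefficients need `2 * n` derivatives; the extra one feeds the mean value
  -- inequality at order zero.
  obtain ⟨B, hB1, hB⟩ := exists_bound_iteratedFDeriv hG hGc (2 * n + 1)
  have hB0 : 0 ≤ B := zero_le_one.trans hB1
  have hχc : HasCompactSupport χ := HasCompactSupport.of_support_subset_isCompact
    (isCompact_cell n) hχs
  -- The Leibniz bound for χ · G(z₀ + r y) with the factor ‖G z₀‖ + r taken out, so that it no
  -- longer depends on `r`.
  let Φ : ℕ → EuclideanSpace ℝ (Fin n) → ℝ := fun j y => ∑ i ∈ Finset.range (j + 1),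
    (j.choose i : ℝ) * ‖iteratedFDeriv ℝ i χ y‖ * (B * (1 + ‖y‖))
  have hΦ0 : ∀ j y, 0 ≤ Φ j y := fun j y => Finset.sum_nonneg fun i _ => by positivity
  have hΦi : ∀ j, Integrable (Φ j) := fun j => by
    refine integrable_finsetSum _ fun i _ => ?_
    refine Continuous.integrable_of_hasCompactSupport ?_ ?_
    · have := hχ.continuous_iteratedFDeriv (m := i) (by exact_mod_cast le_top)
      fun_prop
    · exact ((hχc.iteratedFDeriv (𝕜 := ℝ) i).norm.mul_left).mul_right
  let S : ℝ := ∑ j ∈ Finset.range (2 * n + 1), ∫ y, Φ j y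
  have hS0 : 0 ≤ S := Finset.sum_nonneg fun j _ => integral_nonneg (hΦ0 j)
  let W : ℝ := ∑' k : Fin n → ℤ, (1 + ‖latticePt k‖ ^ (2 * n))⁻¹
  let D : ℝ := (1 + 2 ^ (2 * n)) * S
  refine ⟨D * W, mul_nonneg (by positivity) (tsum_nonneg fun k => by positivity),
    fun r hr hr1 => ?_⟩
  let c : EuclideanSpace ℝ (Fin n) → ℂ := fun y => χ y * G (z₀ + r • y)
  have hGr : ContDiff ℝ ∞ fun y => G (z₀ + r • y) := by fun_prop
  have hc : ContDiff ℝ ∞ c := hχ.mul hGr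
  have hcs : Function.support c ⊆ cell n := fun y hy => hχs (left_ne_zero_of_mul hy)
  have hcc : HasCompactSupport c := HasCompactSupport.of_support_subset_isCompact
    (isCompact_cell n) hcs
  set δ : ℝ := ‖G z₀‖ + r
  have hδ : 0 ≤ δ := by positivity
  have hcb : ∀ j ≤ 2 * n, ∀ y, ‖iteratedFDeriv ℝ j c y‖ ≤ δ * Φ j y := fun j hj y => by
    refine (norm_iteratedFDeriv_mul_le hχ hGr y (by exact_mod_cast le_top)).trans ?_
    rw [Finset.mul_sum]
    refine Finset.sum_le_sum fun i hi => ?_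
    rw [mul_left_comm]
    gcongr
    exact norm_iteratedFDeriv_comp_scale_le hG hB1 hB z₀ hr hr1 ((Nat.sub_le j i).trans hj) y
  have hint : ∀ j : ℕ, Integrable fun y => ‖iteratedFDeriv ℝ j c y‖ := fun j =>
    ((hc.continuous_iteratedFDeriv (by exact_mod_cast le_top)).integrable_of_hasCompactSupport
      (hcc.iteratedFDeriv j)).norm
  have hcI : ∀ N ≤ 2 * n,
      ∑ j ∈ Finset.range (N + 1), ∫ y, ‖iteratedFDeriv ℝ j c y‖ ≤ δ * S := fun N hN => by
    refine (Finset.sum_le_sum_of_subset_of_nonneg (Finset.range_mono (Nat.succ_le_succ hN))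
      fun j _ _ => integral_nonneg fun y => norm_nonneg _).trans ?_
    rw [Finset.mul_sum]
    refine Finset.sum_le_sum fun j hj => ?_
    rw [← integral_const_mul]
    exact integral_mono (hint j) ((hΦi j).const_mul δ)
      (hcb j (Nat.lt_succ_iff.1 (Finset.mem_range.1 hj)))
  -- Differentiability of `c` becomes decay of its transform. No derivative of the transform is
  -- needed, so the general constant reduces to `2 ^ N`. The cases `N = 0` and `N = 2 * n` add up to
  -- the constant `D`.
  have hdecay : ∀ N ≤ 2 * n, ∀ w, ‖w‖ ^ N * ‖𝓕 c w‖ ≤ 2 ^ N * (δ * S) := fun N hN w => by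
    refine le_trans ?_ (mul_le_mul_of_nonneg_left (hcI N hN) (by positivity))
    have := Real.pow_mul_norm_iteratedFDeriv_fourier_le (K := 0) (N := ⊤)
      (by simpa using hc) (fun k j hk _ => by
        obtain rfl : k = 0 := by simpa using hk
        simpa using hint j) (k := 0) (n := N) le_rfl (by exact_mod_cast le_top) w
    simpa [Finset.sum_product] using this
  have hbound : ∀ k : Fin n → ℤ, ‖𝓕 c (latticePt k)‖ ≤
      D * δ * (1 + ‖latticePt k‖ ^ (2 * n))⁻¹ := fun k => by
    rw [← div_eq_mul_inv, le_div_iff₀ (by positivity), mul_comm, add_mul]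
    have h1 := hdecay 0 (Nat.zero_le _) (latticePt k)
    have h2 := hdecay (2 * n) le_rfl (latticePt k)
    rw [pow_zero, pow_zero] at h1
    refine (add_le_add h1 h2).trans (le_of_eq ?_)
    ring
  have hW := (summable_inv_one_add_norm_pow n).mul_left (D * δ)
  have hsum : Summable fun k : Fin n → ℤ => ‖𝓕 c (latticePt k)‖ :=
    Summable.of_nonneg_of_le (fun k => norm_nonneg _) hbound hW
  refine ⟨fun k => 𝓕 c (latticePt k), hsum, ?_, fun y hy =>
    hasSum_fourier_latticePt hc.continuous hcs hsum.of_norm hy⟩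
  refine (hsum.tsum_le_tsum hbound hW).trans (le_of_eq ?_)
  rw [tsum_mul_left]
  ring

end FourierSeries

end FHarmonic
end

open scoped Manifold ContDiff

noncomputable section

namespace FHarmonic

open MeasureTheory Filter Topology

/-! ### Absolutely convergent trigonometric series -/

section SummableSequences

variable {ι F : Type*} [NormedAddCommGroup F] [NormedSpace ℂ F] [CompleteSpace F]

/-- The Banach space of absolutely summable families. -/
abbrev SummableFamily (ι : Type*) := lp (fun _ : ι => ℂ) 1

lemma SummableFamily.summable_norm (v : SummableFamily ι) : Summable fun i => ‖v i‖ := by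
  simpa using (lp.memℓp v).summable (by simp)

lemma SummableFamily.norm_eq (v : SummableFamily ι) : ‖v‖ = ∑' i, ‖v i‖ := by
  simpa using lp.norm_eq_tsum_rpow (p := 1) (by simp) v

lemma SummableFamily.summable_smul (v : SummableFamily ι) {b : ι → F} {C : ℝ}
    (hb : ∀ i, ‖b i‖ ≤ C) : Summable fun i => v i • b i := by
  refine Summable.of_norm_bounded ((SummableFamily.summable_norm v).mul_right C) fun i => ?_
  rw [norm_smul]
  gcongr
  exact hb i

/-- The continuous linear extension of a bounded family to summable families. -/
def SummableFamily.lift (b : ι → F) (C : ℝ) (hb : ∀ i, ‖b i‖ ≤ C) :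
    SummableFamily ι →L[ℂ] F :=
  LinearMap.mkContinuous
    { toFun := fun v => ∑' i, v i • b i
      map_add' := fun v w => by
        refine Eq.trans (tsum_congr fun i => ?_)
          ((SummableFamily.summable_smul v hb).tsum_add (SummableFamily.summable_smul w hb))
        simp [add_smul]
      map_smul' := fun c v => by
        simp only [RingHom.id_apply, ← tsum_const_smul'']
        simp [mul_smul] } C fun v => by
    change ‖∑' i, v i • b i‖ ≤ C * ‖v‖
    have h : ∀ i, ‖v i • b i‖ ≤ C * ‖v i‖ := fun i => by
      rw [norm_smul, mul_comm]
      gcongr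
      exact hb i
    refine (tsum_of_norm_bounded ((SummableFamily.summable_norm v).mul_left C).hasSum h).trans (le_of_eq ?_)
    rw [tsum_mul_left, (SummableFamily.norm_eq v)]

lemma SummableFamily.lift_apply (b : ι → F) (C : ℝ) (hb : ∀ i, ‖b i‖ ≤ C)
    (v : SummableFamily ι) : SummableFamily.lift b C hb v = ∑' i, v i • b i := rfl

lemma SummableFamily.norm_lift_le [Nonempty ι] (b : ι → F) (C : ℝ) (hb : ∀ i, ‖b i‖ ≤ C) :
    ‖SummableFamily.lift b C hb‖ ≤ C :=
  LinearMap.mkContinuous_norm_le _ ((norm_nonneg _).trans (hb (Classical.arbitrary ι))) _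

/-- Bundle a summable family. -/
def SummableFamily.mk (c : ι → ℂ) (hc : Summable fun i => ‖c i‖) : SummableFamily ι :=
  ⟨c, memℓp_gen (by simpa using hc)⟩

lemma SummableFamily.mk_apply (c : ι → ℂ) (hc : Summable fun i => ‖c i‖) (i : ι) :
    SummableFamily.mk c hc i = c i := rfl

/-- Neumann series; the bound follows from ‖v‖ ≤ ‖s‖ + ‖K v‖ ≤ ‖s‖ + ‖v‖ / 2. -/
lemma exists_add_apply_eq {V : Type*} [NormedAddCommGroup V] [NormedSpace ℂ V] [CompleteSpace V]
    (K : V →L[ℂ] V) (hK : ‖K‖ ≤ 1 / 2) (s : V) : ∃ v, v + K v = s ∧ ‖v‖ ≤ 2 * ‖s‖ := by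
  have hu : IsUnit (1 - -K) := isUnit_one_sub_of_norm_lt_one (by rw [norm_neg]; linarith)
  obtain ⟨T, hT⟩ := hu.exists_right_inv
  refine ⟨T s, ?_, ?_⟩
  · simpa using DFunLike.congr_fun hT s
  · have h1 : T s + K (T s) = s := by simpa using DFunLike.congr_fun hT s
    have h2 : ‖T s‖ ≤ ‖s‖ + ‖K (T s)‖ := by
      rw [← eq_sub_iff_add_eq] at h1
      nth_rw 1 [h1]
      exact norm_sub_le _ _
    have h3 := K.le_of_opNorm_le hK (T s)
    linarith

end SummableSequences

/-! ### Series with half-integer frequencies, and their perturbed equations. -/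

section TrigonometricSeries

variable {n : ℕ}

/-- The frequency `k + (1/2, …, 1/2)`, which never vanishes if `n` is positive. -/
def freq (k : Fin n → ℤ) : EuclideanSpace ℝ (Fin n) :=
  latticePt k + WithLp.toLp 2 fun _ => (1 / 2 : ℝ)

lemma latticePt_add (k l : Fin n → ℤ) : latticePt (k + l) = latticePt k + latticePt l := by
  ext i; simp [latticePt]

/-- Multiplication by an ordinary Fourier series maps series with shifted frequencies to such
series, so variable coefficients act on the shifted lattice. -/
lemma char_freq_add (k l : Fin n → ℤ) (y : EuclideanSpace ℝ (Fin n)) :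
    char (freq (l + k)) y = char (latticePt k) y * char (freq l) y := by
  rw [← char_add]
  congr 1
  rw [freq, freq, latticePt_add]
  abel

/-- Each coordinate of a frequency is half an odd integer. The index `i` records that the dimension
is positive. -/
lemma half_le_norm_freq (i : Fin n) (k : Fin n → ℤ) : 1 / 2 ≤ ‖freq k‖ := by
  refine le_trans ?_ (PiLp.norm_apply_le (freq k) i)
  simp only [freq, latticePt, PiLp.add_apply, Real.norm_eq_abs]
  rcases le_or_gt 0 (k i) with h | h
  · have : (0 : ℝ) ≤ k i := by exact_mod_cast h
    rw [abs_of_nonneg (by linarith)]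
    linarith
  · have : (k i : ℝ) ≤ -1 := by exact_mod_cast Int.le_sub_one_of_lt h
    rw [abs_of_nonpos (by linarith)]
    linarith

/-- A perturbation of the identity by small multiples, with coefficients given by absolutely
convergent Fourier series, of bounded Fourier multipliers is invertible. -/
lemma exists_perturbed_series {α : Type*} [Fintype α] (m c : α → (Fin n → ℤ) → ℂ)
    (s : (Fin n → ℤ) → ℂ) {B : ℝ} (hm : ∀ a k, ‖m a k‖ ≤ B) (hc : ∀ a, Summable fun k => ‖c a k‖)
    (hsmall : ∑ a, B * ∑' k, ‖c a k‖ ≤ 1 / 2) (hs : Summable fun k => ‖s k‖) :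
    ∃ v : (Fin n → ℤ) → ℂ, (Summable fun k => ‖v k‖) ∧ ∑' k, ‖v k‖ ≤ 2 * ∑' k, ‖s k‖ ∧
      ∀ y, ∑' k, v k * char (freq k) y + ∑ a, (∑' k, c a k * char (latticePt k) y) *
        ∑' k, v k * m a k * char (freq k) y = ∑' k, s k * char (freq k) y := by
  classical
  let δ : (Fin n → ℤ) → SummableFamily (Fin n → ℤ) := fun k => lp.single 1 k 1
  have hδ : ∀ k, ‖δ k‖ ≤ 1 := fun k => by simp [δ, lp.norm_single]
  let C : α → SummableFamily (Fin n → ℤ) := fun a => SummableFamily.mk (c a) (hc a)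
  have hC : ∀ a, ‖C a‖ = ∑' k, ‖c a k‖ := fun a => (SummableFamily.norm_eq (C a))
  -- The perturbation applied to the unit vector `δ k`: the multipliers act by the scalars `m a k`,
  -- and convolving `c a` with `δ k` is a shift by `k`. By linearity and continuity these values
  -- determine the operator on ℓ¹.
  let b : (Fin n → ℤ) → SummableFamily (Fin n → ℤ) := fun k =>
    ∑ a, m a k • SummableFamily.lift (fun l => δ (k + l)) 1 (fun l => hδ _) (C a)
  have hb : ∀ k, ‖b k‖ ≤ 1 / 2 := fun k => by
    refine (norm_sum_le _ _).trans (le_trans (Finset.sum_le_sum fun a _ => ?_) hsmall)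
    rw [norm_smul, ← hC]
    have := (SummableFamily.lift (fun l => δ (k + l)) 1 (fun l => hδ _)).le_of_opNorm_le
      (SummableFamily.norm_lift_le _ _ _) (C a)
    rw [one_mul] at this
    exact mul_le_mul (hm a k) this (norm_nonneg _) ((norm_nonneg _).trans (hm a k))
  obtain ⟨v, hv, hvn⟩ := exists_add_apply_eq (SummableFamily.lift b _ hb)
    (SummableFamily.norm_lift_le _ _ _) (SummableFamily.mk s hs)
  refine ⟨v, (SummableFamily.summable_norm v), ?_, fun y => ?_⟩
  · rwa [(SummableFamily.norm_eq v), SummableFamily.norm_eq] at hvn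
  -- Summing the series at `y` is a continuous functional on ℓ¹ that takes convolution to
  -- multiplication. Applying it to the abstract equation gives the pointwise one.
  let ev := SummableFamily.lift (fun k => char (freq k) y) 1 fun k => (norm_char _ _).le
  have hev : ∀ k, ev (δ k) = char (freq k) y := fun k => by
    rw [SummableFamily.lift_apply, tsum_eq_single k]
    · simp [δ]
    · intro l hl
      simp [δ, lp.single_apply, hl]
  have hevb : ∀ k, ev (b k) = ∑ a, (∑' l, c a l * char (latticePt l) y) *
      (m a k * char (freq k) y) := fun k => by
    rw [map_sum]
    refine Finset.sum_congr rfl fun a _ => ?_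
    rw [map_smul, SummableFamily.lift_apply (fun l => δ (k + l)), ev.map_tsum (SummableFamily.summable_smul (C a) fun l => hδ (k + l))]
    simp only [map_smul, hev, char_freq_add, smul_eq_mul, C, SummableFamily.mk_apply]
    rw [← tsum_mul_left, ← tsum_mul_right]
    refine tsum_congr fun l => ?_
    ring
  have h := congrArg ev hv
  rw [map_add, SummableFamily.lift_apply b, ev.map_tsum (SummableFamily.summable_smul v hb)] at h
  simp only [map_smul, hevb] at h
  simp only [ev, SummableFamily.lift_apply, smul_eq_mul, SummableFamily.mk_apply] at h
  rw [← h]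
  congr 1
  simp only [Finset.mul_sum]
  rw [Summable.tsum_finsetSum]
  · refine Finset.sum_congr rfl fun a _ => ?_
    rw [← tsum_mul_left]
    refine tsum_congr fun k => ?_
    ring
  · intro a _
    have : ∀ k, ‖(∑' l, c a l * char (latticePt l) y) * (m a k * char (freq k) y)‖ ≤
        ‖∑' l, c a l * char (latticePt l) y‖ * B := fun k => by
      rw [norm_mul, norm_mul, norm_char, mul_one]
      exact mul_le_mul_of_nonneg_left (hm a k) (norm_nonneg _)
    exact SummableFamily.summable_smul v this

/-! ### Derivatives of trigonometric series -/

lemma hasFDerivAt_char (κ y : EuclideanSpace ℝ (Fin n)) :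
    HasFDerivAt (char κ) ((2 * Real.pi * Complex.I * char κ y) •
      (Complex.ofRealCLM ∘L innerSL ℝ κ)) y := by
  have h1 : HasFDerivAt (fun y : EuclideanSpace ℝ (Fin n) => inner ℝ κ y) (innerSL ℝ κ) y :=
    (innerSL ℝ κ).hasFDerivAt
  have h2 : HasFDerivAt (fun y => ((2 * Real.pi * inner ℝ κ y : ℝ) : ℂ) * Complex.I)
      ((2 * Real.pi * Complex.I) • (Complex.ofRealCLM ∘L innerSL ℝ κ)) y := by
    have h3 := (Complex.ofRealCLM.hasFDerivAt (x := inner ℝ κ y)).comp y h1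
    have h4 := h3.const_mul (2 * Real.pi * Complex.I : ℂ)
    refine h4.congr_of_eventuallyEq (Eventually.of_forall fun z => ?_)
    simp
    ring
  have h5 := h2.cexp
  refine h5.congr_fderiv ?_
  ext v
  simp [char]
  ring

lemma norm_ofReal_inner_le (κ : EuclideanSpace ℝ (Fin n)) :
    ‖Complex.ofRealCLM ∘L innerSL ℝ κ‖ ≤ ‖κ‖ := by
  refine (ContinuousLinearMap.opNorm_comp_le _ _).trans ?_
  simp

lemma hasFDerivAt_series {d : (Fin n → ℤ) → ℂ} (hd : Summable fun k => ‖d k‖)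
    (hd1 : Summable fun k => ‖d k‖ * ‖freq k‖) (y : EuclideanSpace ℝ (Fin n)) :
    HasFDerivAt (fun y => ∑' k, d k * char (freq k) y)
      (∑' k, d k • ((2 * Real.pi * Complex.I * char (freq k) y) •
        (Complex.ofRealCLM ∘L innerSL ℝ (freq k)))) y ∧
    Summable fun k => d k • ((2 * Real.pi * Complex.I * char (freq k) y) •
        (Complex.ofRealCLM ∘L innerSL ℝ (freq k))) := by
  have hb : ∀ k y, ‖d k • ((2 * Real.pi * Complex.I * char (freq k) y) •
        (Complex.ofRealCLM ∘L innerSL ℝ (freq k)))‖ ≤ 2 * Real.pi * (‖d k‖ * ‖freq k‖) := by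
    intro k y
    rw [norm_smul, norm_smul]
    have : ‖2 * Real.pi * Complex.I * char (freq k) y‖ = 2 * Real.pi := by
      simp [norm_char, abs_of_pos Real.pi_pos]
    rw [this, mul_left_comm]
    have := norm_ofReal_inner_le (freq k)
    have := Real.pi_pos
    gcongr
  refine ⟨hasFDerivAt_tsum (hd1.mul_left (2 * Real.pi))
    (fun k y => (hasFDerivAt_char (freq k) y).const_mul (d k)) hb (x₀ := 0) ?_ y,
    Summable.of_norm_bounded (hd1.mul_left (2 * Real.pi)) fun k => hb k y⟩
  refine Summable.of_norm_bounded hd fun k => ?_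
  rw [norm_mul, norm_char, mul_one]

lemma partialD_series {d : (Fin n → ℤ) → ℂ} (hd : Summable fun k => ‖d k‖)
    (hd1 : Summable fun k => ‖d k‖ * ‖freq k‖) (i : Fin n) :
    partialD i (fun y => ∑' k, d k * char (freq k) y) =
      fun y => ∑' k, d k * (2 * Real.pi * Complex.I * freq k i) * char (freq k) y := by
  ext y
  obtain ⟨h, hs⟩ := hasFDerivAt_series hd hd1 y
  rw [partialD, h.fderiv]
  have := (ContinuousLinearMap.apply ℝ ℂ (stdVec i)).map_tsum hs
  simp only [ContinuousLinearMap.apply_apply] at this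
  rw [this]
  refine tsum_congr fun k => ?_
  simp [EuclideanSpace.inner_single_right]
  ring

lemma continuous_series {d : (Fin n → ℤ) → ℂ} (hd : Summable fun k => ‖d k‖) :
    Continuous fun y => ∑' k, d k * char (freq k) y := by
  refine continuous_tsum (fun k => ?_) hd fun k y => ?_
  · exact continuous_const.mul
      (continuous_iff_continuousAt.2 fun y => (hasFDerivAt_char (freq k) y).continuousAt)
  · rw [norm_mul, norm_char, mul_one]

lemma contDiff_succ_of_partialD {F : Type*} [NormedAddCommGroup F] [NormedSpace ℝ F] {r : ℕ}
    {u : EuclideanSpace ℝ (Fin n) → F} (hu : Differentiable ℝ u)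
    (h : ∀ i, ContDiff ℝ r (partialD i u)) : ContDiff ℝ (r + 1) u := by
  refine contDiff_succ_iff_fderiv.2 ⟨hu, by simp, ?_⟩
  have : fderiv ℝ u = fun y => ∑ i, (EuclideanSpace.proj i :
      EuclideanSpace ℝ (Fin n) →L[ℝ] ℝ).smulRight (partialD i u y) := by
    ext y v
    conv_lhs => rw [← (EuclideanSpace.basisFun (Fin n) ℝ).sum_repr v]
    simp [partialD]
  rw [this]
  exact ContDiff.sum fun i _ =>
    (ContinuousLinearMap.smulRightL ℝ (EuclideanSpace ℝ (Fin n)) F (EuclideanSpace.proj i)).contDiff.comp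
      (h i)

lemma norm_two_pi_I_mul (x : ℝ) : ‖(2 * Real.pi * Complex.I * x : ℂ)‖ = 2 * Real.pi * |x| := by
  simp [abs_of_pos Real.pi_pos]

lemma contDiff_one_series {d : (Fin n → ℤ) → ℂ} (hd : Summable fun k => ‖d k‖)
    (hd1 : Summable fun k => ‖d k‖ * ‖freq k‖) :
    ContDiff ℝ 1 fun y => ∑' k, d k * char (freq k) y := by
  refine contDiff_succ_of_partialD (r := 0)
    (fun y => (hasFDerivAt_series hd hd1 y).1.differentiableAt) fun i => ?_
  rw [partialD_series hd hd1]
  refine contDiff_zero.2 (continuous_series ?_)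
  refine Summable.of_nonneg_of_le (fun _ => norm_nonneg _) (fun k => ?_)
    (hd1.mul_left (2 * Real.pi))
  rw [norm_mul, norm_two_pi_I_mul, mul_left_comm]
  have := PiLp.norm_apply_le (freq k) i
  have := Real.pi_pos
  gcongr
  assumption

/-- Each derivative costs one power of the frequency, so weights up to the second power allow two
termwise differentiations. -/
lemma contDiff_two_series {d : (Fin n → ℤ) → ℂ} (hd : Summable fun k => ‖d k‖)
    (hd1 : Summable fun k => ‖d k‖ * ‖freq k‖)
    (hd2 : Summable fun k => ‖d k‖ * ‖freq k‖ ^ 2) :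
    ContDiff ℝ 2 (fun y => ∑' k, d k * char (freq k) y) ∧ ∀ i j,
      partialD i (partialD j (fun y => ∑' k, d k * char (freq k) y)) = fun y => ∑' k,
        d k * (2 * Real.pi * Complex.I * freq k j) * (2 * Real.pi * Complex.I * freq k i) *
          char (freq k) y := by
  have h1 : ∀ i, Summable fun k => ‖d k * (2 * Real.pi * Complex.I * freq k i)‖ := fun i => by
    refine Summable.of_nonneg_of_le (fun _ => norm_nonneg _) (fun k => ?_)
      (hd1.mul_left (2 * Real.pi))
    rw [norm_mul, norm_two_pi_I_mul, mul_left_comm]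
    have := PiLp.norm_apply_le (freq k) i
    have := Real.pi_pos
    gcongr
    assumption
  have h2 : ∀ i, Summable fun k =>
      ‖d k * (2 * Real.pi * Complex.I * freq k i)‖ * ‖freq k‖ := fun i => by
    refine Summable.of_nonneg_of_le (fun _ => by positivity) (fun k => ?_)
      (hd2.mul_left (2 * Real.pi))
    rw [norm_mul, norm_two_pi_I_mul]
    have := Real.pi_pos
    calc ‖d k‖ * (2 * Real.pi * |freq k i|) * ‖freq k‖
        ≤ ‖d k‖ * (2 * Real.pi * ‖freq k‖) * ‖freq k‖ := by
          gcongr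
          exact PiLp.norm_apply_le (freq k) i
      _ = 2 * Real.pi * (‖d k‖ * ‖freq k‖ ^ 2) := by ring
  constructor
  · refine contDiff_succ_of_partialD (r := 1)
      (fun y => (hasFDerivAt_series hd hd1 y).1.differentiableAt) fun i => ?_
    rw [partialD_series hd hd1]
    exact contDiff_one_series (h1 i) (h2 i)
  · intro i j
    rw [partialD_series hd hd1, partialD_series (h1 j) (h2 j)]

end TrigonometricSeries

end FHarmonic
end

open scoped Manifold ContDiff

noncomputable section

namespace FHarmonic

open MeasureTheory Filter Topology

/-! ### Local solvability of second order elliptic equations -/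

section LocalSolvability

variable {n : ℕ}

/-- Small perturbations, with coefficients given by absolutely convergent Fourier series, of an
elliptic operator with constant coefficients are solvable in `C²`. -/
lemma exists_series_solution (i₀ : Fin n) {a₀ : Fin n → Fin n → ℝ} {lam : ℝ} (hlam : 0 < lam)
    (ha₀ : ∀ ξ : EuclideanSpace ℝ (Fin n), lam * ‖ξ‖ ^ 2 ≤ ∑ i, ∑ j, a₀ i j * (ξ i * ξ j))
    {c : Fin n → Fin n → (Fin n → ℤ) → ℂ} {d : Fin n → (Fin n → ℤ) → ℂ} {s : (Fin n → ℤ) → ℂ}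
    (hc : ∀ i j, Summable fun k => ‖c i j k‖) (hd : ∀ i, Summable fun k => ‖d i k‖)
    (hs : Summable fun k => ‖s k‖)
    (hsmall : ∑ i, ∑ j, lam⁻¹ * ∑' k, ‖c i j k‖ + ∑ i, lam⁻¹ * ∑' k, ‖d i k‖ ≤ 1 / 2) :
    ∃ W : EuclideanSpace ℝ (Fin n) → ℂ, ContDiff ℝ 2 W ∧
      (∀ y, ∑ i, ∑ j, (a₀ i j + ∑' k, c i j k * char (latticePt k) y) *
          partialD i (partialD j W) y +
        ∑ i, (∑' k, d i k * char (latticePt k) y) * partialD i W y =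
          ∑' k, s k * char (freq k) y) ∧
      (∀ i y, ‖partialD i W y‖ ≤ lam⁻¹ * (2 * ∑' k, ‖s k‖)) ∧
      ∀ i j y, ‖partialD i (partialD j W) y‖ ≤ lam⁻¹ * (2 * ∑' k, ‖s k‖) := by
  have hpi := Real.pi_pos
  let q : (Fin n → ℤ) → ℝ := fun k => ∑ i, ∑ j, a₀ i j * (freq k i * freq k j)
  have hκ : ∀ k, 1 / 2 ≤ ‖freq k‖ := half_le_norm_freq i₀
  have hq : ∀ k, 0 < q k := fun k => by
    have := hκ k
    have h1 : 0 < lam * ‖freq k‖ ^ 2 := by positivity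
    exact h1.trans_le (ha₀ (freq k))
  -- The inverse of the symbol `-4π² q` of the constant-coefficient part. The unknown is `v`, the
  -- coefficients of that part applied to `W`; `W` itself has coefficients `v k * σ k`.
  let σ : (Fin n → ℤ) → ℂ := fun k => ((-(4 * Real.pi ^ 2 * q k)⁻¹ : ℝ) : ℂ)
  let β : ℝ := (4 * Real.pi ^ 2 * lam)⁻¹
  have hβ : 0 < β := by positivity
  have hσ2 : ∀ k, ‖σ k‖ * ‖freq k‖ ^ 2 ≤ β := fun k => by
    have h0 := hq k
    have h1 := ha₀ (freq k)
    simp only [σ, Complex.norm_real, norm_neg, Real.norm_eq_abs, β]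
    rw [abs_of_pos (by positivity), inv_mul_le_iff₀ (by positivity), ← div_eq_mul_inv,
      le_div_iff₀ (by positivity)]
    calc ‖freq k‖ ^ 2 * (4 * Real.pi ^ 2 * lam)
        = 4 * Real.pi ^ 2 * (lam * ‖freq k‖ ^ 2) := by ring
      _ ≤ 4 * Real.pi ^ 2 * q k := by gcongr
  -- As frequencies have norm at least 1/2, dropping one power of the norm costs only a factor 2.
  have hσ1 : ∀ k, ‖σ k‖ * ‖freq k‖ ≤ 2 * β := fun k => by
    have h1 := hκ k
    have h2 := hσ2 k
    have h3 := mul_nonneg (norm_nonneg (σ k)) (norm_nonneg (freq k))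
    nlinarith
  have hσ0 : ∀ k, ‖σ k‖ ≤ 4 * β := fun k => by
    have h1 := hκ k
    have h2 := hσ1 k
    have h3 := norm_nonneg (σ k)
    nlinarith
  -- The multipliers taking `v` to the second derivatives (left summand) and the first derivatives
  -- (right summand) of `W`. Ellipticity bounds both kinds by `lam⁻¹`.
  let m : (Fin n × Fin n) ⊕ Fin n → (Fin n → ℤ) → ℂ := Sum.elim
    (fun p k => σ k * (2 * Real.pi * Complex.I * freq k p.2) *
      (2 * Real.pi * Complex.I * freq k p.1))
    (fun i k => σ k * (2 * Real.pi * Complex.I * freq k i))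
  have hm : ∀ a k, ‖m a k‖ ≤ lam⁻¹ := by
    rintro (⟨i, j⟩ | i) k
    · simp only [m, Sum.elim_inl, norm_mul (σ k * _), norm_mul (σ k), norm_two_pi_I_mul]
      have h1 : |freq k i| ≤ ‖freq k‖ := PiLp.norm_apply_le (freq k) i
      have h2 : |freq k j| ≤ ‖freq k‖ := PiLp.norm_apply_le (freq k) j
      calc ‖σ k‖ * (2 * Real.pi * |freq k j|) * (2 * Real.pi * |freq k i|)
          ≤ ‖σ k‖ * (2 * Real.pi * ‖freq k‖) * (2 * Real.pi * ‖freq k‖) := by gcongr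
        _ = 4 * Real.pi ^ 2 * (‖σ k‖ * ‖freq k‖ ^ 2) := by ring
        _ ≤ 4 * Real.pi ^ 2 * β := by gcongr; exact hσ2 k
        _ = lam⁻¹ := by simp only [β]; field_simp
    · simp only [m, Sum.elim_inr, norm_mul (σ k), norm_two_pi_I_mul]
      have h1 : |freq k i| ≤ ‖freq k‖ := PiLp.norm_apply_le (freq k) i
      calc ‖σ k‖ * (2 * Real.pi * |freq k i|)
          ≤ ‖σ k‖ * (2 * Real.pi * ‖freq k‖) := by gcongr
        _ = 2 * Real.pi * (‖σ k‖ * ‖freq k‖) := by ring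
        _ ≤ 2 * Real.pi * (2 * β) := mul_le_mul_of_nonneg_left (hσ1 k) (by positivity)
        _ = Real.pi⁻¹ * lam⁻¹ := by simp only [β]; field_simp; norm_num
        _ ≤ lam⁻¹ := by
          refine mul_le_of_le_one_left (by positivity) (inv_le_one_of_one_le₀ ?_)
          linarith [Real.pi_gt_three]
  obtain ⟨v, hv, hvs, heq⟩ := exists_perturbed_series m
    (Sum.elim (fun p => c p.1 p.2) d) s hm (by rintro (⟨i, j⟩ | i) <;> simp [hc, hd])
    (by simpa [Fintype.sum_sum_type, Fintype.sum_prod_type] using hsmall) hs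
  have hvσ : ∀ (N : ℕ) (C : ℝ), (∀ k, ‖σ k‖ * ‖freq k‖ ^ N ≤ C) →
      Summable fun k => ‖v k * σ k‖ * ‖freq k‖ ^ N := fun N C hC => by
    refine Summable.of_nonneg_of_le (fun k => by positivity) (fun k => ?_) (hv.mul_right C)
    rw [norm_mul, mul_assoc]
    exact mul_le_mul_of_nonneg_left (hC k) (norm_nonneg _)
  have h0 : Summable fun k => ‖v k * σ k‖ := by
    simpa using hvσ 0 (4 * β) (by simpa using hσ0)
  have h1 : Summable fun k => ‖v k * σ k‖ * ‖freq k‖ := by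
    simpa using hvσ 1 (2 * β) (by simpa using hσ1)
  have h2 := hvσ 2 β hσ2
  obtain ⟨hW, hW2⟩ := contDiff_two_series h0 h1 h2
  have hW1 := partialD_series h0 h1
  have hmsum : ∀ a y, Summable fun k => v k * m a k * char (freq k) y := fun a y => by
    refine Summable.of_norm_bounded (hv.mul_right lam⁻¹) fun k => ?_
    rw [norm_mul, norm_mul, norm_char, mul_one]
    exact mul_le_mul_of_nonneg_left (hm a k) (norm_nonneg _)
  have hbound : ∀ a y, ‖∑' k, v k * m a k * char (freq k) y‖ ≤ lam⁻¹ * (2 * ∑' k, ‖s k‖) :=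
    fun a y => by
    refine (tsum_of_norm_bounded (hv.mul_right lam⁻¹).hasSum fun k => ?_).trans ?_
    · rw [norm_mul, norm_mul, norm_char, mul_one]
      exact mul_le_mul_of_nonneg_left (hm a k) (norm_nonneg _)
    · rw [tsum_mul_right, mul_comm]
      gcongr
  have hW1' : ∀ i y, partialD i (fun y => ∑' k, v k * σ k * char (freq k) y) y =
      ∑' k, v k * m (Sum.inr i) k * char (freq k) y := fun i y => by
    rw [hW1]
    refine tsum_congr fun k => ?_
    simp only [m, Sum.elim_inr]
    ring
  have hW2' : ∀ i j y, partialD i (partialD j (fun y => ∑' k, v k * σ k * char (freq k) y)) y =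
      ∑' k, v k * m (Sum.inl (i, j)) k * char (freq k) y := fun i j y => by
    rw [hW2]
    refine tsum_congr fun k => ?_
    simp only [m, Sum.elim_inl]
    ring
  refine ⟨fun y => ∑' k, v k * σ k * char (freq k) y, hW, fun y => ?_, fun i y => ?_,
    fun i j y => ?_⟩
  · simp only [hW1', hW2']
    rw [← heq y]
    simp only [Fintype.sum_sum_type, Fintype.sum_prod_type, Sum.elim_inl, Sum.elim_inr, add_mul,
      Finset.sum_add_distrib]
    rw [add_assoc]
    congr 1
    -- The constant-coefficient operator contributes its symbol times the inverse symbol, which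
    -- returns `v`, the identity part of the equation on ℓ¹.
    have hkey : ∀ k, ∑ i, ∑ j, (a₀ i j : ℂ) * m (Sum.inl (i, j)) k = 1 := fun k => by
      have hqk : ((q k : ℝ) : ℂ) ≠ 0 := by exact_mod_cast (hq k).ne'
      have hq' : ((q k : ℝ) : ℂ) = ∑ i, ∑ j, (a₀ i j : ℂ) * (freq k i * freq k j) := by
        simp only [q]; push_cast; rfl
      have : ∀ i j, (a₀ i j : ℂ) * m (Sum.inl (i, j)) k =
          (σ k * (-(4 * Real.pi ^ 2))) * ((a₀ i j : ℂ) * (freq k i * freq k j)) := fun i j => by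
        simp only [m, Sum.elim_inl]
        linear_combination (4 * (a₀ i j : ℂ) * σ k * Real.pi ^ 2 * freq k j * freq k i) *
          Complex.I_sq
      simp only [this, ← Finset.mul_sum]
      rw [← hq']
      simp only [σ]
      have : (Real.pi : ℂ) ≠ 0 := by exact_mod_cast hpi.ne'
      push_cast
      field_simp
    have hsw : ∑ i, ∑ j, (a₀ i j : ℂ) * ∑' k, v k * m (Sum.inl (i, j)) k * char (freq k) y =
        ∑' k, ∑ i, ∑ j, (a₀ i j : ℂ) * (v k * m (Sum.inl (i, j)) k * char (freq k) y) := by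
      rw [Summable.tsum_finsetSum fun i _ => summable_sum fun j _ => (hmsum _ y).mul_left _]
      refine Finset.sum_congr rfl fun i _ => ?_
      rw [Summable.tsum_finsetSum fun j _ => (hmsum _ y).mul_left _]
      refine Finset.sum_congr rfl fun j _ => ?_
      rw [tsum_mul_left]
    rw [hsw]
    refine tsum_congr fun k => ?_
    have : ∀ i j, (a₀ i j : ℂ) * (v k * m (Sum.inl (i, j)) k * char (freq k) y) =
        (v k * char (freq k) y) * ((a₀ i j : ℂ) * m (Sum.inl (i, j)) k) := fun i j => by ring
    simp only [this, ← Finset.mul_sum, hkey, mul_one]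
  · rw [hW1']; exact hbound _ y
  · rw [hW2']; exact hbound _ y

/-- A smooth function near a point agrees near this point with a smooth function with compact
support. -/
lemma exists_contDiff_hasCompactSupport_eventuallyEq {G : EuclideanSpace ℝ (Fin n) → ℝ}
    {z₀ : EuclideanSpace ℝ (Fin n)} {U : Set (EuclideanSpace ℝ (Fin n))} (hU : U ∈ 𝓝 z₀)
    (hG : ContDiffOn ℝ ∞ G U) : ∃ G' : EuclideanSpace ℝ (Fin n) → ℂ, ContDiff ℝ ∞ G' ∧
      HasCompactSupport G' ∧ G' =ᶠ[𝓝 z₀] fun z => (G z : ℂ) := by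
  obtain ⟨ρ, hρ, hsub⟩ := Metric.mem_nhds_iff.1 hU
  -- The cutoff dies at radius ρ/2, strictly inside the ball where `G` is smooth, so the product is
  -- smooth across the edge of `U` as well.
  let b : ContDiffBump z₀ := ⟨ρ / 4, ρ / 2, by positivity, by linarith⟩
  refine ⟨fun z => ((b z * G z : ℝ) : ℂ), Complex.ofRealCLM.contDiff.comp ?_, ?_, ?_⟩
  · rw [contDiff_iff_contDiffAt]
    intro z
    by_cases hz : z ∈ Metric.ball z₀ ρ
    · exact b.contDiff.contDiffAt.mul
        ((hG.mono hsub).contDiffAt (Metric.isOpen_ball.mem_nhds hz))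
    · have : (fun z => b z * G z) =ᶠ[𝓝 z] fun _ => 0 := by
        have hz' : z ∈ (Metric.closedBall z₀ (ρ / 2))ᶜ := by
          simp only [Metric.mem_ball, not_lt, Set.mem_compl_iff, Metric.mem_closedBall] at hz ⊢
          linarith
        filter_upwards [Metric.isClosed_closedBall.isOpen_compl.mem_nhds hz'] with w hw
        have : b w = 0 := by
          rw [← Function.notMem_support, b.support_eq]
          exact fun h => hw (Metric.ball_subset_closedBall h)
        rw [this, zero_mul]
      exact contDiffAt_const.congr_of_eventuallyEq this
  · exact (b.hasCompactSupport.mul_right (f' := G)).comp_left (g := fun x : ℝ => (x : ℂ)) (by simp)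
  · filter_upwards [b.eventuallyEq_one] with z hz
    simp only [Pi.one_apply] at hz
    simp [hz]

lemma natCast_le_infty (k : ℕ) : (k : WithTop ℕ∞) ≤ ∞ := by
  exact_mod_cast le_top

lemma two_le_infty : (2 : WithTop ℕ∞) ≤ ∞ := natCast_le_infty 2

lemma contDiff_partialD {F : Type*} [NormedAddCommGroup F] [NormedSpace ℝ F]
    {u : EuclideanSpace ℝ (Fin n) → F} {r s : WithTop ℕ∞} (hu : ContDiff ℝ s u) (hrs : r + 1 ≤ s)
    (i : Fin n) : ContDiff ℝ r (partialD i u) :=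
  (hu.fderiv_right hrs).clm_apply contDiff_const

lemma contDiffAt_partialD {F : Type*} [NormedAddCommGroup F] [NormedSpace ℝ F]
    {u : EuclideanSpace ℝ (Fin n) → F} {z : EuclideanSpace ℝ (Fin n)} {r s : WithTop ℕ∞}
    (hu : ContDiffAt ℝ s u z) (hrs : r + 1 ≤ s) (i : Fin n) : ContDiffAt ℝ r (partialD i u) z :=
  (hu.fderiv_right hrs).clm_apply contDiffAt_const

lemma partialD_add {F : Type*} [NormedAddCommGroup F] [NormedSpace ℝ F]
    {u v : EuclideanSpace ℝ (Fin n) → F} {z : EuclideanSpace ℝ (Fin n)}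
    (hu : DifferentiableAt ℝ u z) (hv : DifferentiableAt ℝ v z) (i : Fin n) :
    partialD i (fun z => u z + v z) z = partialD i u z + partialD i v z := by
  simp only [FHarmonic.partialD]
  rw [fderiv_fun_add hu hv]
  rfl

/-- Each derivative costs a factor `r⁻¹`; started from `A = r ^ 2`, two derivatives leave factor 1
and one derivative leaves factor `r`. -/
lemma partialD_re_scale {W : EuclideanSpace ℝ (Fin n) → ℂ} (hW : Differentiable ℝ W)
    (A r : ℝ) (z₀ : EuclideanSpace ℝ (Fin n)) (i : Fin n) :
    partialD i (fun z => A * (W (r⁻¹ • (z - z₀))).re) =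
      fun z => A * r⁻¹ * (partialD i W (r⁻¹ • (z - z₀))).re := by
  ext z
  have h1 : HasFDerivAt (fun z => r⁻¹ • (z - z₀))
      (r⁻¹ • ContinuousLinearMap.id ℝ (EuclideanSpace ℝ (Fin n))) z :=
    ((hasFDerivAt_id z).sub_const z₀).const_smul r⁻¹
  have h2 := (Complex.reCLM.hasFDerivAt.comp z ((hW _).hasFDerivAt.comp z h1)).const_mul A
  have h3 : fderiv ℝ (fun z => A * (W (r⁻¹ • (z - z₀))).re) z = _ := h2.fderiv
  rw [partialD, h3]
  simp [partialD, mul_assoc]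

/-- The constant is the minimum of the form on the compact unit sphere; homogeneity extends the
bound to all vectors. -/
lemma exists_pos_mul_norm_sq_le {a₀ : Fin n → Fin n → ℝ}
    (hpos : ∀ ξ : EuclideanSpace ℝ (Fin n), ξ ≠ 0 → 0 < ∑ i, ∑ j, a₀ i j * (ξ i * ξ j))
    (i₀ : Fin n) : ∃ lam : ℝ, 0 < lam ∧
      ∀ ξ : EuclideanSpace ℝ (Fin n), lam * ‖ξ‖ ^ 2 ≤ ∑ i, ∑ j, a₀ i j * (ξ i * ξ j) := by
  have hne : (Metric.sphere (0 : EuclideanSpace ℝ (Fin n)) 1).Nonempty :=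
    ⟨stdVec i₀, by simp⟩
  obtain ⟨η, hη, hmin⟩ := (isCompact_sphere (0 : EuclideanSpace ℝ (Fin n)) 1).exists_isMinOn hne
    (f := fun ξ => ∑ i, ∑ j, a₀ i j * (ξ i * ξ j)) (by fun_prop)
  have hη0 : η ≠ 0 := by
    rintro rfl
    simp at hη
  refine ⟨_, hpos η hη0, fun ξ => ?_⟩
  rcases eq_or_ne ξ 0 with rfl | hξ
  · simp
  · have hn : 0 < ‖ξ‖ := norm_pos_iff.2 hξ
    have h1 := isMinOn_iff.1 hmin (‖ξ‖⁻¹ • ξ) (by simp [norm_smul, hn.ne'])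
    have h2 : ∑ i, ∑ j, a₀ i j * ((‖ξ‖⁻¹ • ξ) i * (‖ξ‖⁻¹ • ξ) j) =
        (‖ξ‖ ^ 2)⁻¹ * ∑ i, ∑ j, a₀ i j * (ξ i * ξ j) := by
      simp only [Finset.mul_sum, PiLp.smul_apply, smul_eq_mul]
      refine Finset.sum_congr rfl fun i _ => Finset.sum_congr rfl fun j _ => ?_
      ring
    rw [h2] at h1
    rw [mul_comm]
    calc ‖ξ‖ ^ 2 * _ ≤ ‖ξ‖ ^ 2 * ((‖ξ‖ ^ 2)⁻¹ * ∑ i, ∑ j, a₀ i j * (ξ i * ξ j)) := by gcongr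
      _ = _ := by field_simp

lemma exists_small_scale {T S ε : ℝ} (hε : 0 < ε) :
    ∃ r : ℝ, 0 < r ∧ r ≤ 1 ∧ T * r ≤ 1 / 2 ∧ S * r ≤ ε := by
  have h : ∀ c δ : ℝ, 0 < δ → ∀ᶠ r : ℝ in 𝓝[>] 0, c * r ≤ δ := fun c δ hδ => by
    refine nhdsWithin_le_nhds ?_
    have : Tendsto (fun r : ℝ => c * r) (𝓝 0) (𝓝 (c * 0)) := by
      exact (continuous_const.mul continuous_id).tendsto 0
    rw [mul_zero] at this
    exact this.eventually_le_const hδ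
  have h1 := h 1 1 one_pos
  obtain ⟨r, ⟨⟨hr1, hT⟩, hS⟩, hr⟩ :=
    (((h1.and (h T (1 / 2) (by norm_num))).and (h S ε hε)).and self_mem_nhdsWithin).exists
  exact ⟨r, hr, by linarith, hT, hS⟩

/-- Local solvability of a second order elliptic equation with smooth coefficients, with the
derivatives of order at most two at the centre prescribed up to a small error. -/
theorem exists_solution_near_jet {a : Fin n → Fin n → EuclideanSpace ℝ (Fin n) → ℝ}
    {b : Fin n → EuclideanSpace ℝ (Fin n) → ℝ} {p : EuclideanSpace ℝ (Fin n) → ℝ}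
    {z₀ : EuclideanSpace ℝ (Fin n)} {U : Set (EuclideanSpace ℝ (Fin n))} (hU : U ∈ 𝓝 z₀)
    (ha : ∀ i j, ContDiffOn ℝ ∞ (a i j) U) (hb : ∀ i, ContDiffOn ℝ ∞ (b i) U)
    (hp : ContDiff ℝ ∞ p)
    (hpos : ∀ ξ : EuclideanSpace ℝ (Fin n), ξ ≠ 0 → 0 < ∑ i, ∑ j, a i j z₀ * (ξ i * ξ j))
    (hp0 : ∑ i, ∑ j, a i j z₀ * partialD i (partialD j p) z₀ + ∑ i, b i z₀ * partialD i p z₀ = 0)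
    {ε : ℝ} (hε : 0 < ε) :
    ∃ u : EuclideanSpace ℝ (Fin n) → ℝ, ContDiff ℝ 2 u ∧
      (∀ᶠ z in 𝓝 z₀, ∑ i, ∑ j, a i j z * partialD i (partialD j u) z +
        ∑ i, b i z * partialD i u z = 0) ∧
      (∀ i, |partialD i u z₀ - partialD i p z₀| ≤ ε) ∧
      ∀ i j, |partialD i (partialD j u) z₀ - partialD i (partialD j p) z₀| ≤ ε := by
  -- In dimension zero the shifted lattice contains only the zero frequency, but then the equation
  -- and the estimates are empty and `p` serves.
  rcases isEmpty_or_nonempty (Fin n) with hn | ⟨⟨i₀⟩⟩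
  · exact ⟨p, hp.of_le two_le_infty, by simp, fun i => isEmptyElim i,
      fun i => isEmptyElim i⟩
  have hp1 : ∀ i, ContDiff ℝ ∞ (partialD i p) := fun i => contDiff_partialD hp (by simp) i
  have hp2 : ∀ i j, ContDiff ℝ ∞ (partialD i (partialD j p)) := fun i j =>
    contDiff_partialD (hp1 j) (by simp) i
  obtain ⟨lam, hlam, hell⟩ := exists_pos_mul_norm_sq_le hpos i₀
  -- `A` extends the deviation of the leading coefficients from their values at `z₀`, `D` the
  -- lower-order coefficients, and `F` the residual of `p`. `A` and `F` vanish at `z₀`, the latter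
  -- by `hp0`, so their Fourier norms at scale `r` are O(r).
  choose A hA hAc hAe using fun i j => exists_contDiff_hasCompactSupport_eventuallyEq hU
    (G := fun z => a i j z - a i j z₀) ((ha i j).sub contDiffOn_const)
  choose D hD hDc hDe using fun i => exists_contDiff_hasCompactSupport_eventuallyEq hU (hb i)
  obtain ⟨F, hF, hFc, hFe⟩ := exists_contDiff_hasCompactSupport_eventuallyEq hU
    (G := fun z => ∑ i, ∑ j, a i j z * partialD i (partialD j p) z + ∑ i, b i z * partialD i p z)
    ((ContDiffOn.sum fun i _ => ContDiffOn.sum fun j _ => (ha i j).mul (hp2 i j).contDiffOn).add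
      (ContDiffOn.sum fun i _ => (hb i).mul (hp1 i).contDiffOn))
  -- The outer radius 1/4 keeps the support inside the cell.
  let χ₀ : ContDiffBump (0 : EuclideanSpace ℝ (Fin n)) :=
    ⟨1 / 8, 1 / 4, by norm_num, by norm_num⟩
  let χ : EuclideanSpace ℝ (Fin n) → ℂ := fun y => (χ₀ y : ℂ)
  have hχ : ContDiff ℝ ∞ χ := Complex.ofRealCLM.contDiff.comp χ₀.contDiff
  have hχs : Function.support χ ⊆ cell n := fun y hy i => by
    have h1 : y ∈ Function.support χ₀ := fun h => hy (by simp [χ, h])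
    rw [χ₀.support_eq, mem_ball_zero_iff] at h1
    exact (PiLp.norm_apply_le y i).trans h1.le
  have hχ1 : ∀ᶠ y in 𝓝 0, χ y = 1 := by
    filter_upwards [χ₀.eventuallyEq_one] with y hy
    simp only [Pi.one_apply] at hy
    simp [χ, hy]
  -- The half shift between the two lattices. The right-hand side must be a series in shifted
  -- characters, so `F` is expanded after multiplication by `char (-θ)` and the twist is undone at
  -- the end.
  let θ : EuclideanSpace ℝ (Fin n) := WithLp.toLp 2 fun _ => (1 / 2 : ℝ)
  have hchar : ContDiff ℝ ∞ (char (-θ)) := by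
    unfold char
    exact (((Complex.ofRealCLM.contDiff.comp (contDiff_const.mul
      (contDiff_const.inner ℝ contDiff_id))).mul contDiff_const)).cexp
  choose CA hCA0 hCA using fun i j => exists_fourierSeries_scale hχ hχs (hA i j) (hAc i j) z₀
  choose CD hCD0 hCD using fun i => exists_fourierSeries_scale hχ hχs (hD i) (hDc i) z₀
  obtain ⟨CF, hCF0, hCF⟩ := exists_fourierSeries_scale (hχ.mul hchar)
    (fun y hy => hχs (left_ne_zero_of_mul hy)) hF hFc z₀
  -- The bound with `T` makes the perturbation at most 1/2 in norm; the bound with `S` keeps the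
  -- derivatives of the correction below `ε`.
  obtain ⟨r, hr, hr1, hrT, hrS⟩ := exists_small_scale (ε := ε) hε
    (T := ∑ i, ∑ j, lam⁻¹ * CA i j + ∑ i, lam⁻¹ * (CD i * (‖D i z₀‖ + 1)))
    (S := lam⁻¹ * (2 * CF))
  choose c hc hcn hcs using fun i j => hCA i j r hr hr1
  choose d hd hdn hds using fun i => hCD i r hr hr1
  obtain ⟨s, hs, hsn, hss⟩ := hCF r hr hr1
  have hA0 : ∀ i j, A i j z₀ = 0 := fun i j => by
    simpa using (hAe i j).eq_of_nhds
  have hF0 : F z₀ = 0 := by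
    have := hFe.eq_of_nhds
    rw [hp0] at this
    simpa using this
  simp only [hA0, norm_zero, zero_add] at hcn
  rw [hF0, norm_zero, zero_add] at hsn
  have hdr : ∀ i k, ‖(r : ℂ) * d i k‖ = r * ‖d i k‖ := fun i k => by
    rw [norm_mul, Complex.norm_real, Real.norm_of_nonneg hr.le]
  -- The equation in the variable y = (z - z₀)/r: first-order coefficients gain a factor `r`
  -- relative to second-order ones, and the right side is minus the residual of `p`.
  obtain ⟨W, hW, hWeq, hW1, hW2⟩ := exists_series_solution i₀ hlam hell (c := c)
    (d := fun i k => r * d i k) (s := fun k => -s k) hc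
    (fun i => by simpa only [hdr] using (hd i).mul_left r) (by simpa using hs) (by
      refine le_trans ?_ hrT
      rw [add_mul, Finset.sum_mul, Finset.sum_mul]
      refine add_le_add (Finset.sum_le_sum fun i _ => ?_) (Finset.sum_le_sum fun i _ => ?_)
      · rw [Finset.sum_mul]
        refine Finset.sum_le_sum fun j _ => ?_
        rw [mul_assoc]
        exact mul_le_mul_of_nonneg_left (hcn i j) (by positivity)
      · rw [mul_assoc]
        refine mul_le_mul_of_nonneg_left ?_ (by positivity)
        simp only [hdr, tsum_mul_left]
        rw [mul_comm]
        refine mul_le_mul_of_nonneg_right ((hdn i).trans ?_) hr.le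
        have := hCD0 i
        gcongr)
  simp only [norm_neg] at hW1 hW2
  have hfin : lam⁻¹ * (2 * ∑' k, ‖s k‖) ≤ ε := by
    refine le_trans ?_ hrS
    rw [mul_assoc, mul_assoc]
    gcongr
  have hW1d : ∀ i, ContDiff ℝ 1 (partialD i W) := fun i =>
    contDiff_partialD hW (by norm_num) i
  let R : EuclideanSpace ℝ (Fin n) → ℝ := fun z => r ^ 2 * (W (r⁻¹ • (z - z₀))).re
  have hR : ContDiff ℝ 2 R :=
    contDiff_const.mul (Complex.reCLM.contDiff.comp (hW.comp
      ((contDiff_id.sub contDiff_const).const_smul r⁻¹)))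
  have hR1 : ∀ i, partialD i R = fun z => r * (partialD i W (r⁻¹ • (z - z₀))).re := fun i => by
    rw [partialD_re_scale (hW.differentiable two_ne_zero)]
    have : r ^ 2 * r⁻¹ = r := by field_simp
    rw [this]
  have hR2 : ∀ i j, partialD i (partialD j R) =
      fun z => (partialD i (partialD j W) (r⁻¹ • (z - z₀))).re := fun i j => by
    rw [hR1, partialD_re_scale ((hW1d j).differentiable one_ne_zero), mul_inv_cancel₀ hr.ne']
    simp
  have hu1 : ∀ i, partialD i (fun z => p z + R z) = fun z => partialD i p z + partialD i R z :=
    fun i => funext fun z => partialD_add (hp.differentiable (by simp) z)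
      (hR.differentiable two_ne_zero z) i
  have hu2 : ∀ i j, partialD i (partialD j (fun z => p z + R z)) =
      fun z => partialD i (partialD j p) z + partialD i (partialD j R) z := fun i j => by
    rw [hu1]
    exact funext fun z => partialD_add ((hp1 j).differentiable (by simp) z)
      ((contDiff_partialD hR (r := 1) (by norm_num) j).differentiable one_ne_zero z) i
  refine ⟨fun z => p z + R z, (hp.of_le two_le_infty).add hR, ?_, fun i => ?_,
    fun i j => ?_⟩
  · have ht : Tendsto (fun z => r⁻¹ • (z - z₀)) (𝓝 z₀) (𝓝 0) := by
      have : Continuous fun z => r⁻¹ • (z - z₀) := by fun_prop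
      simpa using this.tendsto z₀
    have hcell : ∀ᶠ y in 𝓝 (0 : EuclideanSpace ℝ (Fin n)), y ∈ cell n := by
      filter_upwards [hχ1] with y hy
      exact hχs (by simp [Function.mem_support, hy])
    filter_upwards [ht.eventually hχ1, ht.eventually hcell, hFe, eventually_all.2 hDe,
      eventually_all.2 fun i => eventually_all.2 (hAe i)] with z hz1 hzc hzF hzD hzA
    have hz : z₀ + r • (r⁻¹ • (z - z₀)) = z := by
      rw [smul_inv_smul₀ hr.ne']; abel
    have h1 := hWeq (r⁻¹ • (z - z₀))
    have hcz : ∀ i j, ∑' k, c i j k * char (latticePt k) (r⁻¹ • (z - z₀)) =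
        ((a i j z - a i j z₀ : ℝ) : ℂ) := fun i j => by
      rw [(hcs i j _ hzc).tsum_eq, hz1, hz, hzA, one_mul]
    have hdz : ∀ i, ∑' k, r * d i k * char (latticePt k) (r⁻¹ • (z - z₀)) =
        ((r * b i z : ℝ) : ℂ) := fun i => by
      simp only [mul_assoc]
      rw [tsum_mul_left, (hds i _ hzc).tsum_eq, hz1, hz, hzD, one_mul]
      push_cast
      rfl
    have hsz : ∑' k, -s k * char (freq k) (r⁻¹ • (z - z₀)) = -F z := by
      set y := r⁻¹ • (z - z₀)
      have h2 : ∀ k, -s k * char (freq k) y =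
          -(char θ y) * (s k * char (latticePt k) y) := fun k => by
        have : char (freq k) y = char (latticePt k) y * char θ y := char_add _ _ _
        rw [this]
        ring
      simp only [h2]
      rw [tsum_mul_left, (hss _ hzc).tsum_eq, hz1, hz]
      have h3 : char θ y * char (-θ) y = 1 := by
        rw [← char_add, add_neg_cancel, char]
        simp
      linear_combination (-F z) * h3
    simp only [hcz, hdz, hsz, hzF] at h1
    have h2 := congrArg Complex.re h1
    simp only [Complex.add_re, Complex.re_sum, Complex.neg_re, Complex.ofReal_re,
      ← Complex.ofReal_add, Complex.re_ofReal_mul] at h2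
    simp only [hu2, hR2]
    simp only [hu1, hR1, mul_add, Finset.sum_add_distrib]
    have h3 : ∀ i j, (a i j z₀ + (a i j z - a i j z₀)) = a i j z := fun i j => by ring
    simp only [h3] at h2
    have h4 : ∀ i, b i z * (r * (partialD i W (r⁻¹ • (z - z₀))).re) =
        r * b i z * (partialD i W (r⁻¹ • (z - z₀))).re := fun i => by ring
    simp only [h4]
    linarith
  · rw [hu1, hR1]
    simp only [add_sub_cancel_left, sub_self, smul_zero, abs_mul, abs_of_pos hr]
    refine (mul_le_of_le_one_left (abs_nonneg _) hr1).trans ?_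
    exact (Complex.abs_re_le_norm _).trans ((hW1 i _).trans hfin)
  · rw [hu2, hR2]
    simp only [add_sub_cancel_left]
    exact (Complex.abs_re_le_norm _).trans ((hW2 i j _).trans hfin)

end LocalSolvability

end FHarmonic
end

open scoped Manifold ContDiff

noncomputable section

namespace FHarmonic

open Filter Topology

/-! ### Partial derivatives and changes of coordinates -/

section PartialDerivatives

variable {m n : ℕ} {z : EuclideanSpace ℝ (Fin m)}

lemma partialD_congr {F : Type*} [NormedAddCommGroup F] [NormedSpace ℝ F]
    {u v : EuclideanSpace ℝ (Fin m) → F} (h : u =ᶠ[𝓝 z] v) (i : Fin m) :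
    partialD i u z = partialD i v z := by
  rw [partialD, partialD, h.fderiv_eq]

lemma partialD_eventuallyEq {F : Type*} [NormedAddCommGroup F] [NormedSpace ℝ F]
    {u v : EuclideanSpace ℝ (Fin m) → F} (h : u =ᶠ[𝓝 z] v) (i : Fin m) :
    partialD i u =ᶠ[𝓝 z] partialD i v :=
  h.eventuallyEq_nhds.mono fun _ hw => partialD_congr hw i

lemma partialD_sum {ι : Type*} {s : Finset ι} {u : ι → EuclideanSpace ℝ (Fin m) → ℝ}
    (hu : ∀ a ∈ s, DifferentiableAt ℝ (u a) z) (i : Fin m) :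
    partialD i (fun w => ∑ a ∈ s, u a w) z = ∑ a ∈ s, partialD i (u a) z := by
  simp only [partialD]
  rw [fderiv_fun_sum hu]
  simp

lemma partialD_mul {u v : EuclideanSpace ℝ (Fin m) → ℝ} (hu : DifferentiableAt ℝ u z)
    (hv : DifferentiableAt ℝ v z) (i : Fin m) :
    partialD i (fun w => u w * v w) z = partialD i u z * v z + u z * partialD i v z := by
  simp only [partialD]
  rw [fderiv_fun_mul hu hv]
  simp
  ring

lemma partialD_apply {Φ : EuclideanSpace ℝ (Fin m) → EuclideanSpace ℝ (Fin n)}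
    (hΦ : DifferentiableAt ℝ Φ z) (i : Fin m) (a : Fin n) :
    partialD i (fun w => Φ w a) z = fderiv ℝ Φ z (stdVec i) a := by
  have := ((EuclideanSpace.proj a : EuclideanSpace ℝ (Fin n) →L[ℝ] ℝ).hasFDerivAt.comp z
    hΦ.hasFDerivAt).fderiv
  have h2 : fderiv ℝ (fun w => Φ w a) z = _ := this
  rw [partialD, h2]
  rfl

lemma fderiv_apply_eq_sum {F : Type*} [NormedAddCommGroup F] [NormedSpace ℝ F]
    (u : EuclideanSpace ℝ (Fin m) → F) (z v : EuclideanSpace ℝ (Fin m)) :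
    fderiv ℝ u z v = ∑ i, v i • partialD i u z := by
  conv_lhs => rw [← (EuclideanSpace.basisFun (Fin m) ℝ).sum_repr v]
  simp [partialD]

lemma partialD_comp {Φ : EuclideanSpace ℝ (Fin m) → EuclideanSpace ℝ (Fin n)}
    {u : EuclideanSpace ℝ (Fin n) → ℝ} (hu : DifferentiableAt ℝ u (Φ z))
    (hΦ : DifferentiableAt ℝ Φ z) (i : Fin m) :
    partialD i (fun w => u (Φ w)) z =
      ∑ a, partialD i (fun w => Φ w a) z * partialD a u (Φ z) := by
  have h : fderiv ℝ (fun w => u (Φ w)) z = (fderiv ℝ u (Φ z)).comp (fderiv ℝ Φ z) :=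
    fderiv_comp z hu hΦ
  rw [partialD, h, ContinuousLinearMap.comp_apply, fderiv_apply_eq_sum]
  simp only [partialD_apply hΦ, smul_eq_mul]

lemma contDiffAt_coord {Φ : EuclideanSpace ℝ (Fin m) → EuclideanSpace ℝ (Fin n)}
    {r : WithTop ℕ∞} (hΦ : ContDiffAt ℝ r Φ z) (a : Fin n) :
    ContDiffAt ℝ r (fun w => Φ w a) z :=
  (EuclideanSpace.proj a : EuclideanSpace ℝ (Fin n) →L[ℝ] ℝ).contDiff.contDiffAt.comp z hΦ

lemma one_add_one_le_two : (1 : WithTop ℕ∞) + 1 ≤ 2 := by norm_num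

lemma partialD_partialD_comp {Φ : EuclideanSpace ℝ (Fin m) → EuclideanSpace ℝ (Fin n)}
    {u : EuclideanSpace ℝ (Fin n) → ℝ} (hu : ContDiffAt ℝ 2 u (Φ z))
    (hΦ : ContDiffAt ℝ 2 Φ z) (i j : Fin m) :
    partialD i (partialD j fun w => u (Φ w)) z =
      ∑ b, ∑ a, partialD i (fun w => Φ w a) z * partialD j (fun w => Φ w b) z *
        partialD a (partialD b u) (Φ z) +
      ∑ b, partialD i (partialD j fun w => Φ w b) z * partialD b u (Φ z) := by
  have h1 : (partialD j fun w => u (Φ w)) =ᶠ[𝓝 z] fun w =>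
      ∑ b, partialD j (fun w => Φ w b) w * partialD b u (Φ w) := by
    have h2 := hΦ.continuousAt.eventually (hu.eventually (by simp))
    filter_upwards [h2, hΦ.eventually (by simp)] with w hw1 hw2
    exact partialD_comp (hw1.differentiableAt two_ne_zero) (hw2.differentiableAt two_ne_zero) j
  have hd1 : ∀ b, DifferentiableAt ℝ (partialD j fun w => Φ w b) z := fun b =>
    (contDiffAt_partialD (contDiffAt_coord hΦ b) one_add_one_le_two j).differentiableAt one_ne_zero
  have hd2 : ∀ b, DifferentiableAt ℝ (partialD b u) (Φ z) := fun b =>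
    (contDiffAt_partialD hu one_add_one_le_two b).differentiableAt one_ne_zero
  have hΦd := hΦ.differentiableAt two_ne_zero
  have hd3 : ∀ b, DifferentiableAt ℝ (fun w => partialD b u (Φ w)) z := fun b =>
    (hd2 b).comp z hΦd
  rw [partialD_congr h1, partialD_sum fun b _ => (hd1 b).fun_mul (hd3 b),
    ← Finset.sum_add_distrib]
  refine Finset.sum_congr rfl fun b _ => ?_
  rw [partialD_mul (hd1 b) (hd3 b), partialD_comp (hd2 b) hΦd, Finset.mul_sum, add_comm]
  congr 1
  refine Finset.sum_congr rfl fun a _ => ?_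
  ring

lemma partialD_comm {u : EuclideanSpace ℝ (Fin m) → ℝ} (hu : ContDiffAt ℝ 2 u z) (i j : Fin m) :
    partialD i (partialD j u) z = partialD j (partialD i u) z := by
  have h := (hu.isSymmSndFDerivAt (by simp)).eq (stdVec i) (stdVec j)
  have hd : DifferentiableAt ℝ (fderiv ℝ u) z :=
    (hu.fderiv_right one_add_one_le_two).differentiableAt one_ne_zero
  have key : ∀ i j : Fin m, partialD i (partialD j u) z =
      fderiv ℝ (fderiv ℝ u) z (stdVec i) (stdVec j) := fun i j => by
    have : fderiv ℝ (fun w => fderiv ℝ u w (stdVec j)) z = _ :=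
      (hd.hasFDerivAt.clm_apply (hasFDerivAt_const (stdVec j) z)).fderiv
    change fderiv ℝ (fun w => fderiv ℝ u w (stdVec j)) z (stdVec i) = _
    rw [this]
    simp
  rw [key, key, h]

end PartialDerivatives

/-! ### Transformation laws for Christoffel symbols, Hessian and Laplacian. -/

section ChangeOfCoordinates

variable {n : ℕ}

/-- Here `P` stands for the derivatives of the metric `G`, `Q` for the second derivatives of the
coordinate change, and `hP'` is the product rule for Jᵀ G J. Of the six terms containing `Q`, four
cancel in pairs by symmetry and the remaining two coincide, hence the factor 2. -/
lemma firstKind_transform {P Q : Fin n → Fin n → Fin n → ℝ} {G J : Matrix (Fin n) (Fin n) ℝ}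
    (hG : ∀ i j, G i j = G j i) (hQ : ∀ a b i, Q a b i = Q b a i)
    {P' : Fin n → Fin n → Fin n → ℝ}
    (hP' : ∀ c a b, P' c a b = ∑ i, ∑ j, ((∑ l, J l c * P l i j) * (J i a * J j b) +
      G i j * (Q c a i * J j b + J i a * Q c b j))) (a b s : Fin n) :
    P' a b s + P' b a s - P' s a b = ∑ t, J t s *
      (∑ i, ∑ j, (P i j t + P j i t - P t i j) * (J i a * J j b) + 2 * ∑ i, G t i * Q a b i) := by
  set D : Fin n → Fin n → Fin n → ℝ := fun c a b =>
    ∑ i, ∑ j, (∑ l, J l c * P l i j) * (J i a * J j b) with hD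
  set N : Fin n → Fin n → Fin n → ℝ := fun c a b => ∑ i, ∑ j, G i j * (Q c a i * J j b) with hN
  have hP : ∀ c a b, P' c a b = D c a b + N c a b + N c b a := fun c a b => by
    rw [hP']
    have : N c b a = ∑ i, ∑ j, G i j * (J i a * Q c b j) := by
      simp only [hN]
      rw [Finset.sum_comm]
      refine Finset.sum_congr rfl fun i _ => Finset.sum_congr rfl fun j _ => ?_
      rw [hG]; ring
    rw [this]
    simp only [hD, hN, ← Finset.sum_add_distrib]
    refine Finset.sum_congr rfl fun i _ => Finset.sum_congr rfl fun j _ => ?_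
    ring
  have hNs : ∀ c a b, N c a b = N a c b := fun c a b => by
    simp only [hN, hQ c a]
  have hN2 : N a b s = ∑ t, J t s * ∑ i, G t i * Q a b i := by
    simp only [hN, Finset.mul_sum]
    rw [Finset.sum_comm]
    refine Finset.sum_congr rfl fun i _ => Finset.sum_congr rfl fun j _ => ?_
    rw [hG]; ring
  have h1 : D a b s = ∑ t, J t s * ∑ i, ∑ j, P i j t * (J i a * J j b) := by
    simp only [hD, Finset.mul_sum, Finset.sum_mul]
    rw [Finset.sum_comm]
    refine Finset.sum_congr rfl fun t _ => ?_
    rw [Finset.sum_comm]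
    refine Finset.sum_congr rfl fun i _ => Finset.sum_congr rfl fun j _ => ?_
    ring
  have h2 : D b a s = ∑ t, J t s * ∑ i, ∑ j, P j i t * (J i a * J j b) := by
    simp only [hD, Finset.mul_sum, Finset.sum_mul]
    rw [Finset.sum_comm]
    refine Finset.sum_congr rfl fun t _ => ?_
    refine Finset.sum_congr rfl fun i _ => Finset.sum_congr rfl fun j _ => ?_
    ring
  have h3 : D s a b = ∑ t, J t s * ∑ i, ∑ j, P t i j * (J i a * J j b) := by
    simp only [hD, Finset.mul_sum, Finset.sum_mul]
    refine (Finset.sum_congr rfl fun i _ => Finset.sum_comm).trans (Finset.sum_comm.trans ?_)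
    refine Finset.sum_congr rfl fun t _ => ?_
    refine Finset.sum_congr rfl fun i _ => Finset.sum_congr rfl fun j _ => ?_
    ring
  have h4 : ∑ t, J t s * (∑ i, ∑ j, (P i j t + P j i t - P t i j) * (J i a * J j b) +
      2 * ∑ i, G t i * Q a b i) = D a b s + D b a s - D s a b + 2 * N a b s := by
    rw [h1, h2, h3, hN2, Finset.mul_sum]
    simp only [add_mul, sub_mul, Finset.sum_add_distrib, Finset.sum_sub_distrib, mul_add, mul_sub]
    congr 1
    refine Finset.sum_congr rfl fun t _ => ?_
    ring
  rw [h4, hP, hP, hP, hNs b a s, hNs s a b, hNs s b a]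
  ring

/-- Raising the index with (Jᵀ G J)⁻¹ = J⁻¹ G⁻¹ (Jᵀ)⁻¹ cancels the Jᵀ of the first-kind law and
leaves `Q` as the inhomogeneous term. -/
lemma secondKind_transform {P Q : Fin n → Fin n → Fin n → ℝ} {G J : Matrix (Fin n) (Fin n) ℝ}
    (hG : ∀ i j, G i j = G j i) (hQ : ∀ a b i, Q a b i = Q b a i) (hGd : IsUnit G.det)
    (hJd : IsUnit J.det) {P' : Fin n → Fin n → Fin n → ℝ}
    (hP' : ∀ c a b, P' c a b = ∑ i, ∑ j, ((∑ l, J l c * P l i j) * (J i a * J j b) +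
      G i j * (Q c a i * J j b + J i a * Q c b j))) (a b k : Fin n) :
    ∑ c, J k c * (1 / 2 * ∑ s, (J.transpose * G * J)⁻¹ c s *
        (P' a b s + P' b a s - P' s a b)) =
      ∑ i, ∑ j, (1 / 2 * ∑ s, G⁻¹ k s * (P i j s + P j i s - P s i j)) * (J i a * J j b) +
        Q a b k := by
  let x : Fin n → ℝ := fun t =>
    ∑ i, ∑ j, (P i j t + P j i t - P t i j) * (J i a * J j b)
  let y : Fin n → ℝ := fun s => P' a b s + P' b a s - P' s a b
  have hy : y = J.transpose.mulVec (x + (2 : ℝ) • G.mulVec (Q a b)) := by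
    ext s
    simp only [y, firstKind_transform hG hQ hP']
    simp [Matrix.mulVec, dotProduct, x]
  have hinv : (J.transpose * G * J)⁻¹ = J⁻¹ * G⁻¹ * J.transpose⁻¹ := by
    rw [Matrix.mul_inv_rev, Matrix.mul_inv_rev, Matrix.mul_assoc]
  have hJt : IsUnit J.transpose.det := by rwa [Matrix.det_transpose]
  have h1 : J.mulVec ((J.transpose * G * J)⁻¹.mulVec y) =
      G⁻¹.mulVec x + (2 : ℝ) • Q a b := by
    rw [hinv, hy, Matrix.mulVec_mulVec, Matrix.mulVec_mulVec]
    have : J * (J⁻¹ * G⁻¹ * J.transpose⁻¹) * J.transpose = G⁻¹ := by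
      rw [Matrix.mul_assoc, Matrix.mul_assoc (J⁻¹ * G⁻¹), Matrix.nonsing_inv_mul _ hJt,
        Matrix.mul_one, ← Matrix.mul_assoc, Matrix.mul_nonsing_inv _ hJd, Matrix.one_mul]
    rw [this, Matrix.mulVec_add, Matrix.mulVec_smul, Matrix.mulVec_mulVec,
      Matrix.nonsing_inv_mul _ hGd, Matrix.one_mulVec]
  have h2 := congrFun h1 k
  have h3 : ∑ c, J k c * (1 / 2 * ∑ s, (J.transpose * G * J)⁻¹ c s * y s) =
      1 / 2 * J.mulVec ((J.transpose * G * J)⁻¹.mulVec y) k := by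
    simp only [Matrix.mulVec, dotProduct, Finset.mul_sum]
    refine Finset.sum_congr rfl fun c _ => Finset.sum_congr rfl fun s _ => ?_
    ring
  have h4 : ∑ i, ∑ j, (1 / 2 * ∑ s, G⁻¹ k s * (P i j s + P j i s - P s i j)) * (J i a * J j b) =
      1 / 2 * G⁻¹.mulVec x k := by
    simp only [Matrix.mulVec, dotProduct, Finset.mul_sum, Finset.sum_mul, x]
    symm
    rw [Finset.sum_comm]
    refine Finset.sum_congr rfl fun i _ => ?_
    rw [Finset.sum_comm]
    refine Finset.sum_congr rfl fun j _ => Finset.sum_congr rfl fun s _ => ?_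
    ring
  rw [h3, h4, h2]
  simp
  ring

/-- The Christoffel symbols of the metric with matrix `G`. -/
def coordChristoffel (G : EuclideanSpace ℝ (Fin n) → Matrix (Fin n) (Fin n) ℝ)
    (z : EuclideanSpace ℝ (Fin n)) (k i j : Fin n) : ℝ :=
  (1 / 2 : ℝ) * ∑ s, (G z)⁻¹ k s *
    (partialD i (fun w => G w j s) z + partialD j (fun w => G w i s) z
      - partialD s (fun w => G w i j) z)

/-- The Hessian of `u` with respect to the metric with matrix `G`. -/
def coordHessian (G : EuclideanSpace ℝ (Fin n) → Matrix (Fin n) (Fin n) ℝ)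
    (u : EuclideanSpace ℝ (Fin n) → ℝ) (z : EuclideanSpace ℝ (Fin n)) :
    Matrix (Fin n) (Fin n) ℝ := fun i j =>
  partialD i (partialD j u) z - ∑ k, coordChristoffel G z k i j * partialD k u z

/-- The Laplacian of `u` with respect to the metric with matrix `G`. -/
def coordLaplacian (G : EuclideanSpace ℝ (Fin n) → Matrix (Fin n) (Fin n) ℝ)
    (u : EuclideanSpace ℝ (Fin n) → ℝ) (z : EuclideanSpace ℝ (Fin n)) : ℝ :=
  ∑ i, ∑ j, (G z)⁻¹ i j * coordHessian G u z i j

/-- The Jacobian matrix of `T`. -/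
def jacobian (T : EuclideanSpace ℝ (Fin n) → EuclideanSpace ℝ (Fin n))
    (z : EuclideanSpace ℝ (Fin n)) : Matrix (Fin n) (Fin n) ℝ :=
  fun i a => partialD a (fun w => T w i) z

/-- The inhomogeneous term of the Christoffel symbols is exactly the second-derivative term of the
chain rule. So the Hessian transforms as Jᵀ (Hess u) J, and its trace against the inverse metric is
invariant. -/
lemma coordLaplacian_comp {G G' : EuclideanSpace ℝ (Fin n) → Matrix (Fin n) (Fin n) ℝ}
    {T : EuclideanSpace ℝ (Fin n) → EuclideanSpace ℝ (Fin n)} {z : EuclideanSpace ℝ (Fin n)}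
    {u : EuclideanSpace ℝ (Fin n) → ℝ} (hT : ContDiffAt ℝ 2 T z) (hu : ContDiffAt ℝ 2 u (T z))
    (hGd : ∀ i j, DifferentiableAt ℝ (fun w => G w i j) (T z)) (hGs : ∀ i j, G (T z) i j = G (T z) j i)
    (hGu : IsUnit (G (T z)).det) (hJ : IsUnit (jacobian T z).det)
    (hG' : G' =ᶠ[𝓝 z] fun w => (jacobian T w).transpose * G (T w) * jacobian T w) :
    coordLaplacian G' (fun w => u (T w)) z = coordLaplacian G u (T z) := by
  have hTd := hT.differentiableAt two_ne_zero
  have hJd : ∀ i a, DifferentiableAt ℝ (fun w => jacobian T w i a) z := fun i a =>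
    (contDiffAt_partialD (contDiffAt_coord hT i) one_add_one_le_two a).differentiableAt one_ne_zero
  have hGTd : ∀ i j, DifferentiableAt ℝ (fun w => G (T w) i j) z := fun i j =>
    (hGd i j).comp z hTd
  set J := jacobian T z with hJdef
  let P : Fin n → Fin n → Fin n → ℝ := fun l i j => partialD l (fun w => G w i j) (T z)
  let Q : Fin n → Fin n → Fin n → ℝ := fun a b i => partialD a (partialD b fun w => T w i) z
  have hQ : ∀ a b i, Q a b i = Q b a i := fun a b i => partialD_comm (contDiffAt_coord hT i) a b
  have hP' : ∀ c a b, partialD c (fun w => G' w a b) z =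
      ∑ i, ∑ j, ((∑ l, J l c * P l i j) * (J i a * J j b) +
        G (T z) i j * (Q c a i * J j b + J i a * Q c b j)) := fun c a b => by
    have h1 : (fun w => G' w a b) =ᶠ[𝓝 z] fun w =>
        ∑ i, ∑ j, G (T w) i j * (jacobian T w i a * jacobian T w j b) := by
      filter_upwards [hG'] with w hw
      rw [hw]
      simp only [Matrix.mul_apply, Matrix.transpose_apply, Finset.sum_mul]
      rw [Finset.sum_comm]
      refine Finset.sum_congr rfl fun i _ => Finset.sum_congr rfl fun j _ => ?_
      ring
    rw [partialD_congr h1, partialD_sum fun i _ => DifferentiableAt.fun_sum fun j _ =>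
      (hGTd i j).fun_mul ((hJd i a).fun_mul (hJd j b))]
    refine Finset.sum_congr rfl fun i _ => ?_
    rw [partialD_sum fun j _ => (hGTd i j).fun_mul ((hJd i a).fun_mul (hJd j b))]
    refine Finset.sum_congr rfl fun j _ => ?_
    rw [partialD_mul (hGTd i j) ((hJd i a).fun_mul (hJd j b)), partialD_mul (hJd i a) (hJd j b),
      partialD_comp (u := fun w => G w i j) (hGd i j) hTd]
    rfl
  have hG'z : G' z = J.transpose * G (T z) * J := hG'.eq_of_nhds
  have hΓ : ∀ a b k, ∑ c, J k c * coordChristoffel G' z c a b =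
      ∑ i, ∑ j, coordChristoffel G (T z) k i j * (J i a * J j b) + Q a b k := fun a b k => by
    have := secondKind_transform hGs hQ hGu hJ hP' a b k
    simp only [coordChristoffel, hG'z]
    exact this
  have hH : coordHessian G' (fun w => u (T w)) z =
      J.transpose * coordHessian G u (T z) * J := by
    ext a b
    have h1 : ∑ c, coordChristoffel G' z c a b * partialD c (fun w => u (T w)) z =
        ∑ k, (∑ i, ∑ j, coordChristoffel G (T z) k i j * (J i a * J j b) + Q a b k) *
          partialD k u (T z) := by
      simp only [← hΓ, Finset.sum_mul]
      rw [Finset.sum_comm]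
      refine Finset.sum_congr rfl fun c _ => ?_
      rw [partialD_comp (hu.differentiableAt two_ne_zero) hTd, Finset.mul_sum]
      refine Finset.sum_congr rfl fun k _ => ?_
      simp only [hJdef, jacobian]
      ring
    simp only [coordHessian]
    rw [h1, partialD_partialD_comp hu hT]
    simp only [add_mul, Finset.sum_add_distrib]
    have h2 : ∑ k, Q a b k * partialD k u (T z) =
      ∑ k, partialD a (partialD b fun w => T w k) z * partialD k u (T z) := rfl
    rw [h2, add_sub_add_right_eq_sub]
    simp only [Matrix.mul_apply, Matrix.transpose_apply, Finset.sum_mul, mul_sub, sub_mul,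
      Finset.sum_sub_distrib, coordHessian, Finset.mul_sum]
    congr 1
    · refine Finset.sum_congr rfl fun i _ => Finset.sum_congr rfl fun j _ => ?_
      simp only [hJdef, jacobian]
      ring
    · refine (Finset.sum_congr rfl fun k _ => Finset.sum_comm).trans (Finset.sum_comm.trans ?_)
      refine Finset.sum_congr rfl fun j _ => Finset.sum_comm.trans ?_
      refine Finset.sum_congr rfl fun i _ => Finset.sum_congr rfl fun k _ => ?_
      ring
  have htr : ∀ A B : Matrix (Fin n) (Fin n) ℝ, ∑ i, ∑ j, A i j * B i j =
      (A * B.transpose).trace := fun A B => by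
    simp [Matrix.trace, Matrix.mul_apply]
  rw [coordLaplacian, coordLaplacian, htr, htr, hH, hG'z, Matrix.mul_inv_rev, Matrix.mul_inv_rev,
    Matrix.transpose_mul, Matrix.transpose_mul, Matrix.transpose_transpose]
  have hJt : IsUnit J.transpose.det := by rwa [Matrix.det_transpose]
  have : J⁻¹ * ((G (T z))⁻¹ * J.transpose⁻¹) * (J.transpose *
      ((coordHessian G u (T z)).transpose * J)) =
      J⁻¹ * ((G (T z))⁻¹ * (coordHessian G u (T z)).transpose * J) := by
    simp only [Matrix.mul_assoc]
    rw [← Matrix.mul_assoc J.transpose⁻¹, Matrix.nonsing_inv_mul _ hJt, Matrix.one_mul]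
  rw [this, Matrix.trace_mul_comm, Matrix.mul_assoc, Matrix.mul_nonsing_inv _ hJ, Matrix.mul_one]

end ChangeOfCoordinates

end FHarmonic
end

open scoped Manifold ContDiff

noncomputable section

namespace FHarmonic

open Filter Topology Bundle

/-! ### The metric in charts -/

section MetricInCharts

variable {n : ℕ} {M : Type*} [TopologicalSpace M]
  [ChartedSpace (EuclideanSpace ℝ (Fin n)) M] [IsManifold (𝓡 n) ∞ M]

omit [IsManifold (𝓡 n) ∞ M] in
lemma isOpen_extChartAt_target' (p : M) : IsOpen (extChartAt (𝓡 n) p).target :=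
  isOpen_extChartAt_target p

/-- The coordinate field is the tangent map of the smooth inverse chart along a constant section. -/
lemma contMDiffOn_coordVec (p : M) (i : Fin n) :
    ContMDiffOn (𝓡 n) ((𝓡 n).prod (𝓡 n)) ∞
      (fun w => (⟨(extChartAt (𝓡 n) p).symm w, coordVec p w i⟩ : TangentBundle (𝓡 n) M))
      (extChartAt (𝓡 n) p).target := by
  have ho := isOpen_extChartAt_target' (n := n) p
  have h1 : ContMDiffOn (𝓡 n) (𝓡 n) ∞ (extChartAt (𝓡 n) p).symm (extChartAt (𝓡 n) p).target :=
    contMDiffOn_extChartAt_symm p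
  have h2 := h1.contMDiffOn_tangentMapWithin (m := ∞) (by simp) ho.uniqueMDiffOn
  have h3 : ContMDiff (𝓡 n) ((𝓡 n).prod (𝓡 n)) ∞ (fun w : EuclideanSpace ℝ (Fin n) =>
      (⟨w, stdVec i⟩ : TangentBundle (𝓡 n) (EuclideanSpace ℝ (Fin n)))) := by
    exact contMDiff_vectorSpace_iff_contDiff.2 contDiff_const
  refine (h2.comp h3.contMDiffOn fun w hw => hw).congr fun w hw => ?_
  simp only [Function.comp, tangentMapWithin, coordVec]
  rw [mfderivWithin_of_isOpen ho hw]

lemma contDiffOn_gram (g : Metric n M) (p : M) (i j : Fin n) :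
    ContDiffOn ℝ ∞ (fun w => gram g p w i j) (extChartAt (𝓡 n) p).target := by
  rw [← contMDiffOn_iff_contDiffOn]
  intro w hw
  have hκ : ContMDiffWithinAt (𝓡 n) (𝓡 n) ∞ (extChartAt (𝓡 n) p).symm
      (extChartAt (𝓡 n) p).target w := contMDiffOn_extChartAt_symm p w hw
  have : ContMDiffWithinAt (𝓡 n) ((𝓡 n).prod 𝓘(ℝ)) ∞
      (fun w ↦ TotalSpace.mk' ℝ (E := Bundle.Trivial M ℝ) ((extChartAt (𝓡 n) p).symm w)
        (g.inner ((extChartAt (𝓡 n) p).symm w) (coordVec p w i) (coordVec p w j)))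
      (extChartAt (𝓡 n) p).target w := by
    apply ContMDiffWithinAt.clm_bundle_apply₂ (F₁ := EuclideanSpace ℝ (Fin n))
      (F₂ := EuclideanSpace ℝ (Fin n))
    · exact ContMDiffAt.comp_contMDiffWithinAt w g.contMDiff.contMDiffAt hκ
    · exact contMDiffOn_coordVec p i w hw
    · exact contMDiffOn_coordVec p j w hw
  simp only [contMDiffWithinAt_totalSpace] at this
  exact this.2

/-- The metric at a point as a bilinear form on the model space. -/
def metricForm (g : Metric n M) (x : M) :
    EuclideanSpace ℝ (Fin n) →L[ℝ] EuclideanSpace ℝ (Fin n) →L[ℝ] ℝ := g.inner x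

/-- The derivative of the inverse of a chart, as a map of the model space. -/
def chartDeriv (p : M) (w : EuclideanSpace ℝ (Fin n)) :
    EuclideanSpace ℝ (Fin n) →L[ℝ] EuclideanSpace ℝ (Fin n) :=
  mfderiv (𝓡 n) (𝓡 n) (extChartAt (𝓡 n) p).symm w

lemma gram_apply (g : Metric n M) (p : M) (w : EuclideanSpace ℝ (Fin n)) (i j : Fin n) :
    gram g p w i j = metricForm g ((extChartAt (𝓡 n) p).symm w) (chartDeriv p w (stdVec i))
      (chartDeriv p w (stdVec j)) := rfl

lemma mdifferentiableAt_extChartAt_symm' (p : M) {w : EuclideanSpace ℝ (Fin n)}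
    (hw : w ∈ (extChartAt (𝓡 n) p).target) :
    MDifferentiableAt (𝓡 n) (𝓡 n) (extChartAt (𝓡 n) p).symm w := by
  have := mdifferentiableWithinAt_extChartAt_symm (I := 𝓡 n) hw
  rwa [ModelWithCorners.range_eq_univ, mdifferentiableWithinAt_univ] at this

lemma chartDeriv_injective (p : M) {w : EuclideanSpace ℝ (Fin n)}
    (hw : w ∈ (extChartAt (𝓡 n) p).target) : Function.Injective (chartDeriv p w) := by
  have := isInvertible_mfderivWithin_extChartAt_symm (I := 𝓡 n) hw
  rw [ModelWithCorners.range_eq_univ, mfderivWithin_univ] at this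
  exact this.injective

lemma chartDeriv_self (x : M) :
    chartDeriv x (extChartAt (𝓡 n) x x) = ContinuousLinearMap.id ℝ _ := by
  have := mfderivWithin_range_extChartAt_symm (I := 𝓡 n) (x := x)
  rw [ModelWithCorners.range_eq_univ, mfderivWithin_univ] at this
  exact this

lemma metricForm_chartDeriv (g : Metric n M) (p : M) (w : EuclideanSpace ℝ (Fin n))
    (u v : EuclideanSpace ℝ (Fin n)) :
    metricForm g ((extChartAt (𝓡 n) p).symm w) (chartDeriv p w u) (chartDeriv p w v) =
      ∑ i, ∑ j, gram g p w i j * (u i * v j) := by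
  have key : ∀ u : EuclideanSpace ℝ (Fin n),
      chartDeriv p w u = ∑ i, u i • chartDeriv p w (stdVec i) := fun u => by
    conv_lhs => rw [← (EuclideanSpace.basisFun (Fin n) ℝ).sum_repr u]
    rw [map_sum]
    refine Finset.sum_congr rfl fun i _ => ?_
    rw [map_smul]
    simp
  rw [key, key]
  simp only [map_sum, map_smul, sum_apply, smul_apply, smul_eq_mul, gram_apply, Finset.mul_sum]
  rw [Finset.sum_comm]
  refine Finset.sum_congr rfl fun i _ => Finset.sum_congr rfl fun j _ => ?_
  ring

lemma gram_comm (g : Metric n M) (p : M) (w : EuclideanSpace ℝ (Fin n)) (i j : Fin n) :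
    gram g p w i j = gram g p w j i := g.symm _ _ _

/-- The derivative of the inverse chart is injective, so positivity of the metric pulls back. -/
lemma posDef_gram (g : Metric n M) (p : M) {w : EuclideanSpace ℝ (Fin n)}
    (hw : w ∈ (extChartAt (𝓡 n) p).target) : (gram g p w).PosDef := by
  refine Matrix.PosDef.of_dotProduct_mulVec_pos ?_ fun x hx => ?_
  · ext i j
    simp [gram_comm g p w i j]
  · let v : EuclideanSpace ℝ (Fin n) := WithLp.toLp 2 x
    have hv : v ≠ 0 := fun h => hx (by simpa [v] using congrArg WithLp.ofLp h)
    have h1 : 0 < metricForm g ((extChartAt (𝓡 n) p).symm w) (chartDeriv p w v)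
        (chartDeriv p w v) :=
      g.pos _ (chartDeriv p w v)
        (fun h => hv (chartDeriv_injective p hw (h.trans (map_zero (chartDeriv p w)).symm)))
    rw [metricForm_chartDeriv] at h1
    refine h1.trans_eq ?_
    simp only [dotProduct, Matrix.mulVec, Finset.mul_sum, v, star_trivial]
    refine Finset.sum_congr rfl fun i _ => Finset.sum_congr rfl fun j _ => ?_
    ring

lemma isUnit_det_gram (g : Metric n M) (p : M) {w : EuclideanSpace ℝ (Fin n)}
    (hw : w ∈ (extChartAt (𝓡 n) p).target) : IsUnit (gram g p w).det :=
  (posDef_gram g p hw).det_pos.ne'.isUnit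

/-- The change of coordinates from the preferred chart around `x` to the one around `p`. -/
def transition (p x : M) (w : EuclideanSpace ℝ (Fin n)) : EuclideanSpace ℝ (Fin n) :=
  extChartAt (𝓡 n) p ((extChartAt (𝓡 n) x).symm w)

lemma contDiffAt_transition {p x : M} {w : EuclideanSpace ℝ (Fin n)}
    (hw : w ∈ (extChartAt (𝓡 n) x).target)
    (hp : (extChartAt (𝓡 n) x).symm w ∈ (extChartAt (𝓡 n) p).source) :
    ContDiffAt ℝ ∞ (transition p x) w := by
  rw [← contMDiffAt_iff_contDiffAt]
  have h1 : ContMDiffAt (𝓡 n) (𝓡 n) ∞ (extChartAt (𝓡 n) x).symm w :=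
    (contMDiffOn_extChartAt_symm x).contMDiffAt
      ((isOpen_extChartAt_target' (n := n) x).mem_nhds hw)
  have h2 : ContMDiffAt (𝓡 n) (𝓡 n) ∞ (extChartAt (𝓡 n) p) ((extChartAt (𝓡 n) x).symm w) :=
    contMDiffAt_extChartAt' (by rwa [extChartAt_source] at hp)
  exact h2.comp w h1

/-- Near `w` the inverse chart at `x` is the inverse chart at `p` after the transition map; this is
the chain rule. -/
lemma chartDeriv_eq {p x : M} {w : EuclideanSpace ℝ (Fin n)}
    (hw : w ∈ (extChartAt (𝓡 n) x).target)
    (hp : (extChartAt (𝓡 n) x).symm w ∈ (extChartAt (𝓡 n) p).source)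
    (v : EuclideanSpace ℝ (Fin n)) :
    chartDeriv x w v = chartDeriv p (transition p x w) (fderiv ℝ (transition p x) w v) := by
  have ho := (isOpen_extChartAt_target' (n := n) x).mem_nhds hw
  have h1 : (extChartAt (𝓡 n) x).symm =ᶠ[𝓝 w] (extChartAt (𝓡 n) p).symm ∘ transition p x := by
    have hc : ContinuousAt (extChartAt (𝓡 n) x).symm w := continuousAt_extChartAt_symm'' hw
    filter_upwards [hc.preimage_mem_nhds ((isOpen_extChartAt_source p).mem_nhds hp)] with y hy
    exact ((extChartAt (𝓡 n) p).left_inv hy).symm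
  have h2 : HasMFDerivAt (𝓡 n) (𝓡 n) (transition p x) w (fderiv ℝ (transition p x) w) :=
    ((contDiffAt_transition hw hp).differentiableAt (by simp)).hasFDerivAt.hasMFDerivAt
  have h3 := (mdifferentiableAt_extChartAt_symm' p
    (w := transition p x w) ((extChartAt (𝓡 n) p).map_source hp)).hasMFDerivAt
  have h4 := ((h3.comp w h2).congr_of_eventuallyEq h1).mfderiv
  rw [chartDeriv, h4]
  rfl

lemma gram_transition (g : Metric n M) {p x : M} {w : EuclideanSpace ℝ (Fin n)}
    (hw : w ∈ (extChartAt (𝓡 n) x).target)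
    (hp : (extChartAt (𝓡 n) x).symm w ∈ (extChartAt (𝓡 n) p).source) :
    gram g x w = (jacobian (transition p x) w).transpose * gram g p (transition p x w) *
      jacobian (transition p x) w := by
  have hd := (contDiffAt_transition hw hp).differentiableAt (by simp)
  have hpt : (extChartAt (𝓡 n) x).symm w = (extChartAt (𝓡 n) p).symm (transition p x w) :=
    ((extChartAt (𝓡 n) p).left_inv hp).symm
  ext a b
  have h1 : gram g x w a b = ∑ i, ∑ j, gram g p (transition p x w) i j *
      (fderiv ℝ (transition p x) w (stdVec a) i * fderiv ℝ (transition p x) w (stdVec b) j) := by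
    rw [← metricForm_chartDeriv, ← chartDeriv_eq hw hp, ← chartDeriv_eq hw hp, ← hpt, gram_apply]
  rw [h1]
  simp only [Matrix.mul_apply, Matrix.transpose_apply, Finset.sum_mul, jacobian,
    partialD_apply hd]
  rw [Finset.sum_comm]
  refine Finset.sum_congr rfl fun i _ => Finset.sum_congr rfl fun j _ => ?_
  ring

lemma isUnit_det_jacobian_transition {p x : M} {w : EuclideanSpace ℝ (Fin n)}
    (hw : w ∈ (extChartAt (𝓡 n) x).target)
    (hp : (extChartAt (𝓡 n) x).symm w ∈ (extChartAt (𝓡 n) p).source) :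
    IsUnit (jacobian (transition p x) w).det := by
  have hd := (contDiffAt_transition hw hp).differentiableAt (by simp)
  rw [isUnit_iff_ne_zero, Ne, ← Matrix.exists_mulVec_eq_zero_iff]
  rintro ⟨v, hv, h0⟩
  have h1 : fderiv ℝ (transition p x) w (WithLp.toLp 2 v) = 0 := by
    ext i
    have := congrFun h0 i
    rw [fderiv_apply_eq_sum]
    simp only [Matrix.mulVec, dotProduct, jacobian, partialD_apply hd] at this
    simp only [PiLp.zero_apply, Pi.zero_apply] at this ⊢
    rw [← this]
    simp [partialD, mul_comm]
  have h2 := chartDeriv_eq hw hp (WithLp.toLp 2 v)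
  rw [h1, map_zero] at h2
  refine hv ?_
  have := chartDeriv_injective x hw (h2.trans (map_zero _).symm)
  simpa using congrArg WithLp.ofLp this

/-- The Laplace–Beltrami operator may be computed in any of the preferred charts. -/
lemma laplacian_eq_coordLaplacian (g : Metric n M) {u : M → ℝ} {p x : M}
    (hx : x ∈ (extChartAt (𝓡 n) p).source)
    (hu : ContDiffAt ℝ 2 (fun w => u ((extChartAt (𝓡 n) p).symm w)) (extChartAt (𝓡 n) p x)) :
    laplacian g u x = coordLaplacian (gram g p) (fun w => u ((extChartAt (𝓡 n) p).symm w))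
      (extChartAt (𝓡 n) p x) := by
  set z := extChartAt (𝓡 n) x x with hz
  have hzt : z ∈ (extChartAt (𝓡 n) x).target := mem_extChartAt_target x
  have hzx : (extChartAt (𝓡 n) x).symm z = x := extChartAt_to_inv x
  have hTz : transition p x z = extChartAt (𝓡 n) p x := by rw [transition, hzx]
  have hzp : (extChartAt (𝓡 n) x).symm z ∈ (extChartAt (𝓡 n) p).source := by rwa [hzx]
  have hev : ∀ᶠ w in 𝓝 z, w ∈ (extChartAt (𝓡 n) x).target ∧
      (extChartAt (𝓡 n) x).symm w ∈ (extChartAt (𝓡 n) p).source := by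
    have hc : ContinuousAt (extChartAt (𝓡 n) x).symm z := continuousAt_extChartAt_symm'' hzt
    exact inter_mem ((isOpen_extChartAt_target' (n := n) x).mem_nhds hzt)
      (hc.preimage_mem_nhds ((isOpen_extChartAt_source p).mem_nhds hzp))
  have hTt : transition p x z ∈ (extChartAt (𝓡 n) p).target := by
    rw [hTz]; exact (extChartAt (𝓡 n) p).map_source hx
  have hL : laplacian g u x =
      coordLaplacian (gram g x) (fun w => u ((extChartAt (𝓡 n) x).symm w)) z := rfl
  have hcomp : (fun w => u ((extChartAt (𝓡 n) x).symm w)) =ᶠ[𝓝 z]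
      fun w => u ((extChartAt (𝓡 n) p).symm (transition p x w)) := by
    filter_upwards [hev] with w hw
    rw [transition, (extChartAt (𝓡 n) p).left_inv hw.2]
  have hL2 : coordLaplacian (gram g x) (fun w => u ((extChartAt (𝓡 n) x).symm w)) z =
      coordLaplacian (gram g x) (fun w => u ((extChartAt (𝓡 n) p).symm (transition p x w))) z := by
    simp only [coordLaplacian, coordHessian]
    refine Finset.sum_congr rfl fun i _ => Finset.sum_congr rfl fun j _ => ?_
    rw [partialD_congr (partialD_eventuallyEq hcomp j)]
    congr 2
    refine Finset.sum_congr rfl fun k _ => ?_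
    rw [partialD_congr hcomp]
  rw [hL, hL2, ← hTz]
  refine coordLaplacian_comp (u := fun w => u ((extChartAt (𝓡 n) p).symm w))
    ((contDiffAt_transition hzt hzp).of_le two_le_infty) (by rwa [hTz])
    (fun i j => ?_) (fun i j => gram_comm g p _ i j) (isUnit_det_gram g p hTt)
    (isUnit_det_jacobian_transition hzt hzp) ?_
  · exact ((contDiffOn_gram g p i j).contDiffAt
      ((isOpen_extChartAt_target' (n := n) p).mem_nhds hTt)).differentiableAt (by simp)
  · filter_upwards [hev] with w hw
    exact gram_transition g hw.1 hw.2

end MetricInCharts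

end FHarmonic
end

open scoped Manifold ContDiff

noncomputable section

namespace FHarmonic

open Filter Topology Bundle

/-! ### Local harmonic functions with prescribed jets -/

section Jets

variable {n : ℕ}

lemma partialD_coord_sub (y z : EuclideanSpace ℝ (Fin n)) (k i : Fin n) :
    partialD k (fun z => z i - y i) z = if i = k then 1 else 0 := by
  have h : HasFDerivAt (fun z : EuclideanSpace ℝ (Fin n) => z i - y i)
      (EuclideanSpace.proj i : EuclideanSpace ℝ (Fin n) →L[ℝ] ℝ) z :=
    (EuclideanSpace.proj i : EuclideanSpace ℝ (Fin n) →L[ℝ] ℝ).hasFDerivAt.sub_const _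
  rw [partialD, h.fderiv]
  simp

/-- The polynomial with Taylor coefficients ξ and C/2; symmetry of `C` merges the two halves upon
differentiation. -/
lemma exists_quadratic (y : EuclideanSpace ℝ (Fin n)) (ξ : Fin n → ℝ)
    {C : Matrix (Fin n) (Fin n) ℝ} (hC : ∀ i j, C i j = C j i) :
    ∃ p : EuclideanSpace ℝ (Fin n) → ℝ, ContDiff ℝ ∞ p ∧ (∀ i, partialD i p y = ξ i) ∧
      ∀ i j, partialD i (partialD j p) y = C i j := by
  have hd : ∀ (i : Fin n) (z : EuclideanSpace ℝ (Fin n)),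
      DifferentiableAt ℝ (fun z : EuclideanSpace ℝ (Fin n) => z i - y i) z := fun i z => by fun_prop
  have hD : ∀ j, partialD j (fun z : EuclideanSpace ℝ (Fin n) =>
      ∑ i, (ξ i + ∑ k, (1 / 2 * C i k) * (z k - y k)) * (z i - y i)) =
      fun z => ξ j + ∑ k, C j k * (z k - y k) := fun j => by
    ext z
    have h2 : ∀ i, DifferentiableAt ℝ (fun z : EuclideanSpace ℝ (Fin n) =>
        ξ i + ∑ k, (1 / 2 * C i k) * (z k - y k)) z := fun i => by fun_prop
    have h3 : ∀ i, partialD j (fun z : EuclideanSpace ℝ (Fin n) =>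
        ξ i + ∑ k, (1 / 2 * C i k) * (z k - y k)) z = 1 / 2 * C i j := fun i => by
      rw [partialD_add (by fun_prop) (by fun_prop), partialD_sum fun k _ => by fun_prop]
      have h0 : partialD j (fun _ : EuclideanSpace ℝ (Fin n) => ξ i) z = 0 := by simp [partialD]
      rw [h0, zero_add, Finset.sum_eq_single j]
      · rw [partialD_mul (by fun_prop) (hd j z), partialD_coord_sub]
        simp [partialD]
      · intro k _ hk
        rw [partialD_mul (by fun_prop) (hd k z), partialD_coord_sub]
        simp [partialD, hk]
      · simp
    rw [partialD_sum fun i _ => (h2 i).fun_mul (hd i z)]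
    simp only [fun i => partialD_mul (h2 i) (hd i z) j, h3, partialD_coord_sub, mul_ite, mul_one,
      mul_zero, Finset.sum_add_distrib, Finset.sum_ite_eq', Finset.mem_univ, if_true]
    rw [add_left_comm, ← Finset.sum_add_distrib]
    congr 1
    refine Finset.sum_congr rfl fun k _ => ?_
    rw [hC k j]
    ring
  refine ⟨fun z => ∑ i, (ξ i + ∑ k, (1 / 2 * C i k) * (z k - y k)) * (z i - y i), by fun_prop,
    fun i => ?_, fun i j => ?_⟩
  · rw [hD]; simp
  · rw [hD, partialD_add (by fun_prop) (by fun_prop), partialD_sum fun k _ => by fun_prop]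
    have h0 : partialD i (fun _ : EuclideanSpace ℝ (Fin n) => ξ j) y = 0 := by simp [partialD]
    rw [h0, zero_add, Finset.sum_eq_single i]
    · rw [partialD_mul (by fun_prop) (hd i y), partialD_coord_sub, hC j i]
      simp [partialD]
    · intro k _ hk
      rw [partialD_mul (by fun_prop) (hd k y), partialD_coord_sub]
      simp [partialD, hk]
    · simp

lemma contDiffOn_det {S : Set (EuclideanSpace ℝ (Fin n))}
    {A : EuclideanSpace ℝ (Fin n) → Matrix (Fin n) (Fin n) ℝ}
    (hA : ∀ i j, ContDiffOn ℝ ∞ (fun w => A w i j) S) :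
    ContDiffOn ℝ ∞ (fun w => (A w).det) S := by
  simp only [Matrix.det_apply']
  exact ContDiffOn.sum fun σ _ => contDiffOn_const.mul (contDiffOn_prod fun i _ => hA _ _)

/-- By Cramer's rule the entries are quotients of determinants. -/
lemma contDiffOn_matrix_inv {S : Set (EuclideanSpace ℝ (Fin n))}
    {A : EuclideanSpace ℝ (Fin n) → Matrix (Fin n) (Fin n) ℝ}
    (hA : ∀ i j, ContDiffOn ℝ ∞ (fun w => A w i j) S) (hdet : ∀ w ∈ S, IsUnit (A w).det)
    (i j : Fin n) : ContDiffOn ℝ ∞ (fun w => (A w)⁻¹ i j) S := by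
  simp only [Matrix.inv_def, Ring.inverse_eq_inv', Matrix.smul_apply, smul_eq_mul,
    Matrix.adjugate_apply]
  refine ((contDiffOn_det hA).inv fun w hw => (hdet w hw).ne_zero).mul (contDiffOn_det fun k l => ?_)
  by_cases hk : k = j
  · subst hk
    simp only [Matrix.updateRow_self]
    exact contDiffOn_const
  · simp only [Matrix.updateRow_ne hk]
    exact hA k l

lemma contDiffOn_partialD {S : Set (EuclideanSpace ℝ (Fin n))} (hS : IsOpen S)
    {u : EuclideanSpace ℝ (Fin n) → ℝ} (hu : ContDiffOn ℝ ∞ u S) (i : Fin n) :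
    ContDiffOn ℝ ∞ (partialD i u) S := fun w hw =>
  (contDiffAt_partialD (hu.contDiffAt (hS.mem_nhds hw)) (by simp) i).contDiffWithinAt

lemma contDiffOn_coordChristoffel {S : Set (EuclideanSpace ℝ (Fin n))} (hS : IsOpen S)
    {G : EuclideanSpace ℝ (Fin n) → Matrix (Fin n) (Fin n) ℝ}
    (hG : ∀ i j, ContDiffOn ℝ ∞ (fun w => G w i j) S) (hdet : ∀ w ∈ S, IsUnit (G w).det)
    (k i j : Fin n) : ContDiffOn ℝ ∞ (fun w => coordChristoffel G w k i j) S := by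
  refine contDiffOn_const.mul (ContDiffOn.sum fun s _ =>
    (contDiffOn_matrix_inv hG hdet k s).mul ?_)
  exact ((contDiffOn_partialD hS (hG j s) i).add (contDiffOn_partialD hS (hG i s) j)).sub
    (contDiffOn_partialD hS (hG i j) s)

/-- Separating second- from first-order terms puts the operator into the form treated by
`exists_solution_near_jet`. -/
lemma coordLaplacian_eq (G : EuclideanSpace ℝ (Fin n) → Matrix (Fin n) (Fin n) ℝ)
    (u : EuclideanSpace ℝ (Fin n) → ℝ) (z : EuclideanSpace ℝ (Fin n)) :
    coordLaplacian G u z = ∑ i, ∑ j, (G z)⁻¹ i j * partialD i (partialD j u) z +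
      ∑ k, (-∑ i, ∑ j, (G z)⁻¹ i j * coordChristoffel G z k i j) * partialD k u z := by
  simp only [coordLaplacian, coordHessian, mul_sub, Finset.sum_sub_distrib, neg_mul,
    Finset.sum_neg_distrib, ← sub_eq_add_neg]
  congr 1
  simp only [Finset.mul_sum, Finset.sum_mul]
  symm
  rw [Finset.sum_comm]
  refine Finset.sum_congr rfl fun i _ => ?_
  rw [Finset.sum_comm]
  refine Finset.sum_congr rfl fun j _ => Finset.sum_congr rfl fun k _ => ?_
  ring

lemma coordHessian_congr {G : EuclideanSpace ℝ (Fin n) → Matrix (Fin n) (Fin n) ℝ}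
    {u v : EuclideanSpace ℝ (Fin n) → ℝ} {z : EuclideanSpace ℝ (Fin n)} (h : u =ᶠ[𝓝 z] v) :
    coordHessian G u z = coordHessian G v z := by
  ext i j
  simp only [coordHessian, partialD_congr (partialD_eventuallyEq h j), partialD_congr h]

lemma coordLaplacian_congr {G : EuclideanSpace ℝ (Fin n) → Matrix (Fin n) (Fin n) ℝ}
    {u v : EuclideanSpace ℝ (Fin n) → ℝ} {z : EuclideanSpace ℝ (Fin n)} (h : u =ᶠ[𝓝 z] v) :
    coordLaplacian G u z = coordLaplacian G v z := by
  simp only [coordLaplacian, coordHessian_congr h]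

variable {N : Type*} [TopologicalSpace N] [ChartedSpace (EuclideanSpace ℝ (Fin n)) N]
  [IsManifold (𝓡 n) ∞ N]

/-- Every 2-jet satisfying the Laplace equation is approximated by jets of harmonic functions. -/
theorem exists_harmonic_near_jet (h : Metric n N) (q : N) (ξ : Fin n → ℝ)
    {C : Matrix (Fin n) (Fin n) ℝ} (hC : ∀ i j, C i j = C j i)
    (hξC : ∑ i, ∑ j, (gram h q (extChartAt (𝓡 n) q q))⁻¹ i j *
      (C i j - ∑ k, coordChristoffel (gram h q) (extChartAt (𝓡 n) q q) k i j * ξ k) = 0)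
    {ε : ℝ} (hε : 0 < ε) :
    ∃ (V : Set N) (u : N → ℝ) (U : EuclideanSpace ℝ (Fin n) → ℝ), IsOpen V ∧ q ∈ V ∧
      V ⊆ (extChartAt (𝓡 n) q).source ∧ IsHarmonicOn h u V ∧ ContDiff ℝ 2 U ∧
      (u = fun x => U (extChartAt (𝓡 n) q x)) ∧
      (∀ i, |partialD i U (extChartAt (𝓡 n) q q) - ξ i| ≤ ε) ∧
      ∀ i j, |partialD i (partialD j U) (extChartAt (𝓡 n) q q) - C i j| ≤ ε := by
  set y := extChartAt (𝓡 n) q q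
  set S := (extChartAt (𝓡 n) q).target
  have hS : IsOpen S := isOpen_extChartAt_target' q
  have hyS : y ∈ S := mem_extChartAt_target q
  have hdet : ∀ w ∈ S, IsUnit (gram h q w).det := fun w hw => isUnit_det_gram h q hw
  have hG := contDiffOn_gram h q
  obtain ⟨p, hp, hp1, hp2⟩ := exists_quadratic y ξ hC
  obtain ⟨U, hU, hUeq, hU1, hU2⟩ := exists_solution_near_jet (z₀ := y) (hS.mem_nhds hyS)
    (a := fun i j w => (gram h q w)⁻¹ i j)
    (b := fun k w => -∑ i, ∑ j, (gram h q w)⁻¹ i j * coordChristoffel (gram h q) w k i j)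
    (contDiffOn_matrix_inv hG hdet)
    (fun k => (ContDiffOn.sum fun i _ => ContDiffOn.sum fun j _ =>
      (contDiffOn_matrix_inv hG hdet i j).mul (contDiffOn_coordChristoffel hS hG hdet k i j)).neg)
    hp (fun v hv => by
      have := (posDef_gram h q hyS).inv.dotProduct_mulVec_pos (x := v)
        (fun h0 => hv (by ext i; exact congrFun h0 i))
      refine this.trans_eq ?_
      simp only [dotProduct, Matrix.mulVec, Finset.mul_sum, star_trivial]
      refine Finset.sum_congr rfl fun i _ => Finset.sum_congr rfl fun j _ => ?_
      ring) (by
      rw [← coordLaplacian_eq]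
      simp only [coordLaplacian, coordHessian, hp1, hp2]
      exact hξC) hε
  simp only [hp1, hp2] at hU1 hU2
  -- The equation holds on a whole neighbourhood of the centre, which is what harmonicity on an open
  -- set requires.
  obtain ⟨O, hOS, hO, hyO⟩ := mem_nhds_iff.1 (inter_mem (hS.mem_nhds hyS) hUeq)
  have hsrc := isOpen_extChartAt_source (I := 𝓡 n) q
  refine ⟨(extChartAt (𝓡 n) q).source ∩ extChartAt (𝓡 n) q ⁻¹' O, _, U,
    (continuousOn_extChartAt q).isOpen_inter_preimage hsrc hO, ⟨mem_extChartAt_source q, hyO⟩,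
    Set.inter_subset_left, ⟨?_, fun x hx => ?_⟩, hU, rfl, hU1, hU2⟩
  · have h1 : ContMDiffOn (𝓡 n) (𝓡 n) 2 (extChartAt (𝓡 n) q) (extChartAt (𝓡 n) q).source := by
      rw [extChartAt_source]
      exact (contMDiffOn_extChartAt (n := ∞)).of_le two_le_infty
    exact hU.contMDiff.comp_contMDiffOn (h1.mono Set.inter_subset_left)
  · have hxt : extChartAt (𝓡 n) q x ∈ S := (extChartAt (𝓡 n) q).map_source hx.1
    have hev : (fun w => U (extChartAt (𝓡 n) q ((extChartAt (𝓡 n) q).symm w)))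
        =ᶠ[𝓝 (extChartAt (𝓡 n) q x)] U := by
      filter_upwards [hS.mem_nhds hxt] with w hw
      rw [(extChartAt (𝓡 n) q).right_inv hw]
    -- `laplacian` at a point uses that point's own chart, whereas the equation was solved in the
    -- chart at `q`; invariance bridges the two.
    rw [laplacian_eq_coordLaplacian h hx.1 (hU.contDiffAt.congr_of_eventuallyEq hev),
      coordLaplacian_congr hev, coordLaplacian_eq]
    exact (hOS hx.2).2

end Jets

end FHarmonic
end

open scoped Manifold ContDiff

noncomputable section

namespace FHarmonic

open Filter Topology Bundle

/-! ### Regularity of `f`-harmonic morphisms -/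

section Regularity

variable {m n : ℕ} {M N : Type*}
  [TopologicalSpace M] [ChartedSpace (EuclideanSpace ℝ (Fin m)) M] [IsManifold (𝓡 m) ∞ M]
  [TopologicalSpace N] [ChartedSpace (EuclideanSpace ℝ (Fin n)) N] [IsManifold (𝓡 n) ∞ N]

lemma exists_hasFDerivAt_equiv {T : EuclideanSpace ℝ (Fin n) → EuclideanSpace ℝ (Fin n)}
    {z : EuclideanSpace ℝ (Fin n)} (hT : DifferentiableAt ℝ T z) (hJ : (jacobian T z).det ≠ 0) :
    ∃ e : EuclideanSpace ℝ (Fin n) ≃L[ℝ] EuclideanSpace ℝ (Fin n),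
      HasFDerivAt T (e : EuclideanSpace ℝ (Fin n) →L[ℝ] EuclideanSpace ℝ (Fin n)) z := by
  have hinj : Function.Injective (fderiv ℝ T z).toLinearMap := by
    rw [← LinearMap.ker_eq_bot, LinearMap.ker_eq_bot']
    intro v hv
    by_contra hv0
    refine hJ (Matrix.exists_mulVec_eq_zero_iff.1 ⟨v, fun h => hv0 (by ext i; exact congrFun h i), ?_⟩)
    ext i
    have h1 : fderiv ℝ T z v i = 0 := by
      have : fderiv ℝ T z v = 0 := hv
      rw [this]; rfl
    rw [fderiv_apply_eq_sum] at h1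
    simp only [Matrix.mulVec, dotProduct, jacobian, partialD_apply hT, Pi.zero_apply]
    rw [← h1]
    simp [partialD, mul_comm]
  refine ⟨(LinearEquiv.ofInjectiveEndo _ hinj).toContinuousLinearEquiv, ?_⟩
  convert! hT.hasFDerivAt using 1

lemma coordChristoffel_comm {G : EuclideanSpace ℝ (Fin n) → Matrix (Fin n) (Fin n) ℝ}
    (hG : ∀ w i j, G w i j = G w j i) (z : EuclideanSpace ℝ (Fin n)) (k i j : Fin n) :
    coordChristoffel G z k i j = coordChristoffel G z k j i := by
  simp only [coordChristoffel]
  congr 1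
  refine Finset.sum_congr rfl fun s _ => ?_
  simp only [fun w => hG w i j]
  ring

/-- Around every point there are coordinates consisting of harmonic functions. -/
lemma exists_harmonic_coordinates (h : Metric n N) (q : N) :
    ∃ (V : Fin n → Set N) (u : Fin n → N → ℝ)
      (T : EuclideanSpace ℝ (Fin n) → EuclideanSpace ℝ (Fin n)),
      (∀ i, IsOpen (V i) ∧ q ∈ V i ∧ IsHarmonicOn h (u i) (V i)) ∧ ContDiff ℝ 2 T ∧
      (∀ i x, u i x = T (extChartAt (𝓡 n) q x) i) ∧
      (jacobian T (extChartAt (𝓡 n) q q)).det ≠ 0 := by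
  set y := extChartAt (𝓡 n) q q with hy
  -- Chosen so that `n * ε + ε = 1/2`: the Jacobian, within ε of the identity entrywise, is then
  -- strictly diagonally dominant.
  have hε : (0 : ℝ) < 1 / (2 * (n + 1)) := by positivity
  -- The prescribed second derivatives make the covariant Hessian zero, so the trace condition is
  -- automatic.
  choose V u U hV hqV _ hu hU huU hU1 _ using fun i : Fin n =>
    exists_harmonic_near_jet h q (Pi.single i 1)
      (C := fun a b => ∑ k, coordChristoffel (gram h q) y k a b * (Pi.single i 1 : Fin n → ℝ) k)
      (fun a b => Finset.sum_congr rfl fun k _ => by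
        rw [coordChristoffel_comm (fun w => gram_comm h q w)])
      (by simp only [← hy, sub_self, mul_zero, Finset.sum_const_zero]) hε
  refine ⟨V, u, fun w => WithLp.toLp 2 fun i => U i w, fun i => ⟨hV i, hqV i, hu i⟩, ?_,
    fun i x => by rw [huU i], ?_⟩
  · exact contDiff_piLp' 2 fun i => hU i
  · refine det_ne_zero_of_sum_row_lt_diag fun i => ?_
    have hJ : ∀ a, jacobian (fun w => WithLp.toLp 2 fun i => U i w) y i a = partialD a (U i) y :=
      fun a => rfl
    simp only [hJ, Real.norm_eq_abs]
    have h1 : ∑ j ∈ Finset.univ.erase i, |partialD j (U i) y| ≤ n * (1 / (2 * (n + 1))) := by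
      refine (Finset.sum_le_card_nsmul _ _ (1 / (2 * (n + 1) : ℝ)) fun j hj => ?_).trans ?_
      · have := hU1 i j
        rwa [Pi.single_eq_of_ne (Finset.ne_of_mem_erase hj), sub_zero] at this
      · rw [nsmul_eq_mul]
        have hc : ((Finset.univ.erase i).card : ℝ) ≤ n := by
          exact_mod_cast (Finset.card_le_univ _).trans (by simp)
        gcongr
    have h2 := hU1 i i
    rw [Pi.single_eq_same] at h2
    have h3 := (abs_le.1 h2).1
    have h4 : (n : ℝ) * (1 / (2 * (n + 1))) + 1 / (2 * (n + 1)) = 1 / 2 := by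
      field_simp
    have h5 := le_abs_self (partialD i (U i) y)
    linarith

/-- An `f`-harmonic morphism is of class `C²`. -/
theorem IsFHarmonicMorphism.contMDiff {g : Metric m M} {h : Metric n N} {f : M → ℝ} {φ : M → N}
    (hφ : IsFHarmonicMorphism g h f φ) : ContMDiff (𝓡 m) (𝓡 n) 2 φ := by
  intro x₀
  set q := φ x₀ with hq
  set y := extChartAt (𝓡 n) q q
  obtain ⟨V, u, T, hV, hT, huT, hJ⟩ := exists_harmonic_coordinates h q
  obtain ⟨e, he⟩ := exists_hasFDerivAt_equiv (hT.differentiable two_ne_zero y) hJ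
  have hS := hT.contDiffAt.to_localInverse he two_ne_zero
  have hSl := (hT.contDiffAt.hasStrictFDerivAt' he two_ne_zero).eventually_left_inverse
  set S := hT.contDiffAt.localInverse he two_ne_zero
  -- The components `u i ∘ φ` are `f`-harmonic, and `C²` is part of that notion.
  have hK : ContMDiffAt (𝓡 m) (𝓡 n) 2
      (fun x => (WithLp.toLp 2 fun i => u i (φ x) : EuclideanSpace ℝ (Fin n))) x₀ := by
    have h1 : ContMDiffAt (𝓡 m) 𝓘(ℝ, Fin n → ℝ) 2 (fun x => fun i => u i (φ x)) x₀ := by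
      rw [contMDiffAt_pi_space]
      intro i
      exact (hφ.2 (V i) (u i) (hV i).1 ⟨x₀, (hV i).2.1⟩ (hV i).2.2).1.contMDiffAt
        (((hV i).1.preimage hφ.1).mem_nhds (hV i).2.1)
    have h2 : ContDiff ℝ 2 (fun v : Fin n → ℝ => (WithLp.toLp 2 v : EuclideanSpace ℝ (Fin n))) :=
      PiLp.contDiff_toLp
    exact h2.contMDiff.contMDiffAt.comp x₀ h1
  have hKT : ∀ x, (WithLp.toLp 2 fun i => u i (φ x) : EuclideanSpace ℝ (Fin n)) =
      T (extChartAt (𝓡 n) q (φ x)) := fun x => by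
    ext i
    exact huT i (φ x)
  rw [contMDiffAt_iff_target]
  refine ⟨hφ.1.continuousAt, ?_⟩
  have hS' : ContMDiffAt (𝓡 n) (𝓡 n) 2 S
      (WithLp.toLp 2 fun i => u i (φ x₀) : EuclideanSpace ℝ (Fin n)) := by
    rw [hKT]
    exact hS.contMDiffAt
  refine (hS'.comp x₀ hK).congr_of_eventuallyEq ?_
  -- `S` inverts `T` only near `y`; continuity of `φ` keeps the values in that region.
  have hc : ContinuousAt (fun x => extChartAt (𝓡 n) q (φ x)) x₀ :=
    (continuousAt_extChartAt (I := 𝓡 n) q).comp hφ.1.continuousAt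
  filter_upwards [hc.eventually hSl] with x hx
  simp only [Function.comp_apply, hKT]
  exact hx.symm

end Regularity

end FHarmonic
end

open scoped Manifold ContDiff

noncomputable section

namespace FHarmonic

open Filter Topology Bundle

/-! ### The composition formula in coordinates -/

section CoordinateFormulas

variable {m n : ℕ}

/-- The pushforward `gⁱʲ ∂ᵢΦᵃ ∂ⱼΦᵇ` of the cometric with matrix `(G z)⁻¹`. -/
def pushCometric (G : EuclideanSpace ℝ (Fin m) → Matrix (Fin m) (Fin m) ℝ)
    (Φ : EuclideanSpace ℝ (Fin m) → EuclideanSpace ℝ (Fin n)) (z : EuclideanSpace ℝ (Fin m)) :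
    Matrix (Fin n) (Fin n) ℝ := fun a b =>
  ∑ i, ∑ j, (G z)⁻¹ i j * (partialD i (fun w => Φ w a) z * partialD j (fun w => Φ w b) z)

/-- The components of the tension field in coordinates. -/
def coordTension (G : EuclideanSpace ℝ (Fin m) → Matrix (Fin m) (Fin m) ℝ)
    (H : EuclideanSpace ℝ (Fin n) → Matrix (Fin n) (Fin n) ℝ)
    (Φ : EuclideanSpace ℝ (Fin m) → EuclideanSpace ℝ (Fin n)) (z : EuclideanSpace ℝ (Fin m))
    (y : EuclideanSpace ℝ (Fin n)) (c : Fin n) : ℝ :=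
  ∑ i, ∑ j, (G z)⁻¹ i j * (coordHessian G (fun w => Φ w c) z i j +
    ∑ a, ∑ b, coordChristoffel H y c a b * partialD i (fun w => Φ w a) z *
      partialD j (fun w => Φ w b) z)

lemma sum_swap_pairs (F : Fin m → Fin m → Fin n → Fin n → ℝ) :
    ∑ i, ∑ j, ∑ a, ∑ b, F i j a b = ∑ a, ∑ b, ∑ i, ∑ j, F i j a b := by
  have h1 : ∀ i, ∑ j, ∑ a, ∑ b, F i j a b = ∑ a, ∑ b, ∑ j, F i j a b := fun i => by
    rw [Finset.sum_comm]
    exact Finset.sum_congr rfl fun a _ => Finset.sum_comm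
  simp only [h1]
  rw [Finset.sum_comm]
  exact Finset.sum_congr rfl fun a _ => Finset.sum_comm

lemma coordTension_eq (G : EuclideanSpace ℝ (Fin m) → Matrix (Fin m) (Fin m) ℝ)
    (H : EuclideanSpace ℝ (Fin n) → Matrix (Fin n) (Fin n) ℝ)
    (Φ : EuclideanSpace ℝ (Fin m) → EuclideanSpace ℝ (Fin n)) (z : EuclideanSpace ℝ (Fin m))
    (y : EuclideanSpace ℝ (Fin n)) (c : Fin n) :
    coordTension G H Φ z y c = coordLaplacian G (fun w => Φ w c) z +
      ∑ a, ∑ b, coordChristoffel H y c a b * pushCometric G Φ z a b := by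
  simp only [coordTension, coordLaplacian, mul_add, Finset.sum_add_distrib, pushCometric]
  congr 1
  simp only [Finset.mul_sum]
  rw [sum_swap_pairs]
  refine Finset.sum_congr rfl fun a _ => Finset.sum_congr rfl fun b _ =>
    Finset.sum_congr rfl fun i _ => Finset.sum_congr rfl fun j _ => ?_
  ring

variable {G : EuclideanSpace ℝ (Fin m) → Matrix (Fin m) (Fin m) ℝ}
  {H : EuclideanSpace ℝ (Fin n) → Matrix (Fin n) (Fin n) ℝ}
  {Φ : EuclideanSpace ℝ (Fin m) → EuclideanSpace ℝ (Fin n)} {z : EuclideanSpace ℝ (Fin m)}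

lemma coordHessian_comp_map {u : EuclideanSpace ℝ (Fin n) → ℝ} (hΦ : ContDiffAt ℝ 2 Φ z)
    (hu : ContDiffAt ℝ 2 u (Φ z)) (i j : Fin m) :
    coordHessian G (fun w => u (Φ w)) z i j =
      ∑ a, ∑ b, partialD i (fun w => Φ w a) z * partialD j (fun w => Φ w b) z *
        partialD a (partialD b u) (Φ z) +
      ∑ c, coordHessian G (fun w => Φ w c) z i j * partialD c u (Φ z) := by
  simp only [coordHessian]
  rw [partialD_partialD_comp hu hΦ, Finset.sum_comm, add_sub_assoc]
  congr 1
  simp only [sub_mul, Finset.sum_sub_distrib]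
  congr 1
  simp only [Finset.sum_mul]
  rw [Finset.sum_comm]
  refine Finset.sum_congr rfl fun k _ => ?_
  rw [partialD_comp (hu.differentiableAt two_ne_zero) (hΦ.differentiableAt two_ne_zero),
    Finset.mul_sum]
  refine Finset.sum_congr rfl fun c _ => ?_
  ring

/-- The Christoffel symbols of `H` enter the Hessian term and the tension term with opposite signs
and cancel, so the identity is the plain chain rule and holds for any `H`. -/
lemma coordLaplacian_comp_map {u : EuclideanSpace ℝ (Fin n) → ℝ} (hΦ : ContDiffAt ℝ 2 Φ z)
    (hu : ContDiffAt ℝ 2 u (Φ z)) :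
    coordLaplacian G (fun w => u (Φ w)) z =
      ∑ a, ∑ b, pushCometric G Φ z a b * coordHessian H u (Φ z) a b +
      ∑ c, coordTension G H Φ z (Φ z) c * partialD c u (Φ z) := by
  have h1 : coordLaplacian G (fun w => u (Φ w)) z =
      ∑ a, ∑ b, pushCometric G Φ z a b * partialD a (partialD b u) (Φ z) +
      ∑ c, coordLaplacian G (fun w => Φ w c) z * partialD c u (Φ z) := by
    simp only [coordLaplacian, coordHessian_comp_map hΦ hu, mul_add, Finset.sum_add_distrib]
    congr 1
    · simp only [pushCometric, Finset.mul_sum, Finset.sum_mul]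
      rw [sum_swap_pairs]
      refine Finset.sum_congr rfl fun a _ => Finset.sum_congr rfl fun b _ =>
        Finset.sum_congr rfl fun i _ => Finset.sum_congr rfl fun j _ => ?_
      ring
    · simp only [Finset.mul_sum, Finset.sum_mul]
      refine (Finset.sum_congr rfl fun i _ => Finset.sum_comm).trans (Finset.sum_comm.trans ?_)
      refine Finset.sum_congr rfl fun c _ => Finset.sum_congr rfl fun i _ =>
        Finset.sum_congr rfl fun j _ => ?_
      ring
  rw [h1]
  simp only [coordTension_eq, coordHessian, mul_sub, Finset.sum_sub_distrib, add_mul,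
    Finset.sum_add_distrib]
  have h2 : ∑ a, ∑ b, pushCometric G Φ z a b *
      ∑ c, coordChristoffel H (Φ z) c a b * partialD c u (Φ z) =
      ∑ c, (∑ a, ∑ b, coordChristoffel H (Φ z) c a b * pushCometric G Φ z a b) *
        partialD c u (Φ z) := by
    simp only [Finset.mul_sum, Finset.sum_mul]
    refine (Finset.sum_congr rfl fun i _ => Finset.sum_comm).trans (Finset.sum_comm.trans ?_)
    refine Finset.sum_congr rfl fun c _ => Finset.sum_congr rfl fun i _ =>
      Finset.sum_congr rfl fun j _ => ?_
    ring
  rw [h2]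
  ring

end CoordinateFormulas

/-! ### Maps in the preferred charts, and the jet condition. -/

section Maps

variable {m n : ℕ} {M N : Type*}
  [TopologicalSpace M] [ChartedSpace (EuclideanSpace ℝ (Fin m)) M]
  [TopologicalSpace N] [ChartedSpace (EuclideanSpace ℝ (Fin n)) N]

/-- The map `φ` in the preferred charts around `x` and `φ x`. -/
def localRep (φ : M → N) (x : M) (w : EuclideanSpace ℝ (Fin m)) : EuclideanSpace ℝ (Fin n) :=
  extChartAt (𝓡 n) (φ x) (φ ((extChartAt (𝓡 m) x).symm w))

/-- The differential of `φ` as a map of the model spaces. -/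
def dMap (φ : M → N) (x : M) : EuclideanSpace ℝ (Fin m) →L[ℝ] EuclideanSpace ℝ (Fin n) :=
  mfderiv (𝓡 m) (𝓡 n) φ x

lemma localRep_self (φ : M → N) (x : M) :
    localRep (n := n) φ x (extChartAt (𝓡 m) x x) = extChartAt (𝓡 n) (φ x) (φ x) := by
  simp only [localRep, extChartAt_to_inv]

lemma contDiffAt_localRep {φ : M → N} {x : M} (hφ : ContMDiffAt (𝓡 m) (𝓡 n) 2 φ x) :
    ContDiffAt ℝ 2 (localRep (n := n) φ x) (extChartAt (𝓡 m) x x) := by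
  have : ContDiffWithinAt ℝ 2 (localRep (n := n) φ x) (Set.range (𝓡 m)) (extChartAt (𝓡 m) x x) :=
    (contMDiffAt_iff.1 hφ).2
  rwa [ModelWithCorners.range_eq_univ, contDiffWithinAt_univ] at this

lemma dMap_eq_fderiv {φ : M → N} {x : M} (hφ : MDifferentiableAt (𝓡 m) (𝓡 n) φ x) :
    dMap (m := m) (n := n) φ x = fderiv ℝ (localRep φ x) (extChartAt (𝓡 m) x x) := by
  have h1 : HasFDerivWithinAt (localRep (n := n) φ x) (dMap (m := m) (n := n) φ x)
      (Set.range (𝓡 m)) (extChartAt (𝓡 m) x x) := hφ.hasMFDerivAt.2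
  rw [ModelWithCorners.range_eq_univ, hasFDerivWithinAt_univ] at h1
  exact h1.fderiv.symm

lemma dMap_apply {φ : M → N} {x : M} (hφ : ContMDiffAt (𝓡 m) (𝓡 n) 2 φ x)
    (v : EuclideanSpace ℝ (Fin m)) (c : Fin n) :
    dMap (n := n) φ x v c =
      ∑ i, v i * partialD i (fun w => localRep (n := n) φ x w c) (extChartAt (𝓡 m) x x) := by
  rw [dMap_eq_fderiv (hφ.mdifferentiableAt two_ne_zero), fderiv_apply_eq_sum, WithLp.ofLp_sum,
    Finset.sum_apply]
  refine Finset.sum_congr rfl fun i _ => ?_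
  rw [partialD_apply ((contDiffAt_localRep hφ).differentiableAt two_ne_zero)]
  rfl

variable [IsManifold (𝓡 m) ∞ M] [IsManifold (𝓡 n) ∞ N]

lemma metricForm_eq_sum (g : Metric m M) (x : M) (u v : EuclideanSpace ℝ (Fin m)) :
    metricForm g x u v = ∑ i, ∑ j, gram g x (extChartAt (𝓡 m) x x) i j * (u i * v j) := by
  rw [← metricForm_chartDeriv, chartDeriv_self, extChartAt_to_inv]
  rfl

/-- The gradient as a vector of the model space. -/
def gradVec (g : Metric m M) (u : M → ℝ) (x : M) : EuclideanSpace ℝ (Fin m) := grad g u x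

/-- The tension field as a vector of the model space. -/
def tensionVec (g : Metric m M) (h : Metric n N) (φ : M → N) (x : M) :
    EuclideanSpace ℝ (Fin n) := tension g h φ x

/-- The `f`-tension field as a vector of the model space. -/
def fTensionVec (g : Metric m M) (h : Metric n N) (f : M → ℝ) (φ : M → N) (x : M) :
    EuclideanSpace ℝ (Fin n) := fTension g h f φ x

/-- Lowering the index cancels the inverse Gram matrix in the gradient. -/
lemma metricForm_grad (g : Metric m M) (u : M → ℝ) (x : M) (v : EuclideanSpace ℝ (Fin m)) :
    metricForm g x v (gradVec g u x) =
      ∑ i, v i * partialD i (fun w => u ((extChartAt (𝓡 m) x).symm w)) (extChartAt (𝓡 m) x x) := by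
  set z := extChartAt (𝓡 m) x x with hz
  set d : Fin m → ℝ := fun j => partialD j (fun w => u ((extChartAt (𝓡 m) x).symm w)) z
  have h1 : ∀ j, gradVec g u x j = ((gram g x z)⁻¹.mulVec d) j :=
    fun j => rfl
  have h2 : (gram g x z).mulVec ((gram g x z)⁻¹.mulVec d) = d := by
    rw [Matrix.mulVec_mulVec,
      Matrix.mul_nonsing_inv _ (isUnit_det_gram g x (mem_extChartAt_target x)), Matrix.one_mulVec]
  rw [metricForm_eq_sum]
  refine Finset.sum_congr rfl fun i _ => ?_
  have h3 : ∑ j, gram g x z i j * ((gram g x z)⁻¹.mulVec d) j = d i := congrFun h2 i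
  rw [show partialD i (fun w => u ((extChartAt (𝓡 m) x).symm w)) z = d i from rfl, ← h3,
    Finset.mul_sum]
  refine Finset.sum_congr rfl fun j _ => ?_
  rw [h1, ← hz]
  ring

lemma tension_apply (g : Metric m M) (h : Metric n N) (φ : M → N) (x : M) (c : Fin n) :
    tensionVec g h φ x c =
      coordTension (gram g x) (gram h (φ x)) (localRep φ x) (extChartAt (𝓡 m) x x)
        (extChartAt (𝓡 n) (φ x) (φ x)) c := rfl

lemma fTension_apply (g : Metric m M) (h : Metric n N) (f : M → ℝ) (φ : M → N) (x : M)
    (c : Fin n) :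
    fTensionVec g h f φ x c =
      f x * tensionVec g h φ x c + dMap (n := n) φ x (gradVec g f x) c := rfl

/-- The gradient term equals dU(dφ(grad f)); it completes f dU(τ(φ)) to dU(τ_f(φ)). -/
lemma fLaplacian_comp {g : Metric m M} {h : Metric n N} {f : M → ℝ} {φ : M → N} {x : M}
    (hφ : ContMDiffAt (𝓡 m) (𝓡 n) 2 φ x) {U : EuclideanSpace ℝ (Fin n) → ℝ}
    (hU : ContDiffAt ℝ 2 U (extChartAt (𝓡 n) (φ x) (φ x))) :
    fLaplacian g f (fun x' => U (extChartAt (𝓡 n) (φ x) (φ x'))) x =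
      f x * ∑ a, ∑ b, pushCometric (gram g x) (localRep (n := n) φ x) (extChartAt (𝓡 m) x x) a b *
        coordHessian (gram h (φ x)) U (extChartAt (𝓡 n) (φ x) (φ x)) a b +
      ∑ c, fTensionVec g h f φ x c *
        partialD c U (extChartAt (𝓡 n) (φ x) (φ x)) := by
  have hΦ := contDiffAt_localRep hφ
  have hy := localRep_self (m := m) (n := n) φ x
  have h1 : fLaplacian g f (fun x' => U (extChartAt (𝓡 n) (φ x) (φ x'))) x =
      f x * coordLaplacian (gram g x) (fun w => U (localRep φ x w)) (extChartAt (𝓡 m) x x) +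
      metricForm g x (gradVec g f x) (gradVec g (fun x' => U (extChartAt (𝓡 n) (φ x) (φ x'))) x) := rfl
  have hU' : ContDiffAt ℝ 2 U (localRep φ x (extChartAt (𝓡 m) x x)) := by rwa [hy]
  rw [h1, coordLaplacian_comp_map (H := gram h (φ x)) hΦ hU', metricForm_grad]
  have h2 : ∀ i, partialD i (fun w => U (extChartAt (𝓡 n) (φ x)
      (φ ((extChartAt (𝓡 m) x).symm w)))) (extChartAt (𝓡 m) x x) =
      ∑ c, partialD i (fun w => localRep φ x w c) (extChartAt (𝓡 m) x x) *
        partialD c U (localRep φ x (extChartAt (𝓡 m) x x)) := fun i =>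
    partialD_comp (hU'.differentiableAt two_ne_zero) (hΦ.differentiableAt two_ne_zero) i
  simp only [h2, fTension_apply, tension_apply, dMap_apply hφ, hy, mul_add, add_mul, Finset.sum_add_distrib,
    add_assoc]
  congr 1
  simp only [Finset.mul_sum, Finset.sum_mul]
  congr 1
  · refine Finset.sum_congr rfl fun c _ => ?_
    ring
  · rw [Finset.sum_comm]
    refine Finset.sum_congr rfl fun c _ => Finset.sum_congr rfl fun i _ => ?_
    ring

/-- The conditions which an `f`-harmonic morphism imposes on 2-jets. -/
lemma IsFHarmonicMorphism.jet_condition {g : Metric m M} {h : Metric n N} {f : M → ℝ} {φ : M → N}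
    (hφ : IsFHarmonicMorphism g h f φ) (x : M) (ξ : Fin n → ℝ)
    {C : Matrix (Fin n) (Fin n) ℝ} (hC : ∀ i j, C i j = C j i)
    (htr : ∑ a, ∑ b, (gram h (φ x) (extChartAt (𝓡 n) (φ x) (φ x)))⁻¹ a b * C a b = 0) :
    f x * ∑ a, ∑ b, pushCometric (gram g x) (localRep (n := n) φ x) (extChartAt (𝓡 m) x x) a b * C a b +
      ∑ c, fTensionVec g h f φ x c * ξ c = 0 := by
  set y := extChartAt (𝓡 n) (φ x) (φ x) with hy
  set A := pushCometric (gram g x) (localRep (n := n) φ x) (extChartAt (𝓡 m) x x)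
  set Γ := coordChristoffel (gram h (φ x)) y
  -- The `f`-Laplacian of `U ∘ φ` at `x` as a continuous function of the first and second partial
  -- derivatives of `U`.
  let ℓ : (Fin n → ℝ) × (Fin n → Fin n → ℝ) → ℝ := fun p =>
    f x * ∑ a, ∑ b, A a b * (p.2 a b - ∑ k, Γ k a b * p.1 k) +
      ∑ c, fTensionVec g h f φ x c * p.1 c
  have hℓ : Continuous ℓ := by fun_prop
  -- Plain second derivatives whose covariant Hessian, given first derivatives ξ, is `C`.
  let C' : Fin n → Fin n → ℝ := fun a b => C a b + ∑ k, Γ k a b * ξ k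
  have hC' : ∀ a b, C' a b = C' b a := fun a b => by
    simp only [C', hC a b]
    congr 1
    exact Finset.sum_congr rfl fun k _ =>
      congrArg (· * ξ k) (coordChristoffel_comm (fun w => gram_comm h (φ x) w) y k a b)
  -- Jets of genuine harmonic functions are zeros of `ℓ` and come arbitrarily close to `(ξ, C')`. As
  -- the zero set is closed, approximate prescription of jets suffices.
  have hmem : (ξ, C') ∈ closure {p | ℓ p = 0} := by
    rw [Metric.mem_closure_iff]
    intro ε hε
    obtain ⟨V, u, U, hV, hqV, _, hu, hU, huU, hU1, hU2⟩ :=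
      exists_harmonic_near_jet h (φ x) ξ hC' (by
        refine Eq.trans (Finset.sum_congr rfl fun a _ => Finset.sum_congr rfl fun b _ => ?_) htr
        exact congrArg (_ * ·) (add_sub_cancel_right _ _)) (half_pos hε)
    refine ⟨(fun i => partialD i U y, fun i j => partialD i (partialD j U) y), ?_, ?_⟩
    · have h1 := (hφ.2 V u hV ⟨x, hqV⟩ hu).2 x hqV
      have h2 : u ∘ φ = fun x' => U (extChartAt (𝓡 n) (φ x) (φ x')) := by
        rw [huU]; rfl
      rw [h2, fLaplacian_comp (h := h) (hφ.contMDiff x) hU.contDiffAt] at h1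
      exact h1
    · refine lt_of_le_of_lt ?_ (half_lt_self hε)
      rw [Prod.dist_eq]
      refine max_le ((dist_pi_le_iff (half_pos hε).le).2 fun i => ?_)
        ((dist_pi_le_iff (half_pos hε).le).2 fun i =>
          (dist_pi_le_iff (half_pos hε).le).2 fun j => ?_)
      · rw [dist_comm, Real.dist_eq]; exact hU1 i
      · rw [dist_comm, Real.dist_eq]; exact hU2 i j
  rw [(isClosed_eq hℓ continuous_const).closure_eq] at hmem
  have : ℓ (ξ, C') = 0 := hmem
  simpa [ℓ, C'] using this

/-- With zero Hessian and an arbitrary differential, the jet condition isolates each component of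
the `f`-tension field. -/
lemma IsFHarmonicMorphism.fTension_eq_zero {g : Metric m M} {h : Metric n N} {f : M → ℝ}
    {φ : M → N} (hφ : IsFHarmonicMorphism g h f φ) (x : M) : fTension g h f φ x = 0 := by
  have key : fTensionVec g h f φ x = 0 := by
    ext c
    have := hφ.jet_condition x (Pi.single c 1) (C := 0) (by simp) (by simp)
    simpa [Pi.single_apply] using this
  exact key

end Maps

end FHarmonic
end

open scoped Manifold ContDiff

noncomputable section

namespace FHarmonic

open Filter Topology Bundle

/-! ### Linear algebra of horizontal conformality. -/

section LinearAlgebra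

open Matrix
open scoped MatrixOrder

variable {m n : ℕ}

lemma sum_mul_eq_trace (A C : Matrix (Fin n) (Fin n) ℝ) (hC : ∀ i j, C i j = C j i) :
    ∑ a, ∑ b, A a b * C a b = (A * C).trace := by
  simp only [trace, diag, mul_apply]
  exact Finset.sum_congr rfl fun a _ => Finset.sum_congr rfl fun b _ => by rw [hC a b]

/-- A symmetric matrix `D` with `tr (D H D H) = 0` for a positive definite `H` vanishes. -/
lemma eq_zero_of_trace_eq_zero {H D : Matrix (Fin n) (Fin n) ℝ} (hH : H.PosDef) (hD : Dᵀ = D)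
    (htr : (D * (H * D * H)).trace = 0) : D = 0 := by
  -- Writing H = Bᵀ B turns the trace into the squared Frobenius norm of B D Bᵀ.
  obtain ⟨B, hB⟩ : ∃ B : Matrix (Fin n) (Fin n) ℝ, H = Bᵀ * B := by
    obtain ⟨B, hB⟩ := CStarAlgebra.nonneg_iff_eq_star_mul_self.1 hH.posSemidef.nonneg
    exact ⟨B, by rw [hB, star_eq_conjTranspose, conjTranspose_eq_transpose_of_trivial]⟩
  have hE : ((B * D * Bᵀ)ᴴ * (B * D * Bᵀ)).trace = 0 := by
    rw [← htr, conjTranspose_eq_transpose_of_trivial, transpose_mul, transpose_mul, hD,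
      transpose_transpose, hB, trace_mul_comm]
    simp only [← mul_assoc]
    rw [trace_mul_comm]
    simp only [← mul_assoc]
    rw [trace_mul_comm]
    simp only [← mul_assoc]
  rw [trace_conjTranspose_mul_self_eq_zero_iff] at hE
  have h1 : H * D * H = 0 := by
    rw [hB, show Bᵀ * B * D * (Bᵀ * B) = Bᵀ * (B * D * Bᵀ) * B by simp only [mul_assoc], hE]
    simp
  have hu : IsUnit H := hH.isUnit
  have h2 : H * D = 0 := by simpa using (hu.mul_left_eq_zero).1 h1
  exact (hu.mul_right_eq_zero).1 h2

/-- A functional vanishing on the kernel of the trace is a multiple of it. Contraction with `H`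
forces the factor tr(A H)/n; the remainder `D` is trace-free, and testing with C = H D H gives tr(D
H D H) = 0. -/
lemma exists_eq_smul_inv {H A : Matrix (Fin n) (Fin n) ℝ} (hH : H.PosDef)
    (hA : ∀ i j, A i j = A j i)
    (h : ∀ C : Matrix (Fin n) (Fin n) ℝ, (∀ i j, C i j = C j i) →
      ∑ a, ∑ b, H⁻¹ a b * C a b = 0 → ∑ a, ∑ b, A a b * C a b = 0) :
    ∃ μ : ℝ, A = μ • H⁻¹ := by
  rcases Nat.eq_zero_or_pos n with rfl | hn
  · exact ⟨0, Subsingleton.elim _ _⟩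
  have hdet : IsUnit H.det := (isUnit_iff_isUnit_det _).1 hH.isUnit
  have hHs : Hᵀ = H := hH.isHermitian
  have hHi : H⁻¹ᵀ = H⁻¹ := by rw [transpose_nonsing_inv, hHs]
  refine ⟨(A * H).trace / n, sub_eq_zero.1 ?_⟩
  set D := A - ((A * H).trace / n) • H⁻¹ with hDdef
  have hAs : Aᵀ = A := by ext i j; exact hA j i
  have hD : Dᵀ = D := by rw [hDdef, transpose_sub, transpose_smul, hHi, hAs]
  have hCs : (H * D * H)ᵀ = H * D * H := by
    rw [transpose_mul, transpose_mul, hHs, hD, mul_assoc]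
  have hCs' : ∀ i j, (H * D * H) i j = (H * D * H) j i := fun i j => by
    conv_lhs => rw [← hCs]
    rfl
  have hDH : (D * H).trace = 0 := by
    rw [hDdef, sub_mul, smul_mul_assoc, nonsing_inv_mul _ hdet, trace_sub, trace_smul, trace_one,
      Fintype.card_fin, smul_eq_mul, div_mul_cancel₀ _ (by positivity), sub_self]
  have h1 : (H⁻¹ * (H * D * H)).trace = 0 := by
    rw [mul_assoc, nonsing_inv_mul_cancel_left _ _ hdet, hDH]
  have h2 := h _ hCs' (by rw [sum_mul_eq_trace _ _ hCs', h1])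
  rw [sum_mul_eq_trace _ _ hCs'] at h2
  refine eq_zero_of_trace_eq_zero hH hD ?_
  have h3 : A = D + ((A * H).trace / n) • H⁻¹ := by rw [hDdef, sub_add_cancel]
  rw [h3, add_mul, smul_mul_assoc, trace_add, trace_smul, h1, smul_zero, add_zero] at h2
  exact h2

variable {G : Matrix (Fin m) (Fin m) ℝ} {H : Matrix (Fin n) (Fin n) ℝ}
  {L : Matrix (Fin n) (Fin m) ℝ} {μ : ℝ}

/-- A nonzero row of `L` gives a positive diagonal entry on the left, while the diagonal of H⁻¹ is
positive. -/
lemma pos_of_mul_inv_mul_transpose (hG : G.PosDef) (hH : H.PosDef)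
    (h : L * G⁻¹ * Lᵀ = μ • H⁻¹) (hL : L ≠ 0) : 0 < μ := by
  obtain ⟨a, ha⟩ : ∃ a, L a ≠ 0 := by
    by_contra! hc
    exact hL (funext hc)
  have h1 : 0 < L a ⬝ᵥ (G⁻¹ *ᵥ L a) := by simpa using hG.inv.dotProduct_mulVec_pos ha
  have h2 : 0 < H⁻¹ a a := hH.inv.diag_pos
  have h3 : L a ⬝ᵥ (G⁻¹ *ᵥ L a) = (L * G⁻¹ * Lᵀ) a a := by
    rw [Matrix.mul_assoc]
    simp only [Matrix.mul_apply, dotProduct, mulVec, transpose_apply]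
  rw [h3, h, Matrix.smul_apply, smul_eq_mul] at h1
  exact (pos_iff_pos_of_mul_pos h1).2 h2

/-- The horizontal lift of a vector. -/
lemma exists_horizontal_lift (hG : G.PosDef) (hH : H.PosDef)
    (h : L * G⁻¹ * Lᵀ = μ • H⁻¹) (hμ : μ ≠ 0) (v : Fin n → ℝ) :
    ∃ X : Fin m → ℝ, L *ᵥ X = v ∧ ∀ Y, X ⬝ᵥ (G *ᵥ Y) = μ⁻¹ * (v ⬝ᵥ (H *ᵥ (L *ᵥ Y))) := by
  have hGd : IsUnit G.det := (isUnit_iff_isUnit_det _).1 hG.isUnit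
  have hHd : IsUnit H.det := (isUnit_iff_isUnit_det _).1 hH.isUnit
  have hGs : Gᵀ = G := hG.isHermitian
  have hHs : Hᵀ = H := hH.isHermitian
  -- The matrix G⁻¹ Lᵀ H is the adjoint of `L` for the two inner products, and `L` times its adjoint
  -- is μ.
  refine ⟨μ⁻¹ • ((G⁻¹ * Lᵀ * H) *ᵥ v), ?_, fun Y => ?_⟩
  · rw [mulVec_smul, mulVec_mulVec, ← Matrix.mul_assoc, ← Matrix.mul_assoc, h, smul_mul_assoc,
      nonsing_inv_mul _ hHd, smul_mulVec, one_mulVec, smul_smul, inv_mul_cancel₀ hμ, one_smul]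
  · have h1 : (G⁻¹ * Lᵀ * H)ᵀ * G = H * L := by
      rw [transpose_mul, transpose_mul, transpose_transpose, transpose_nonsing_inv, hGs, hHs,
        Matrix.mul_assoc, Matrix.mul_assoc, nonsing_inv_mul _ hGd, Matrix.mul_one]
    rw [smul_dotProduct, smul_eq_mul, mulVec_mulVec Y H, ← h1, ← mulVec_mulVec Y, dotProduct_mulVec v,
      vecMul_transpose]

/-- A horizontal vector equals the lift of its image: their difference lies in the kernel and is
orthogonal to it. -/
lemma conformal_of_horizontal (hG : G.PosDef) (hH : H.PosDef)
    (h : L * G⁻¹ * Lᵀ = μ • H⁻¹) (hμ : μ ≠ 0) {X : Fin m → ℝ}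
    (hX : ∀ V, L *ᵥ V = 0 → X ⬝ᵥ (G *ᵥ V) = 0) (Y : Fin m → ℝ) :
    (L *ᵥ X) ⬝ᵥ (H *ᵥ (L *ᵥ Y)) = μ * (X ⬝ᵥ (G *ᵥ Y)) := by
  obtain ⟨X', h1, h2⟩ := exists_horizontal_lift hG hH h hμ (L *ᵥ X)
  have h3 : L *ᵥ (X - X') = 0 := by rw [mulVec_sub, h1, sub_self]
  have h4 : (X - X') ⬝ᵥ (G *ᵥ (X - X')) = 0 := by
    rw [sub_dotProduct, hX _ h3, h2, h3, mulVec_zero, dotProduct_zero, mul_zero, sub_zero]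
  have h5 : X = X' := by
    by_contra hne
    have := hG.dotProduct_mulVec_pos (sub_ne_zero.2 hne)
    rw [star_trivial, h4] at this
    exact lt_irrefl _ this
  conv_rhs => rw [h5, h2, ← mul_assoc, mul_inv_cancel₀ hμ, one_mul]

end LinearAlgebra

/-! ### The dilation of an `f`-harmonic morphism. -/

section Conformality

variable {m n : ℕ} {M N : Type*}
  [TopologicalSpace M] [ChartedSpace (EuclideanSpace ℝ (Fin m)) M]
  [TopologicalSpace N] [ChartedSpace (EuclideanSpace ℝ (Fin n)) N]
  {f : M → ℝ} {φ : M → N} {x : M}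

/-- The Jacobian matrix of `φ` in the preferred charts. -/
def jacobianAt (φ : M → N) (x : M) : Matrix (Fin n) (Fin m) ℝ := fun c i =>
  partialD i (fun w => localRep (n := n) φ x w c) (extChartAt (𝓡 m) x x)

lemma ofLp_dMap (hφ : ContMDiffAt (𝓡 m) (𝓡 n) 2 φ x) (v : EuclideanSpace ℝ (Fin m)) :
    (dMap (m := m) (n := n) φ x v).ofLp = (jacobianAt (m := m) (n := n) φ x).mulVec v.ofLp := by
  ext c
  rw [dMap_apply hφ]
  exact Finset.sum_congr rfl fun i _ => mul_comm _ _

lemma jacobianAt_eq_zero_iff (hφ : ContMDiffAt (𝓡 m) (𝓡 n) 2 φ x) :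
    jacobianAt (m := m) (n := n) φ x = 0 ↔ dMap (m := m) (n := n) φ x = 0 := by
  refine ⟨fun hJ => ?_, fun hd => ?_⟩
  · ext v c
    rw [ofLp_dMap hφ, hJ, Matrix.zero_mulVec]
    rfl
  · refine Matrix.ext_of_mulVec_single fun i => ?_
    have := ofLp_dMap (n := n) hφ (WithLp.toLp 2 (Pi.single i 1))
    rw [hd] at this
    rw [← this, Matrix.zero_mulVec]
    rfl

variable [IsManifold (𝓡 m) ∞ M] {g : Metric m M}

/-- The matrix of the metric at `x` in the preferred chart around `x`. -/
def gramAt (g : Metric m M) (x : M) : Matrix (Fin m) (Fin m) ℝ := gram g x (extChartAt (𝓡 m) x x)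

lemma posDef_gramAt (g : Metric m M) (x : M) : (gramAt g x).PosDef :=
  posDef_gram g x (mem_extChartAt_target x)

lemma metricForm_eq_dotProduct (g : Metric m M) (x : M) (u v : EuclideanSpace ℝ (Fin m)) :
    metricForm g x u v = u.ofLp ⬝ᵥ (gramAt g x).mulVec v.ofLp := by
  rw [metricForm_eq_sum]
  simp only [dotProduct, Matrix.mulVec, Finset.mul_sum, gramAt]
  exact Finset.sum_congr rfl fun i _ => Finset.sum_congr rfl fun j _ => by ring

lemma pushCometric_eq (g : Metric m M) (φ : M → N) (x : M) :
    pushCometric (gram g x) (localRep (n := n) φ x) (extChartAt (𝓡 m) x x) =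
      jacobianAt (m := m) (n := n) φ x * (gramAt g x)⁻¹ * (jacobianAt (m := m) (n := n) φ x).transpose := by
  ext a b
  rw [Matrix.mul_assoc]
  simp only [Matrix.mul_apply, Matrix.transpose_apply, Finset.mul_sum]
  refine Finset.sum_congr rfl fun i _ => Finset.sum_congr rfl fun j _ => ?_
  simp only [jacobianAt, gramAt]
  ring

lemma mem_horizontal_iff (hφ : ContMDiffAt (𝓡 m) (𝓡 n) 2 φ x) (X : EuclideanSpace ℝ (Fin m)) :
    (show TangentSpace (𝓡 m) x from X) ∈ horizontal (n := n) g φ x ↔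
      ∀ V, (jacobianAt (m := m) (n := n) φ x).mulVec V = 0 → X.ofLp ⬝ᵥ (gramAt g x).mulVec V = 0 := by
  have h1 : (show TangentSpace (𝓡 m) x from X) ∈ horizontal (n := n) g φ x ↔
      ∀ V : EuclideanSpace ℝ (Fin m), dMap (m := m) (n := n) φ x V = 0 → metricForm g x X V = 0 := Iff.rfl
  rw [h1]
  refine ⟨fun H V hV => ?_, fun H V hV => ?_⟩
  · rw [← metricForm_eq_dotProduct g x X (WithLp.toLp 2 V)]
    refine H _ ?_
    ext c
    rw [ofLp_dMap hφ, hV]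
    rfl
  · rw [metricForm_eq_dotProduct]
    refine H _ ?_
    rw [← ofLp_dMap hφ, hV]
    rfl

variable [IsManifold (𝓡 n) ∞ N] {h : Metric n N}

/-- For an `f`-harmonic morphism, the pushforward of the cometric is proportional to the
cometric of the target. -/
lemma IsFHarmonicMorphism.exists_pushCometric (hφ : IsFHarmonicMorphism g h f φ)
    (hf : f x ≠ 0) :
    ∃ μ : ℝ, jacobianAt (m := m) (n := n) φ x * (gramAt g x)⁻¹ * (jacobianAt (m := m) (n := n) φ x).transpose =
      μ • (gramAt h (φ x))⁻¹ := by
  rw [← pushCometric_eq]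
  refine exists_eq_smul_inv (posDef_gramAt h (φ x)) (fun i j => ?_) fun C hC htr => ?_
  · rw [pushCometric_eq]
    have hG : (gramAt g x).transpose = gramAt g x := (posDef_gramAt g x).isHermitian
    have : (jacobianAt (m := m) (n := n) φ x * (gramAt g x)⁻¹ *
        (jacobianAt (m := m) (n := n) φ x).transpose).transpose = jacobianAt (m := m) (n := n) φ x * (gramAt g x)⁻¹ *
          (jacobianAt (m := m) (n := n) φ x).transpose := by
      rw [Matrix.transpose_mul, Matrix.transpose_mul, Matrix.transpose_transpose,
        Matrix.transpose_nonsing_inv, hG, Matrix.mul_assoc]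
    conv_lhs => rw [← this]
    rfl
  · have := hφ.jet_condition x 0 hC htr
    simpa [hf] using this

/-- The conformality relation on horizontal vectors, and horizontal lifts. -/
lemma conformal_of_pushCometric {μ : ℝ} (hφ : ContMDiffAt (𝓡 m) (𝓡 n) 2 φ x)
    (hμ : jacobianAt (m := m) (n := n) φ x * (gramAt g x)⁻¹ * (jacobianAt (m := m) (n := n) φ x).transpose =
      μ • (gramAt h (φ x))⁻¹) (hμ0 : μ ≠ 0) {X : EuclideanSpace ℝ (Fin m)}
    (hX : (show TangentSpace (𝓡 m) x from X) ∈ horizontal (n := n) g φ x)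
    (Y : EuclideanSpace ℝ (Fin m)) :
    metricForm h (φ x) (dMap φ x X) (dMap φ x Y) = μ * metricForm g x X Y := by
  rw [metricForm_eq_dotProduct, metricForm_eq_dotProduct, ofLp_dMap hφ, ofLp_dMap hφ]
  exact conformal_of_horizontal (posDef_gramAt g x) (posDef_gramAt h (φ x)) hμ hμ0
    ((mem_horizontal_iff hφ X).1 hX) Y.ofLp

lemma exists_horizontal_of_pushCometric {μ : ℝ} (hφ : ContMDiffAt (𝓡 m) (𝓡 n) 2 φ x)
    (hμ : jacobianAt (m := m) (n := n) φ x * (gramAt g x)⁻¹ * (jacobianAt (m := m) (n := n) φ x).transpose =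
      μ • (gramAt h (φ x))⁻¹) (hμ0 : μ ≠ 0) (v : EuclideanSpace ℝ (Fin n)) :
    ∃ X : EuclideanSpace ℝ (Fin m),
      (show TangentSpace (𝓡 m) x from X) ∈ horizontal (n := n) g φ x ∧ dMap φ x X = v := by
  obtain ⟨X, h1, h2⟩ :=
    exists_horizontal_lift (posDef_gramAt g x) (posDef_gramAt h (φ x)) hμ hμ0 v.ofLp
  refine ⟨WithLp.toLp 2 X, (mem_horizontal_iff hφ _).2 fun V hV => ?_, ?_⟩
  · rw [h2, hV]
    simp
  · ext c
    rw [ofLp_dMap hφ, h1]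

/-- An `f`-harmonic morphism is horizontally weakly conformal. -/
lemma IsFHarmonicMorphism.exists_isHWCWithDilation (hφ : IsFHarmonicMorphism g h f φ)
    (hf : ∀ x, f x ≠ 0) : ∃ lam : M → ℝ, IsHWCWithDilation g h φ lam := by
  classical
  choose μ hμ using fun x => hφ.exists_pushCometric (hf x)
  have hC := hφ.contMDiff
  -- The case split also covers `n = 0`, where the differential vanishes and `μ` is arbitrary.
  refine ⟨fun x => if dMap (m := m) (n := n) φ x = 0 then 0 else √(μ x),
    hC.mdifferentiable two_ne_zero, fun x => ⟨fun h0 => if_pos h0, fun h0 => ?_⟩⟩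
  have h0' : dMap (m := m) (n := n) φ x ≠ 0 := h0
  have hpos : 0 < μ x := pos_of_mul_inv_mul_transpose (posDef_gramAt g x)
    (posDef_gramAt h (φ x)) (hμ x) fun hJ => h0' ((jacobianAt_eq_zero_iff (hC x)).1 hJ)
  simp only [if_neg h0', Real.sq_sqrt hpos.le]
  refine ⟨Real.sqrt_pos.2 hpos, fun v _ => ?_, fun X hX Y _ => ?_⟩
  · exact exists_horizontal_of_pushCometric (hC x) (hμ x) hpos.ne' v
  · exact conformal_of_pushCometric (hC x) (hμ x) hpos.ne' hX Y

/-- The dilation is determined by the pushforward of the cometric. -/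
lemma IsFHarmonicMorphism.pushCometric_eq_sq_smul (hφ : IsFHarmonicMorphism g h f φ)
    (hf : f x ≠ 0) {lam : M → ℝ} (hlam : IsHWCWithDilation g h φ lam) :
    pushCometric (gram g x) (localRep (n := n) φ x) (extChartAt (𝓡 m) x x) =
      (lam x ^ 2) • (gram h (φ x) (extChartAt (𝓡 n) (φ x) (φ x)))⁻¹ := by
  have hC := hφ.contMDiff x
  obtain ⟨μ, hμ⟩ := hφ.exists_pushCometric hf
  rw [pushCometric_eq]
  by_cases h0 : dMap (m := m) (n := n) φ x = 0
  · rw [(hlam.2 x).1 h0, (jacobianAt_eq_zero_iff (n := n) hC).2 h0]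
    simp
  obtain ⟨_, hsurj, hconf⟩ := (hlam.2 x).2 h0
  have hpos : 0 < μ := pos_of_mul_inv_mul_transpose (posDef_gramAt g x)
    (posDef_gramAt h (φ x)) hμ fun hJ => h0 ((jacobianAt_eq_zero_iff hC).1 hJ)
  obtain ⟨v, hv⟩ : ∃ v, dMap (m := m) (n := n) φ x v ≠ 0 := by
    by_contra! hc
    exact h0 (ContinuousLinearMap.ext hc)
  -- A single horizontal vector with nonzero image compares the two factors and forces `μ = lam x ^
  -- 2`.
  obtain ⟨X, hX, hXv⟩ : ∃ X : EuclideanSpace ℝ (Fin m),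
      (show TangentSpace (𝓡 m) x from X) ∈ horizontal (n := n) g φ x ∧
        dMap (m := m) (n := n) φ x X = dMap (m := m) (n := n) φ x v :=
    hsurj (Set.mem_univ (dMap (m := m) (n := n) φ x v))
  have hXv' : dMap (m := m) (n := n) φ x X ≠ 0 := fun h => hv (hXv.symm.trans h)
  have hX0 : X ≠ 0 := fun h => hXv' (by rw [h]; exact map_zero (dMap (m := m) (n := n) φ x))
  have h1 : metricForm h (φ x) (dMap φ x X) (dMap φ x X) = lam x ^ 2 * metricForm g x X X :=
    hconf X hX X hX
  rw [conformal_of_pushCometric hC hμ hpos.ne' hX] at h1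
  have h2 : 0 < metricForm g x X X := g.pos x X hX0
  rw [hμ, mul_right_cancel₀ h2.ne' h1]
  rfl

end Conformality

/-! ### The composition law for tension fields. -/

section Composition

variable {m n l : ℕ}

lemma pushCometric_congr {G : EuclideanSpace ℝ (Fin m) → Matrix (Fin m) (Fin m) ℝ}
    {Φ Φ' : EuclideanSpace ℝ (Fin m) → EuclideanSpace ℝ (Fin n)} {z : EuclideanSpace ℝ (Fin m)}
    (h : Φ =ᶠ[𝓝 z] Φ') : pushCometric G Φ z = pushCometric G Φ' z := by
  have h1 : ∀ a, (fun w => Φ w a) =ᶠ[𝓝 z] fun w => Φ' w a := fun a =>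
    h.mono fun w hw => congrArg (fun v : EuclideanSpace ℝ (Fin n) => v a) hw
  ext a b
  simp only [pushCometric, partialD_congr (h1 _)]

lemma coordTension_congr {G : EuclideanSpace ℝ (Fin m) → Matrix (Fin m) (Fin m) ℝ}
    {H : EuclideanSpace ℝ (Fin n) → Matrix (Fin n) (Fin n) ℝ}
    {Φ Φ' : EuclideanSpace ℝ (Fin m) → EuclideanSpace ℝ (Fin n)} {z : EuclideanSpace ℝ (Fin m)}
    {y : EuclideanSpace ℝ (Fin n)} (h : Φ =ᶠ[𝓝 z] Φ') (c : Fin n) :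
    coordTension G H Φ z y c = coordTension G H Φ' z y c := by
  have h1 : (fun w => Φ w c) =ᶠ[𝓝 z] fun w => Φ' w c :=
    h.mono fun w hw => congrArg (fun v : EuclideanSpace ℝ (Fin n) => v c) hw
  rw [coordTension_eq, coordTension_eq, coordLaplacian_congr h1, pushCometric_congr h]

/-- Pushforward of cometrics is functorial, and the first pushforward is a multiple of the cometric
of the middle space. -/
lemma pushCometric_comp {G : EuclideanSpace ℝ (Fin m) → Matrix (Fin m) (Fin m) ℝ}
    {H : EuclideanSpace ℝ (Fin n) → Matrix (Fin n) (Fin n) ℝ}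
    {Φ : EuclideanSpace ℝ (Fin m) → EuclideanSpace ℝ (Fin n)}
    {Ψ : EuclideanSpace ℝ (Fin n) → EuclideanSpace ℝ (Fin l)} {z : EuclideanSpace ℝ (Fin m)}
    (hΦ : DifferentiableAt ℝ Φ z) (hΨ : ∀ c, DifferentiableAt ℝ (fun w => Ψ w c) (Φ z)) {s : ℝ}
    (hs : pushCometric G Φ z = s • (H (Φ z))⁻¹) (a b : Fin l) :
    pushCometric G (fun w => Ψ (Φ w)) z a b = s * pushCometric H Ψ (Φ z) a b := by
  have h1 : ∀ i c, partialD i (fun w => Ψ (Φ w) c) z =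
      ∑ d, partialD i (fun w => Φ w d) z * partialD d (fun w => Ψ w c) (Φ z) := fun i c =>
    partialD_comp (hΨ c) hΦ i
  have h2 : pushCometric G (fun w => Ψ (Φ w)) z a b = ∑ d, ∑ e, pushCometric G Φ z d e *
      (partialD d (fun w => Ψ w a) (Φ z) * partialD e (fun w => Ψ w b) (Φ z)) := by
    simp only [pushCometric, h1, Finset.sum_mul_sum]
    simp only [Finset.mul_sum, Finset.sum_mul]
    rw [sum_swap_pairs]
    refine Finset.sum_congr rfl fun d _ => Finset.sum_congr rfl fun e _ =>
      Finset.sum_congr rfl fun i _ => Finset.sum_congr rfl fun j _ => ?_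
    ring
  rw [h2, hs]
  simp only [pushCometric, Finset.mul_sum, Matrix.smul_apply, smul_eq_mul, mul_assoc]

/-- The composition law in coordinates, for a map which is horizontally conformal at `z`. -/
lemma coordTension_comp {G : EuclideanSpace ℝ (Fin m) → Matrix (Fin m) (Fin m) ℝ}
    {H : EuclideanSpace ℝ (Fin n) → Matrix (Fin n) (Fin n) ℝ}
    {K : EuclideanSpace ℝ (Fin l) → Matrix (Fin l) (Fin l) ℝ}
    {Φ : EuclideanSpace ℝ (Fin m) → EuclideanSpace ℝ (Fin n)}
    {Ψ : EuclideanSpace ℝ (Fin n) → EuclideanSpace ℝ (Fin l)} {z : EuclideanSpace ℝ (Fin m)}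
    (hΦ : ContDiffAt ℝ 2 Φ z) (hΨ : ∀ c, ContDiffAt ℝ 2 (fun w => Ψ w c) (Φ z)) {s : ℝ}
    (hs : pushCometric G Φ z = s • (H (Φ z))⁻¹) (q : EuclideanSpace ℝ (Fin l)) (c : Fin l) :
    coordTension G K (fun w => Ψ (Φ w)) z q c =
      ∑ d, coordTension G H Φ z (Φ z) d * partialD d (fun w => Ψ w c) (Φ z) +
      s * coordTension H K Ψ (Φ z) q c := by
  -- Proportionality of the cometrics is used twice: the Hessian trace becomes `s` times a
  -- Laplacian, and the Christoffel term of `K` also scales by `s`.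
  rw [coordTension_eq, coordTension_eq H K, coordLaplacian_comp_map (H := H) hΦ (hΨ c)]
  simp only [pushCometric_comp (hΦ.differentiableAt two_ne_zero)
    (fun c => (hΨ c).differentiableAt two_ne_zero) hs, hs, Matrix.smul_apply, smul_eq_mul, mul_add,
    coordLaplacian, Finset.mul_sum]
  rw [add_comm (∑ a, ∑ b, _), add_assoc]
  congr 2
  · exact Finset.sum_congr rfl fun a _ => Finset.sum_congr rfl fun b _ => by ring
  · exact Finset.sum_congr rfl fun a _ => Finset.sum_congr rfl fun b _ => by ring

variable {M N Q : Type*}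
  [TopologicalSpace M] [ChartedSpace (EuclideanSpace ℝ (Fin m)) M]
  [TopologicalSpace N] [ChartedSpace (EuclideanSpace ℝ (Fin n)) N]
  [TopologicalSpace Q] [ChartedSpace (EuclideanSpace ℝ (Fin l)) Q]

/-- Continuity of `φ` keeps nearby values in the chart around `φ x`, where chart and inverse chart
cancel. -/
lemma localRep_comp_eventuallyEq {φ : M → N} (hφ : Continuous φ) (ψ : N → Q) (x : M) :
    localRep (n := l) (ψ ∘ φ) x =ᶠ[𝓝 (extChartAt (𝓡 m) x x)]
      fun w => localRep (m := n) (n := l) ψ (φ x) (localRep (m := m) (n := n) φ x w) := by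
  have h1 : ContinuousAt (fun w => φ ((extChartAt (𝓡 m) x).symm w)) (extChartAt (𝓡 m) x x) := by
    refine hφ.continuousAt.comp ?_
    exact continuousAt_extChartAt_symm x
  have h2 : ∀ᶠ w in 𝓝 (extChartAt (𝓡 m) x x),
      φ ((extChartAt (𝓡 m) x).symm w) ∈ (extChartAt (𝓡 n) (φ x)).source := by
    refine h1.eventually ?_
    simp only [extChartAt_to_inv]
    exact extChartAt_source_mem_nhds (φ x)
  refine h2.mono fun w hw => ?_
  simp only [localRep, Function.comp_apply, (extChartAt (𝓡 n) (φ x)).left_inv hw]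

variable [IsManifold (𝓡 m) ∞ M] [IsManifold (𝓡 n) ∞ N] [IsManifold (𝓡 l) ∞ Q]

/-- The composition law for the tension field. -/
lemma tensionVec_comp {g : Metric m M} {h : Metric n N} (k : Metric l Q) {φ : M → N} {ψ : N → Q}
    (hφ : ContMDiff (𝓡 m) (𝓡 n) 2 φ) (hψ : ContMDiff (𝓡 n) (𝓡 l) 2 ψ) {x : M} {s : ℝ}
    (hs : pushCometric (gram g x) (localRep (n := n) φ x) (extChartAt (𝓡 m) x x) =
      s • (gram h (φ x) (extChartAt (𝓡 n) (φ x) (φ x)))⁻¹) :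
    tensionVec g k (ψ ∘ φ) x =
      dMap ψ (φ x) (tensionVec g h φ x) + s • tensionVec h k ψ (φ x) := by
  have hy := localRep_self (m := m) (n := n) φ x
  have hΨ : ∀ c, ContDiffAt ℝ 2 (fun w => localRep (m := n) (n := l) ψ (φ x) w c)
      (localRep (n := n) φ x (extChartAt (𝓡 m) x x)) := fun c => by
    rw [hy]
    exact contDiffAt_coord (contDiffAt_localRep (hψ (φ x))) c
  ext c
  have h1 := coordTension_comp (K := gram k (ψ (φ x))) (contDiffAt_localRep (hφ x)) hΨ
    (H := gram h (φ x)) (G := gram g x) (by rwa [hy]) (extChartAt (𝓡 l) (ψ (φ x)) (ψ (φ x))) c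
  rw [hy] at h1
  rw [tension_apply, coordTension_congr (localRep_comp_eventuallyEq (n := n) hφ.continuous ψ x) c]
  refine h1.trans ?_
  rw [PiLp.add_apply, PiLp.smul_apply, dMap_apply (hψ (φ x))]
  rfl

/-- The composition law for the `f`-tension field. -/
lemma fTension_comp {g : Metric m M} {h : Metric n N} (k : Metric l Q) (f : M → ℝ) {φ : M → N}
    {ψ : N → Q} (hφ : ContMDiff (𝓡 m) (𝓡 n) 2 φ) (hψ : ContMDiff (𝓡 n) (𝓡 l) 2 ψ) {x : M} {s : ℝ}
    (hs : pushCometric (gram g x) (localRep (n := n) φ x) (extChartAt (𝓡 m) x x) =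
      s • (gram h (φ x) (extChartAt (𝓡 n) (φ x) (φ x)))⁻¹) :
    fTension g k f (ψ ∘ φ) x = mfderiv (𝓡 n) (𝓡 l) ψ (φ x) (fTension g h f φ x) +
      (f x * s) • tension h k ψ (φ x) := by
  have h1 : dMap (m := m) (n := l) (ψ ∘ φ) x (gradVec g f x) =
      dMap ψ (φ x) (dMap (m := m) (n := n) φ x (gradVec g f x)) :=
    congrArg (fun T => T (gradVec g f x)) (mfderiv_comp (I := 𝓡 m) (I' := 𝓡 n) (I'' := 𝓡 l) x
      (hψ.mdifferentiable two_ne_zero (φ x)) (hφ.mdifferentiable two_ne_zero x))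
  have key : f x • tensionVec g k (ψ ∘ φ) x + dMap (m := m) (n := l) (ψ ∘ φ) x (gradVec g f x) =
      dMap ψ (φ x) (f x • tensionVec g h φ x + dMap (m := m) (n := n) φ x (gradVec g f x)) +
        (f x * s) • tensionVec h k ψ (φ x) := by
    rw [h1, tensionVec_comp k hφ hψ hs, map_add, map_smul, smul_add, smul_smul]
    abel
  exact key

end Composition

end FHarmonic
end

/-! ### The main theorem. -/

theorem mainTheorem3 {m n l : ℕ} {M N Q : Type*}
    [TopologicalSpace M] [ChartedSpace (EuclideanSpace ℝ (Fin m)) M] [IsManifold (𝓡 m) ∞ M]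
    [TopologicalSpace N] [ChartedSpace (EuclideanSpace ℝ (Fin n)) N] [IsManifold (𝓡 n) ∞ N]
    [TopologicalSpace Q] [ChartedSpace (EuclideanSpace ℝ (Fin l)) Q] [IsManifold (𝓡 l) ∞ Q]
    (g : FHarmonic.Metric m M) (h : FHarmonic.Metric n N) (k : FHarmonic.Metric l Q)
    (f : M → ℝ) (hf : ContMDiff (𝓡 m) 𝓘(ℝ, ℝ) ∞ f) (hf_pos : ∀ x, 0 < f x)
    (φ : M → N) (hφ : FHarmonic.IsFHarmonicMorphism g h f φ) :
    (∀ ψ : N → Q, FHarmonic.IsHarmonicMap h k ψ → FHarmonic.IsFHarmonicMap g k f (ψ ∘ φ)) ∧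
    ContMDiff (𝓡 m) (𝓡 n) 2 φ ∧
    (∃ lam : M → ℝ, FHarmonic.IsHWCWithDilation g h φ lam) ∧
    ∀ lam : M → ℝ, FHarmonic.IsHWCWithDilation g h φ lam →
      ∀ ψ : N → Q, ContMDiff (𝓡 n) (𝓡 l) 2 ψ → ∀ x : M,
        FHarmonic.fTension g k f (ψ ∘ φ) x
          = mfderiv (𝓡 n) (𝓡 l) ψ (φ x) (FHarmonic.fTension g h f φ x)
            + (f x * lam x ^ 2) • FHarmonic.tension h k ψ (φ x) := by
  have hC := hφ.contMDiff
  have hne : ∀ x, f x ≠ 0 := fun x => (hf_pos x).ne'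
  have law : ∀ lam : M → ℝ, FHarmonic.IsHWCWithDilation g h φ lam →
      ∀ ψ : N → Q, ContMDiff (𝓡 n) (𝓡 l) 2 ψ → ∀ x : M,
        FHarmonic.fTension g k f (ψ ∘ φ) x
          = mfderiv (𝓡 n) (𝓡 l) ψ (φ x) (FHarmonic.fTension g h f φ x)
            + (f x * lam x ^ 2) • FHarmonic.tension h k ψ (φ x) :=
    fun lam hlam ψ hψ x =>
      FHarmonic.fTension_comp k f hC hψ (hφ.pushCometric_eq_sq_smul (hne x) hlam)
  obtain ⟨lam, hlam⟩ := hφ.exists_isHWCWithDilation hne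
  refine ⟨fun ψ hψ => ⟨hψ.1.comp hC, fun x => ?_⟩, hC, ⟨lam, hlam⟩, law⟩
  rw [law lam hlam ψ hψ.1 x, hφ.fTension_eq_zero x, hψ.2 (φ x), map_zero, smul_zero, add_zero]
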